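/- Let $m>1$, let $L$ be an oriented $m$-periodic link (preserved, with its orientation, by a rotation of $\mathbb{R}^3$ of order $m$ and disjoint from the axis) and let $D$ be an $m$-periodic diagram of $L$, i.e. a planar diagram preserved by the rotation of the plane of order $m$ and disjoint from its centre. Let $\mathbb{F}$ be a field, $\Lambda_m=\mathbb{F}[\mathbb{Z}_m]$, and let $M$ be a finitely generated $\Lambda_m$-module. For $h,t_0\in\mathbb{F}$ let $C^{*}_{h,t_0}(D)$ be the Khovanov-type cochain complex of $D$ over $\mathbb{F}$ given by the Frobenius algebra $A=\mathbb{F}[X]/(X^2-hX-t_0)$ with $\varepsilon(1)=0$, $\varepsilon(X)=1$, $\Delta(1)=1\otimes X+X\otimes 1-h\,1\otimes 1$, $\Delta(X)=X\otimes X+t_0\,1\otimes 1$. Here $(h,t_0)=(0,0)$ is the Khovanov complex, $(0,1)$ the Lee complex (used if $\operatorname{char}\mathbb{F}\ne 2$) and $(1,0)$ the Bar-Natan complex (used if $\operatorname{char}\mathbb{F}=2$). The rotation makes it a complex of $\Lambda_m$-modules, filtered by the quantum degree. For a projective resolution $P_*\to M$ over $\Lambda_m$ let $E^i(L;M)$ be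 the $i$-th cohomology of the total complex $\bigoplus_{a+b=i}\operatorname{Hom}_{\Lambda_m}(P_a,C^b_{h,t_0}(D))$ with the filtration induced by the quantum filtration, and put $$EP(L;M)=\sum_{i,k}t^iq^k\dim_{\mathbb{F}}\operatorname{Gr}^kE^i(L;M).$$ For the three theories this defines the equivariant Khovanov, Lee and Bar-Natan polynomials $\mathrm{EKhP}$, $\mathrm{ELeeP}$, $\mathrm{EBNP}$. They are Laurent series in $t$ with coefficients in $\mathbb{Z}_{\ge 0}[q^{\pm1}]$; the spaces $E^i(L;M)$ are finite-dimensional for the Khovanov theory and for the Lee theory (if $\operatorname{char}\mathbb{F}\neq2$), respectively the Bar-Natan theory (if $\operatorname{char}\mathbb{F}=2$). Then there are $R_1,R_2,\dots$, Laurent series in $t$ with coefficients in $\mathbb{Z}_{\ge0}[q^{\pm1}]$, all but finitely many of them zero, such that $$\mathrm{EKhP}(L;M)=\mathrm{ELeeP}(L;M)+\sum_{u\ge1}(1+tq^{4u})R_u\quad\text{if }\operatorname{char}\mathbb{F}\neq2,$$ $$\mathrm{EKhP}(L;M)=\mathrm{EBNP}(L;M)+\sum_{u\ge1}(1+tq^{2u})R_u\quad\text{if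 }\operatorname{char}\mathbb{F}=2.$$ If moreover $m$ is invertible in $\mathbb{F}$, then the $R_u$ can be chosen to be Laurent polynomials in $t$ and $q$ such that, $w$ being the width of $L$ over $\mathbb{F}$ (the maximum of $(j-2i)-(j'-2i')$ over all pairs with $\mathrm{Kh}^{i,j}(L;\mathbb{F})\ne0\ne\mathrm{Kh}^{i',j'}(L;\mathbb{F})$, where $i$ is the homological and $j$ the quantum degree), one has $R_u=0$ for all $u>w/2$ if $\operatorname{char}\mathbb{F}\ne2$, and $R_u=0$ for all $u>w$ if $\operatorname{char}\mathbb{F}=2$. -/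

import Mathlib

open CategoryTheory

universe u

/-! ## Oriented link diagrams -/

/-- A signed oriented Gauss code: the combinatorial data of an oriented link diagram.
The crossings are numbered by `Fin n`. A pair `(c, s)` is a passage through the crossing `c`, along
the overstrand if `s = true` and along the understrand if `s = false`. When one travels along the
link and has just made the passage `(c, s)`, the next passage is `next (c, s)`.
`positive c` records whether the crossing `c` is positive, and `loops` is the number of components
of the diagram that have no crossing at all. -/
structure GaussCode where
  n : ℕ
  loops : ℕ
  next : Equiv.Perm (Fin n × Bool)
  positive : Fin n → Bool

namespace GaussCode

/-- A half-edge `((c, s), o)` at the crossing `c`: it lies on the strand `s`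
(`true` for over, `false` for under) and leaves the crossing if `o = true`, enters it otherwise. -/
abbrev Dart (D : GaussCode) : Type := (Fin D.n × Bool) × Bool

/-- The next half-edge at the same crossing in the counterclockwise direction. Around a positive
crossing the counterclockwise order is over-in, under-in, over-out, under-out; around a negative
crossing it is over-in, under-out, over-out, under-in. -/
def rotate (D : GaussCode) : Equiv.Perm D.Dart where
  toFun d := ((d.1.1, !d.1.2), if D.positive d.1.1 = d.1.2 then d.2 else !d.2)
  invFun d := ((d.1.1, !d.1.2), if D.positive d.1.1 = !d.1.2 then d.2 else !d.2)
  left_inv := by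
    rintro ⟨⟨c, s⟩, o⟩
    cases s <;> cases o <;> cases h : D.positive c <;> simp [h]
  right_inv := by
    rintro ⟨⟨c, s⟩, o⟩
    cases s <;> cases o <;> cases h : D.positive c <;> simp [h]

/-- The other half of the edge that contains a given half-edge. -/
def opposite (D : GaussCode) : Equiv.Perm D.Dart where
  toFun d := if d.2 = true then (D.next d.1, false) else (D.next.symm d.1, true)
  invFun d := if d.2 = true then (D.next d.1, false) else (D.next.symm d.1, true)
  left_inv := by
    rintro ⟨p, o⟩
    cases o <;> simp
  right_inv := by
    rintro ⟨p, o⟩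
    cases o <;> simp

/-- The faces of the ribbon surface of the 4-valent graph of the diagram. -/
abbrev Face (D : GaussCode) : Type :=
  Quotient (Equiv.Perm.SameCycle.setoid (D.rotate * D.opposite))

/-- The connected components of the 4-valent graph of the diagram. -/
abbrev Piece (D : GaussCode) : Type :=
  Quotient (Relation.EqvGen.setoid fun c c' : Fin D.n => ∃ s, (D.next (c, s)).1 = c')

/-- The code is realized by a diagram in the plane: each connected component of the 4-valent graph
has genus zero. There are `n` vertices and `2 * n` edges, so by Euler's formula this says
`V - E + F = 2 * (number of connected components)`. -/
def IsPlanar (D : GaussCode) : Prop :=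
  (D.n : ℤ) - 2 * D.n + Nat.card D.Face = 2 * Nat.card D.Piece

end GaussCode

/-- An oriented link diagram in the plane. The relative position of the connected components of
the diagram is not recorded, since the chain complexes below do not depend on it. -/
structure LinkDiagram extends GaussCode where
  planar : toGaussCode.IsPlanar

/-- An `m`-periodic diagram: the group `ℤ/m` acts on the diagram by rotations of the plane. So it
acts on the crossings and on the crossingless components, and it preserves the way in which the
passages follow each other, over and under, the orientation and the signs. As the centre of the
rotation does not lie on the diagram, no nontrivial rotation fixes a crossing. (Conversely, on a
connected diagram with crossings, such an action on the sphere is a rotation around two points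
inside faces of the diagram.) -/
structure PeriodicDiagram (m : ℕ) extends LinkDiagram where
  rotCrossing : Multiplicative (ZMod m) →* Equiv.Perm (Fin n)
  rotLoop : Multiplicative (ZMod m) →* Equiv.Perm (Fin loops)
  next_rot : ∀ g c s, next (rotCrossing g c, s) =
    (rotCrossing g (next (c, s)).1, (next (c, s)).2)
  positive_rot : ∀ g c, positive (rotCrossing g c) = positive c
  free : ∀ g c, rotCrossing g c = c → g = 1

/-! ## The cube of resolutions and the Khovanov-like complexes -/

namespace GaussCode

/-- The arcs of the diagram: `Sum.inl (c, s)` is the arc that starts with the passage `(c, s)` and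
ends at the passage `next (c, s)`; the crossingless components are arcs too. -/
abbrev Arc (D : GaussCode) : Type := (Fin D.n × Bool) ⊕ Fin D.loops

/-- The arc that leaves the crossing `c` along the strand `s`. -/
def outArc (D : GaussCode) (c : Fin D.n) (s : Bool) : D.Arc := Sum.inl (c, s)

/-- The arc that enters the crossing `c` along the strand `s`. -/
def inArc (D : GaussCode) (c : Fin D.n) (s : Bool) : D.Arc := Sum.inl (D.next.symm (c, s))

/-- The arcs that are glued to each other in the resolution of the diagram in which the crossings
in `I` are given the 1-smoothing and the others the 0-smoothing. The 0-smoothing of a positive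
crossing and the 1-smoothing of a negative crossing is the smoothing that agrees with the
orientations. -/
inductive Joined (D : GaussCode) (I : Finset (Fin D.n)) : D.Arc → D.Arc → Prop
  | oriented (c : Fin D.n) (s : Bool) (h : D.positive c = true ↔ c ∉ I) :
      Joined D I (D.inArc c s) (D.outArc c (!s))
  | unoriented_in (c : Fin D.n) (h : ¬ (D.positive c = true ↔ c ∉ I)) :
      Joined D I (D.inArc c true) (D.inArc c false)
  | unoriented_out (c : Fin D.n) (h : ¬ (D.positive c = true ↔ c ∉ I)) :
      Joined D I (D.outArc c true) (D.outArc c false)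

/-- Two arcs lie on the same circle of the resolution `I`. -/
def circles (D : GaussCode) (I : Finset (Fin D.n)) : Setoid D.Arc :=
  Relation.EqvGen.setoid (D.Joined I)

/-- A generator of the chain complex: a resolution `I` with `r` 1-smoothings, and a label of each
circle by one of the basis elements `1` (`true`) and `X` (`false`) of the Frobenius algebra `A`.
A labelling of the circles is given as a labelling of the arcs that is constant along circles. -/
structure Gen (D : GaussCode) (r : ℕ) where
  I : Finset (Fin D.n)
  label : D.Arc → Bool
  card_eq : I.card = r
  constant : ∀ a b, D.circles I a b → label a = label b

theorem Gen.ext' {D : GaussCode} {r : ℕ} {s s' : D.Gen r} (h : s.I = s'.I)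
    (h' : s.label = s'.label) : s = s' := by
  cases s; cases s'; cases h; cases h'; rfl

instance (D : GaussCode) (r : ℕ) : Finite (D.Gen r) :=
  Finite.of_injective (fun s : D.Gen r => (s.I, s.label)) fun _ _ h =>
    Gen.ext' (congrArg Prod.fst h) (congrArg Prod.snd h)

noncomputable instance (D : GaussCode) (r : ℕ) : Fintype (D.Gen r) := Fintype.ofFinite _

/-- The numbers of positive and of negative crossings. -/
def nPos (D : GaussCode) : ℕ := (Finset.univ.filter fun c => D.positive c = true).card

def nNeg (D : GaussCode) : ℕ := (Finset.univ.filter fun c => D.positive c = false).card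

/-- The number of circles of the resolution with the label `b`. -/
noncomputable def Gen.count {D : GaussCode} {r : ℕ} (s : D.Gen r) (b : Bool) : ℕ :=
  (Quotient.mk (D.circles s.I) '' {a | s.label a = b}).ncard

/-- The quantum degree of a generator; `1` has degree `1` and `X` has degree `-1`. -/
noncomputable def Gen.qdeg {D : GaussCode} {r : ℕ} (s : D.Gen r) : ℤ :=
  (s.count true : ℤ) - s.count false + r + D.nPos - 2 * D.nNeg

end GaussCode

/-- The Frobenius algebra `A = F[X]/(X² - hX - t)` with the basis `1` (`true`), `X` (`false`):
`mulCoeff h t a b c` is the coefficient of the basis element `c` in the product `a * b`. -/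
def mulCoeff {F : Type u} [Field F] (h t : F) : Bool → Bool → Bool → F
  | true, true, true => 1
  | true, true, false => 0
  | true, false, true => 0
  | true, false, false => 1
  | false, true, true => 0
  | false, true, false => 1
  | false, false, true => t
  | false, false, false => h

/-- `comulCoeff h t a b c` is the coefficient of `b ⊗ c` in `Δ(a)`, where
`Δ(1) = 1 ⊗ X + X ⊗ 1 - h 1 ⊗ 1` and `Δ(X) = X ⊗ X + t 1 ⊗ 1`
(the counit is `ε(1) = 0`, `ε(X) = 1`). -/
def comulCoeff {F : Type u} [Field F] (h t : F) : Bool → Bool → Bool → F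
  | true, true, true => -h
  | true, true, false => 1
  | true, false, true => 1
  | true, false, false => 0
  | false, true, true => t
  | false, true, false => 0
  | false, false, true => 0
  | false, false, false => 1

namespace GaussCode

open Classical in
/-- Matrix coefficient of the edge of the cube that changes the smoothing of the crossing `c ∉ I`
from 0 to 1. The arcs `inArc c true` and `outArc c true` lie on the two different strands of either
smoothing of `c`. If these strands belong to two circles before the change and to one circle after
it, the edge map is the multiplication, and in the opposite case it is the comultiplication;
the labels of the other circles do not change. -/
noncomputable def edgeCoeff {F : Type u} [Field F] (h t : F) (D : GaussCode)
    (I : Finset (Fin D.n)) (c : Fin D.n) (x y : D.Arc → Bool) : F :=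
  let J := insert c I
  let a := D.inArc c true
  let b := D.outArc c true
  if ∀ e, ¬ D.circles I e a → ¬ D.circles I e b → x e = y e then
    if ¬ D.circles I a b ∧ D.circles J a b then mulCoeff h t (x a) (x b) (y a)
    else if D.circles I a b ∧ ¬ D.circles J a b then comulCoeff h t (x a) (y a) (y b)
    else 0
  else 0

/-- Matrix coefficient of the differential, with the standard signs: the cube is twisted by the
exterior algebra on the crossings, the edge `c` corresponding to the exterior product by `c`. -/
noncomputable def dCoeff {F : Type u} [Field F] (h t : F) (D : GaussCode) {r : ℕ}
    (s : D.Gen r) (s' : D.Gen (r + 1)) : F :=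
  ∑ c : Fin D.n, if c ∉ s.I ∧ insert c s.I = s'.I then
    (-1) ^ (s.I.filter (· < c)).card * D.edgeCoeff h t s.I c s.label s'.label else 0

/-- The differential of the Khovanov-like complex of the Frobenius system `(h, t)`. An element of
the chain group with `r` 1-smoothings is given by its coefficients in the basis `Gen D r`. -/
noncomputable def diff {F : Type u} [Field F] (h t : F) (D : GaussCode) (r : ℕ) :
    (D.Gen r → F) →ₗ[F] (D.Gen (r + 1) → F) where
  toFun f s' := ∑ s, D.dCoeff h t s s' * f s
  map_add' f g := by
    ext s'
    simp [mul_add, Finset.sum_add_distrib]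
  map_smul' k f := by
    ext s'
    simp [Finset.mul_sum, mul_left_comm]

/-- The differential on the product of all chain groups. -/
noncomputable def diffAll {F : Type u} [Field F] (h t : F) (D : GaussCode) :
    (∀ r, D.Gen r → F) →ₗ[F] (∀ r, D.Gen r → F) where
  toFun f
    | 0 => 0
    | r + 1 => D.diff h t r (f r)
  map_add' f g := by
    ext r
    cases r <;> simp
  map_smul' k f := by
    ext r
    cases r <;> simp

/-- The chains of homological degree `i` and quantum degree `j`. -/
def bidegree (F : Type u) [Field F] (D : GaussCode) (i j : ℤ) :
    Submodule F (∀ r, D.Gen r → F) where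
  carrier := {f | ∀ r s, f r s ≠ 0 → (r : ℤ) - D.nNeg = i ∧ s.qdeg = j}
  zero_mem' := by simp
  add_mem' := by
    intro f g hf hg r s hs
    by_cases h0 : f r s = 0
    · exact hg r s (by simpa [h0] using hs)
    · exact hf r s h0
  smul_mem' := by
    intro k f hf r s hs
    exact hf r s (right_ne_zero_of_mul (by simpa using hs))

/-- The (ordinary) Khovanov homology `Kh^{i,j}` with coefficients in `F`, where `i` is the
homological degree and `j` is the quantum degree. -/
abbrev Kh (F : Type u) [Field F] (D : GaussCode) (i j : ℤ) : Type u :=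
  ↥(LinearMap.ker (D.diffAll (0 : F) 0) ⊓ D.bidegree F i j) ⧸
    ((D.bidegree F (i - 1) j).map (D.diffAll (0 : F) 0)).submoduleOf
      (LinearMap.ker (D.diffAll (0 : F) 0) ⊓ D.bidegree F i j)

/-- `w` is the width of the Khovanov homology over `F`: the largest difference between the
diagonal degrees `j - 2 * i` of two nonzero groups `Kh^{i,j}`. -/
def HasWidth (F : Type u) [Field F] (D : GaussCode) (w : ℤ) : Prop :=
  IsGreatest {k | ∃ i j i' j' : ℤ, Nontrivial (D.Kh F i j) ∧ Nontrivial (D.Kh F i' j') ∧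
    k = (j - 2 * i) - (j' - 2 * i')} w

end GaussCode

/-! ## The action of `ℤ/m` on the chain groups -/

namespace PeriodicDiagram

/-- The action on the arcs. -/
def rotArc {m : ℕ} (D : PeriodicDiagram m) :
    Multiplicative (ZMod m) →* Equiv.Perm D.Arc where
  toFun g := Equiv.sumCongr (Equiv.prodCongr (D.rotCrossing g) (Equiv.refl Bool)) (D.rotLoop g)
  map_one' := by
    ext a
    rcases a with ⟨c, s⟩ | l <;> simp
  map_mul' g g' := by
    ext a
    rcases a with ⟨c, s⟩ | l <;> simp

/-- The image of a set of crossings under a rotation. -/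
def rotSet {m : ℕ} (D : PeriodicDiagram m) (g : Multiplicative (ZMod m))
    (I : Finset (Fin D.n)) : Finset (Fin D.n) := I.map (D.rotCrossing g).toEmbedding

theorem mem_rotSet {m : ℕ} (D : PeriodicDiagram m) (g : Multiplicative (ZMod m))
    (I : Finset (Fin D.n)) (c : Fin D.n) : D.rotCrossing g c ∈ D.rotSet g I ↔ c ∈ I := by
  simp [rotSet]

theorem rotSet_mul {m : ℕ} (D : PeriodicDiagram m) (g g' : Multiplicative (ZMod m))
    (I : Finset (Fin D.n)) : D.rotSet (g * g') I = D.rotSet g (D.rotSet g' I) := by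
  rw [rotSet, rotSet, rotSet, Finset.map_map, map_mul]
  rfl

theorem rotSet_one {m : ℕ} (D : PeriodicDiagram m) (I : Finset (Fin D.n)) :
    D.rotSet 1 I = I := by
  rw [rotSet, map_one]
  exact Finset.map_refl

theorem rotArc_outArc {m : ℕ} (D : PeriodicDiagram m) (g : Multiplicative (ZMod m))
    (c : Fin D.n) (s : Bool) : D.rotArc g (D.outArc c s) = D.outArc (D.rotCrossing g c) s := rfl

theorem rotArc_inArc {m : ℕ} (D : PeriodicDiagram m) (g : Multiplicative (ZMod m))
    (c : Fin D.n) (s : Bool) : D.rotArc g (D.inArc c s) = D.inArc (D.rotCrossing g c) s := by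
  have h := D.next_rot g (D.next.symm (c, s)).1 (D.next.symm (c, s)).2
  simp only [Prod.mk.eta, Equiv.apply_symm_apply] at h
  have h' := (Equiv.eq_symm_apply D.next).2 h
  simp only [GaussCode.inArc, ← h']
  rfl

theorem joined_rot {m : ℕ} (D : PeriodicDiagram m) (g : Multiplicative (ZMod m))
    (I : Finset (Fin D.n)) {a b : D.Arc} (h : D.Joined I a b) :
    D.Joined (D.rotSet g I) (D.rotArc g a) (D.rotArc g b) := by
  cases h with
  | oriented c s h =>
    rw [rotArc_inArc, rotArc_outArc]
    exact .oriented _ _ (by rwa [mem_rotSet, D.positive_rot])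
  | unoriented_in c h =>
    rw [rotArc_inArc, rotArc_inArc]
    exact .unoriented_in _ (by rwa [mem_rotSet, D.positive_rot])
  | unoriented_out c h =>
    rw [rotArc_outArc, rotArc_outArc]
    exact .unoriented_out _ (by rwa [mem_rotSet, D.positive_rot])

theorem circles_rot_of {m : ℕ} (D : PeriodicDiagram m) (g : Multiplicative (ZMod m))
    (I : Finset (Fin D.n)) {a b : D.Arc} (h : D.circles I a b) :
    D.circles (D.rotSet g I) (D.rotArc g a) (D.rotArc g b) := by
  change Relation.EqvGen _ _ _ at h
  change Relation.EqvGen _ _ _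
  induction h with
  | rel a b h => exact .rel _ _ (D.joined_rot g I h)
  | refl a => exact .refl _
  | symm a b _ ih => exact .symm _ _ ih
  | trans a b c _ _ ih ih' => exact .trans _ _ _ ih ih'

theorem circles_rot {m : ℕ} (D : PeriodicDiagram m) (g : Multiplicative (ZMod m))
    (I : Finset (Fin D.n)) (a b : D.Arc) :
    D.circles (D.rotSet g I) (D.rotArc g a) (D.rotArc g b) ↔ D.circles I a b := by
  refine ⟨fun h => ?_, D.circles_rot_of g I⟩
  have h' := D.circles_rot_of g⁻¹ _ h
  rw [← rotSet_mul, ← Equiv.Perm.mul_apply, ← Equiv.Perm.mul_apply, ← map_mul,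
    inv_mul_cancel, rotSet_one, map_one] at h'
  exact h'

/-- The action on the generators, up to sign. -/
def rotGen {m : ℕ} (D : PeriodicDiagram m) {r : ℕ} (g : Multiplicative (ZMod m))
    (s : D.Gen r) : D.Gen r where
  I := D.rotSet g s.I
  label a := s.label (D.rotArc g⁻¹ a)
  card_eq := by rw [rotSet, Finset.card_map, s.card_eq]
  constant a b h := by
    apply s.constant
    have h' := D.circles_rot_of g⁻¹ _ h
    rwa [← rotSet_mul, inv_mul_cancel, rotSet_one] at h'

theorem rotGen_mul {m : ℕ} (D : PeriodicDiagram m) {r : ℕ} (g g' : Multiplicative (ZMod m))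
    (s : D.Gen r) : D.rotGen (g * g') s = D.rotGen g (D.rotGen g' s) := by
  apply GaussCode.Gen.ext'
  · exact D.rotSet_mul g g' s.I
  · funext a
    simp [rotGen, mul_inv_rev]

theorem rotGen_one {m : ℕ} (D : PeriodicDiagram m) {r : ℕ} (s : D.Gen r) :
    D.rotGen 1 s = s := by
  apply GaussCode.Gen.ext'
  · exact D.rotSet_one s.I
  · funext a
    simp [rotGen]

/-- The bijection of the generators given by a rotation. -/
def rotGenEquiv {m : ℕ} (D : PeriodicDiagram m) (r : ℕ) (g : Multiplicative (ZMod m)) :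
    D.Gen r ≃ D.Gen r where
  toFun := D.rotGen g
  invFun := D.rotGen g⁻¹
  left_inv s := by rw [← rotGen_mul, inv_mul_cancel, rotGen_one]
  right_inv s := by rw [← rotGen_mul, mul_inv_cancel, rotGen_one]

/-- The sign with which a rotation acts on the exterior product of the crossings of `I` (in
increasing order): `-1` to the number of pairs of crossings of `I` that `g` puts out of order. -/
def rotSign {m : ℕ} (D : PeriodicDiagram m) (g : Multiplicative (ZMod m))
    (I : Finset (Fin D.n)) : ℤ :=
  ∏ p ∈ (I ×ˢ I).filter (fun p => p.1 < p.2),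
    if D.rotCrossing g p.1 < D.rotCrossing g p.2 then 1 else -1

theorem rotSign_one {m : ℕ} (D : PeriodicDiagram m) (I : Finset (Fin D.n)) :
    D.rotSign 1 I = 1 := by
  refine Finset.prod_eq_one fun p hp => ?_
  simp [(Finset.mem_filter.1 hp).2]

theorem rotSign_mul {m : ℕ} (D : PeriodicDiagram m) (g g' : Multiplicative (ZMod m))
    (I : Finset (Fin D.n)) :
    D.rotSign (g * g') I = D.rotSign g (D.rotSet g' I) * D.rotSign g' I := by
  have key : D.rotSign g (D.rotSet g' I) =
      ∏ p ∈ (I ×ˢ I).filter (fun p => p.1 < p.2),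
        (if D.rotCrossing (g * g') p.1 < D.rotCrossing (g * g') p.2 then 1 else -1) *
        (if D.rotCrossing g' p.1 < D.rotCrossing g' p.2 then 1 else -1 : ℤ) := by
    symm
    refine Finset.prod_bij
      (fun p _ => if D.rotCrossing g' p.1 < D.rotCrossing g' p.2
        then (D.rotCrossing g' p.1, D.rotCrossing g' p.2)
        else (D.rotCrossing g' p.2, D.rotCrossing g' p.1)) ?_ ?_ ?_ ?_
    · rintro ⟨a, b⟩ hp
      simp only [Finset.mem_filter, Finset.mem_product] at hp
      have hne : D.rotCrossing g' a ≠ D.rotCrossing g' b := by simpa using hp.2.ne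
      split_ifs with h
      · simp [mem_rotSet, hp.1.1, hp.1.2, h]
      · simp [mem_rotSet, hp.1.1, hp.1.2, lt_of_le_of_ne (not_lt.1 h) hne.symm]
    · rintro ⟨a, b⟩ hp ⟨a', b'⟩ hp' h
      simp only [Finset.mem_filter, Finset.mem_product] at hp hp'
      dsimp only at h
      split_ifs at h <;> simp only [Prod.mk.injEq, EmbeddingLike.apply_eq_iff_eq] at h <;>
        obtain ⟨h1, h2⟩ := h
      · rw [h1, h2]
      · subst h1 h2
        exact absurd hp.2 (not_lt.2 hp'.2.le)
      · subst h1 h2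
        exact absurd hp.2 (not_lt.2 hp'.2.le)
      · rw [h1, h2]
    · rintro ⟨a, b⟩ hp
      simp only [Finset.mem_filter, Finset.mem_product, rotSet, Finset.mem_map,
        Equiv.coe_toEmbedding] at hp
      obtain ⟨⟨⟨a', ha', rfl⟩, ⟨b', hb', rfl⟩⟩, hab⟩ := hp
      have hne : a' ≠ b' := by
        rintro rfl
        exact lt_irrefl _ hab
      rcases lt_or_gt_of_ne hne with h | h
      · exact ⟨(a', b'), by simp [ha', hb', h], by simp [hab]⟩
      · exact ⟨(b', a'), by simp [ha', hb', h], by simp [hab.le]⟩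
    · rintro ⟨a, b⟩ hp
      simp only [Finset.mem_filter, Finset.mem_product] at hp
      have hne : D.rotCrossing g (D.rotCrossing g' a) ≠ D.rotCrossing g (D.rotCrossing g' b) := by
        simpa using hp.2.ne
      simp only [map_mul, Equiv.Perm.mul_apply]
      by_cases h1 : D.rotCrossing g' a < D.rotCrossing g' b
      · simp [h1]
      · rcases lt_or_gt_of_ne hne with h2 | h2
        · simp [h1, h2, h2.le]
        · simp [h1, h2, not_lt.2 h2.le]
  rw [key, rotSign, rotSign, ← Finset.prod_mul_distrib]
  refine Finset.prod_congr rfl fun p _ => ?_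
  split_ifs <;> simp

/-- The representation of `ℤ/m` on the chain group with `r` 1-smoothings: a rotation maps a
generator `(I, label)` to its image, with the sign of the action on the exterior product. -/
noncomputable def rep {m : ℕ} (F : Type u) [Field F] (D : PeriodicDiagram m) (r : ℕ) :
    Representation F (Multiplicative (ZMod m)) (D.Gen r → F) where
  toFun g :=
    { toFun := fun f s => (D.rotSign g (D.rotGen g⁻¹ s).I : F) * f (D.rotGen g⁻¹ s)
      map_add' := fun f f' => by
        funext s
        simp [mul_add]
      map_smul' := fun k f => by
        funext s
        simp [mul_left_comm] }
  map_one' := by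
    ext f s
    simp [rotGen_one, rotSign_one]
  map_mul' g g' := by
    refine LinearMap.ext fun f => funext fun s => ?_
    have h : (D.rotGen g⁻¹ s).I = D.rotSet g' (D.rotGen (g * g')⁻¹ s).I := by
      rw [mul_inv_rev, rotGen_mul]
      change _ = D.rotSet g' (D.rotSet g'⁻¹ _)
      rw [← rotSet_mul, mul_inv_cancel, rotSet_one]
    simp only [Module.End.mul_apply, LinearMap.coe_mk, AddHom.coe_mk]
    rw [h, rotSign_mul, ← rotGen_mul, ← mul_inv_rev]
    push_cast
    ring

theorem edgeCoeff_rot {m : ℕ} {F : Type u} [Field F] (h t : F) (D : PeriodicDiagram m)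
    (g : Multiplicative (ZMod m)) (I : Finset (Fin D.n)) (c : Fin D.n) (x y : D.Arc → Bool) :
    D.edgeCoeff h t (D.rotSet g I) (D.rotCrossing g c) (fun a => x (D.rotArc g⁻¹ a))
      (fun a => y (D.rotArc g⁻¹ a)) = D.edgeCoeff h t I c x y := by
  have hins : insert (D.rotCrossing g c) (D.rotSet g I) = D.rotSet g (insert c I) := by
    simp [rotSet, Finset.map_insert]
  have hinv : ∀ a, D.rotArc g⁻¹ (D.rotArc g a) = a := fun a => by
    rw [← Equiv.Perm.mul_apply, ← map_mul, inv_mul_cancel, map_one, Equiv.Perm.one_apply]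
  have hall : (∀ e, ¬ D.circles (D.rotSet g I) e (D.rotArc g (D.inArc c true)) →
      ¬ D.circles (D.rotSet g I) e (D.rotArc g (D.outArc c true)) →
        x (D.rotArc g⁻¹ e) = y (D.rotArc g⁻¹ e)) ↔
      ∀ e, ¬ D.circles I e (D.inArc c true) → ¬ D.circles I e (D.outArc c true) → x e = y e := by
    rw [← (D.rotArc g).forall_congr_right]
    simp only [circles_rot, hinv]
  simp only [GaussCode.edgeCoeff]
  rw [← rotArc_inArc, ← rotArc_outArc, hins, hinv, hinv]
  by_cases h1 : ∀ e, ¬ D.circles I e (D.inArc c true) → ¬ D.circles I e (D.outArc c true) →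
      x e = y e
  · rw [if_pos (hall.2 h1), if_pos h1]
    have h2 := D.circles_rot g I (D.inArc c true) (D.outArc c true)
    have h3 := D.circles_rot g (insert c I) (D.inArc c true) (D.outArc c true)
    by_cases h4 : D.circles I (D.inArc c true) (D.outArc c true) <;>
      by_cases h5 : D.circles (insert c I) (D.inArc c true) (D.outArc c true) <;>
      simp [h2, h3, h4, h5]
  · rw [if_neg (fun h2 => h1 (hall.1 h2)), if_neg h1]

theorem rotSign_insert {m : ℕ} (D : PeriodicDiagram m) (g : Multiplicative (ZMod m))
    (I : Finset (Fin D.n)) (c : Fin D.n) (hc : c ∉ I) :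
    D.rotSign g (insert c I) * (-1) ^ (I.filter (· < c)).card =
      (-1) ^ ((D.rotSet g I).filter (· < D.rotCrossing g c)).card * D.rotSign g I := by
  have hsplit : ((insert c I) ×ˢ (insert c I)).filter (fun p : Fin D.n × Fin D.n => p.1 < p.2) =
      (I ×ˢ I).filter (fun p => p.1 < p.2) ∪
        I.image (fun b => if b < c then (b, c) else (c, b)) := by
    ext ⟨a, b⟩
    simp only [Finset.mem_filter, Finset.mem_product, Finset.mem_insert, Finset.mem_union,
      Finset.mem_image]
    constructor
    · rintro ⟨⟨rfl | ha, rfl | hb⟩, hab⟩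
      · exact absurd hab (lt_irrefl _)
      · exact Or.inr ⟨b, hb, by simp [hab.le]⟩
      · exact Or.inr ⟨a, ha, by simp [hab]⟩
      · exact Or.inl ⟨⟨ha, hb⟩, hab⟩
    · rintro (⟨⟨ha, hb⟩, hab⟩ | ⟨e, he, hab⟩)
      · exact ⟨⟨Or.inr ha, Or.inr hb⟩, hab⟩
      · have hec : e ≠ c := by
          rintro rfl
          exact hc he
        split_ifs at hab with h <;> obtain ⟨rfl, rfl⟩ := Prod.mk.inj hab
        · exact ⟨⟨Or.inr he, Or.inl rfl⟩, h⟩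
        · exact ⟨⟨Or.inl rfl, Or.inr he⟩, lt_of_le_of_ne (not_lt.1 h) hec.symm⟩
  have hdisj : Disjoint ((I ×ˢ I).filter (fun p : Fin D.n × Fin D.n => p.1 < p.2))
      (I.image (fun b => if b < c then (b, c) else (c, b))) := by
    rw [Finset.disjoint_left]
    rintro ⟨a, b⟩ h1 h2
    simp only [Finset.mem_filter, Finset.mem_product, Finset.mem_image] at h1 h2
    obtain ⟨e, -, h⟩ := h2
    split_ifs at h <;> obtain ⟨rfl, rfl⟩ := Prod.mk.inj h
    · exact hc h1.1.2
    · exact hc h1.1.1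
  have hinj : Set.InjOn (fun b : Fin D.n => if b < c then (b, c) else (c, b)) (I : Set _) := by
    intro a ha b hb h
    dsimp only at h
    split_ifs at h <;> simp only [Prod.mk.injEq] at h <;> obtain ⟨h1, h2⟩ := h
    · exact h1
    · exact h1.trans h2
    · exact h2.trans h1
    · exact h2
  have hpow : ∀ (J : Finset (Fin D.n)) (p : Fin D.n → Prop) [DecidablePred p],
      (-1 : ℤ) ^ (J.filter p).card = ∏ b ∈ J, if p b then -1 else 1 := by
    intro J p _
    rw [← Finset.prod_filter, Finset.prod_const]
  rw [rotSign, hsplit, Finset.prod_union hdisj, Finset.prod_image hinj, hpow, hpow]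
  simp only [rotSet, Finset.prod_map, Equiv.coe_toEmbedding]
  change D.rotSign g I * _ * _ = _
  rw [mul_assoc, mul_comm, ← Finset.prod_mul_distrib]
  congr 1
  refine Finset.prod_congr rfl fun b hb => ?_
  have hbc : b ≠ c := by
    rintro rfl
    exact hc hb
  have hbc' : D.rotCrossing g b ≠ D.rotCrossing g c := by simpa using hbc
  rcases lt_or_gt_of_ne hbc with h1 | h1 <;> rcases lt_or_gt_of_ne hbc' with h2 | h2 <;>
    simp [h1, h2, not_lt.2 h1.le, not_lt.2 h2.le]

theorem dCoeff_rot {m : ℕ} {F : Type u} [Field F] (h t : F) (D : PeriodicDiagram m)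
    (g : Multiplicative (ZMod m)) {r : ℕ} (s : D.Gen r) (s' : D.Gen (r + 1)) :
    D.dCoeff h t (D.rotGen g s) (D.rotGen g s') * (D.rotSign g s.I : F) =
      (D.rotSign g s'.I : F) * D.dCoeff h t s s' := by
  rw [GaussCode.dCoeff, GaussCode.dCoeff, Finset.sum_mul, Finset.mul_sum,
    ← Equiv.sum_comp (D.rotCrossing g)]
  refine Finset.sum_congr rfl fun c _ => ?_
  have hins : insert (D.rotCrossing g c) (D.rotSet g s.I) = D.rotSet g (insert c s.I) := by
    simp [rotSet, Finset.map_insert]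
  have hcond : (D.rotCrossing g c ∉ (D.rotGen g s).I ∧
      insert (D.rotCrossing g c) (D.rotGen g s).I = (D.rotGen g s').I) ↔
      (c ∉ s.I ∧ insert c s.I = s'.I) := by
    change (_ ∉ D.rotSet g s.I ∧ insert _ (D.rotSet g s.I) = D.rotSet g s'.I) ↔ _
    rw [hins, mem_rotSet]
    simp only [rotSet, Finset.map_inj]
  by_cases hc : c ∉ s.I ∧ insert c s.I = s'.I
  · rw [if_pos (hcond.2 hc), if_pos hc]
    have hs := D.rotSign_insert g s.I c hc.1
    rw [hc.2] at hs
    have hs' := congrArg (Int.cast : ℤ → F) hs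
    push_cast at hs'
    change _ * D.edgeCoeff h t (D.rotSet g s.I) (D.rotCrossing g c)
      (fun a => s.label (D.rotArc g⁻¹ a)) (fun a => s'.label (D.rotArc g⁻¹ a)) * _ = _
    rw [edgeCoeff_rot]
    change (-1) ^ ((D.rotSet g s.I).filter (· < D.rotCrossing g c)).card * _ * _ = _
    linear_combination (-(D.edgeCoeff h t s.I c s.label s'.label)) * hs'
  · rw [if_neg (fun h => hc (hcond.1 h)), if_neg hc]
    simp

theorem diff_rep {m : ℕ} {F : Type u} [Field F] (h t : F) (D : PeriodicDiagram m)
    (r : ℕ) (g : Multiplicative (ZMod m)) (f : D.Gen r → F) :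
    D.diff h t r (D.rep F r g f) = D.rep F (r + 1) g (D.diff h t r f) := by
  funext s'
  change ∑ s, D.dCoeff h t s s' * ((D.rotSign g (D.rotGen g⁻¹ s).I : F) * f (D.rotGen g⁻¹ s)) =
    (D.rotSign g (D.rotGen g⁻¹ s').I : F) * ∑ s, D.dCoeff h t s (D.rotGen g⁻¹ s') * f s
  rw [Finset.mul_sum, ← Equiv.sum_comp (D.rotGenEquiv r g)]
  refine Finset.sum_congr rfl fun s _ => ?_
  have h1 : D.rotGen g⁻¹ (D.rotGenEquiv r g s) = s := (D.rotGenEquiv r g).left_inv s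
  have h2 : D.rotGen g (D.rotGen g⁻¹ s') = s' := (D.rotGenEquiv (r + 1) g).right_inv s'
  have h3 := D.dCoeff_rot h t g s (D.rotGen g⁻¹ s')
  rw [h2] at h3
  rw [h1, ← mul_assoc, ← mul_assoc, ← h3]
  rfl

/-- The group algebra `Λ_m = F[ℤ/m]`. -/
abbrev GroupAlg (F : Type u) [Field F] (m : ℕ) : Type u :=
  MonoidAlgebra F (Multiplicative (ZMod m))

theorem diff_asAlgebraHom {m : ℕ} {F : Type u} [Field F] (h t : F) (D : PeriodicDiagram m)
    (r : ℕ) (x : GroupAlg F m) (f : D.Gen r → F) :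
    D.diff h t r ((D.rep F r).asAlgebraHom x f) =
      (D.rep F (r + 1)).asAlgebraHom x (D.diff h t r f) := by
  induction x using MonoidAlgebra.induction_linear with
  | zero => simp
  | add x y hx hy => simp [hx, hy]
  | single g a =>
    simp only [Representation.asAlgebraHom_single, LinearMap.smul_apply, map_smul]
    rw [diff_rep]

/-- The chain group with `r` 1-smoothings, as a module over `Λ_m`: an element is given by its
coefficients in the basis `Gen D r`, and the group acts by the representation `rep`. -/
def Chain {m : ℕ} (F : Type u) [Field F] (D : PeriodicDiagram m) (r : ℕ) : Type u :=
  D.Gen r → F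

noncomputable instance {m : ℕ} (F : Type u) [Field F] (D : PeriodicDiagram m) (r : ℕ) :
    AddCommGroup (D.Chain F r) := inferInstanceAs (AddCommGroup (D.Gen r → F))

noncomputable instance {m : ℕ} (F : Type u) [Field F] (D : PeriodicDiagram m) (r : ℕ) :
    Module F (D.Chain F r) := inferInstanceAs (Module F (D.Gen r → F))

noncomputable instance {m : ℕ} (F : Type u) [Field F] (D : PeriodicDiagram m) (r : ℕ) :
    Module (GroupAlg F m) (D.Chain F r) :=
  Module.compHom (D.Gen r → F) (D.rep F r).asAlgebraHom.toRingHom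

theorem smul_chain {m : ℕ} {F : Type u} [Field F] (D : PeriodicDiagram m) (r : ℕ)
    (x : GroupAlg F m) (f : D.Chain F r) :
    x • f = (D.rep F r).asAlgebraHom x f := rfl

instance {m : ℕ} (F : Type u) [Field F] (D : PeriodicDiagram m) (r : ℕ) :
    SMulCommClass (GroupAlg F m) F (D.Chain F r) where
  smul_comm x k f := ((D.rep F r).asAlgebraHom x).map_smul k f

/-- The differential as a map of `Λ_m`-modules. -/
noncomputable def diffHom {m : ℕ} {F : Type u} [Field F] (h t : F) (D : PeriodicDiagram m)
    (r : ℕ) : D.Chain F r →ₗ[GroupAlg F m] D.Chain F (r + 1) where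
  toFun := D.diff h t r
  map_add' := (D.diff h t r).map_add
  map_smul' x f := D.diff_asAlgebraHom h t r x f

/-! ## The equivariant homology -/

/-- The double complex `Hom(P_a, C_r)`, all bidegrees together: `P_a` are the modules of a
projective resolution of the `Λ_m`-module `M`, and `C_r` is the chain group with `r`
1-smoothings. -/
abbrev Cochain {m : ℕ} {F : Type u} [Field F] (D : PeriodicDiagram m)
    {M : ModuleCat.{u} (GroupAlg F m)} (P : ProjectiveResolution M) : Type u :=
  ∀ a r : ℕ, P.complex.X a →ₗ[GroupAlg F m] D.Chain F r

/-- The part of the total differential that comes from the Khovanov-like complex. -/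
noncomputable def diffC {m : ℕ} {F : Type u} [Field F] (h t : F) (D : PeriodicDiagram m)
    {M : ModuleCat.{u} (GroupAlg F m)} (P : ProjectiveResolution M) :
    D.Cochain P →ₗ[F] D.Cochain P where
  toFun f := fun a r => match r with
    | 0 => 0
    | r + 1 => D.diffHom h t r ∘ₗ f a r
  map_add' f f' := by
    refine funext fun a => funext fun r => ?_
    cases r with
    | zero => exact (add_zero _).symm
    | succ r => exact LinearMap.comp_add _ _ _
  map_smul' k f := by
    refine funext fun a => funext fun r => ?_
    cases r with
    | zero => exact (smul_zero k).symm
    | succ r => exact LinearMap.ext fun x => (D.diff h t r).map_smul k (f a r x)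

/-- The part of the total differential that comes from the resolution, with the usual sign. -/
noncomputable def diffP {m : ℕ} {F : Type u} [Field F] (D : PeriodicDiagram m)
    {M : ModuleCat.{u} (GroupAlg F m)} (P : ProjectiveResolution M) :
    D.Cochain P →ₗ[F] D.Cochain P where
  toFun f := fun a r => match a with
    | 0 => 0
    | a + 1 => (-1 : F) ^ r • (f a r ∘ₗ (P.complex.d (a + 1) a).hom)
  map_add' f f' := by
    refine funext fun a => funext fun r => ?_
    cases a with
    | zero => exact (add_zero _).symm
    | succ a => simp [LinearMap.add_comp]
  map_smul' k f := by
    refine funext fun a => funext fun r => ?_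
    cases a with
    | zero => exact (smul_zero k).symm
    | succ a => simp [LinearMap.smul_comp, smul_comm k]

/-- The total differential. -/
noncomputable def diffTot {m : ℕ} {F : Type u} [Field F] (h t : F) (D : PeriodicDiagram m)
    {M : ModuleCat.{u} (GroupAlg F m)} (P : ProjectiveResolution M) :
    D.Cochain P →ₗ[F] D.Cochain P := D.diffC h t P + D.diffP P

/-- The cochains of total degree `i`; the homological degree of the chain group with `r`
1-smoothings is `r` minus the number of negative crossings. -/
def degree {m : ℕ} {F : Type u} [Field F] (D : PeriodicDiagram m)
    {M : ModuleCat.{u} (GroupAlg F m)} (P : ProjectiveResolution M) (i : ℤ) :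
    Submodule F (D.Cochain P) where
  carrier := {f | ∀ a r : ℕ, (a : ℤ) + (r - D.nNeg) ≠ i → f a r = 0}
  zero_mem' := fun _ _ _ => rfl
  add_mem' := by
    intro f f' hf hf' a r h
    simp [hf a r h, hf' a r h]
  smul_mem' := by
    intro k f hf a r h
    simp [hf a r h]

/-- The quantum filtration of the cochains: all values are combinations of generators of quantum
degree at least `k`. -/
def filt {m : ℕ} {F : Type u} [Field F] (D : PeriodicDiagram m)
    {M : ModuleCat.{u} (GroupAlg F m)} (P : ProjectiveResolution M) (k : ℤ) :
    Submodule F (D.Cochain P) where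
  carrier := {f | ∀ (a r : ℕ) (p : P.complex.X a) (s : D.Gen r),
    s.qdeg < k → (f a r p : D.Gen r → F) s = 0}
  zero_mem' := fun _ _ _ _ _ => rfl
  add_mem' := by
    intro f f' hf hf' a r p s h
    exact (congrArg₂ (· + ·) (hf a r p s h) (hf' a r p s h)).trans (add_zero 0)
  smul_mem' := by
    intro c f hf a r p s h
    exact (congrArg (c * ·) (hf a r p s h)).trans (mul_zero c)

/-- The cocycles of total degree `i`. -/
noncomputable def cocycles {m : ℕ} {F : Type u} [Field F] (h t : F) (D : PeriodicDiagram m)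
    {M : ModuleCat.{u} (GroupAlg F m)} (P : ProjectiveResolution M) (i : ℤ) :
    Submodule F (D.Cochain P) := LinearMap.ker (D.diffTot h t P) ⊓ D.degree P i

/-- The coboundaries of total degree `i`. -/
noncomputable def coboundaries {m : ℕ} {F : Type u} [Field F] (h t : F) (D : PeriodicDiagram m)
    {M : ModuleCat.{u} (GroupAlg F m)} (P : ProjectiveResolution M) (i : ℤ) :
    Submodule F (D.Cochain P) := (D.degree P (i - 1)).map (D.diffTot h t P)

/-- The equivariant homology in degree `i` of the Khovanov-like theory of the Frobenius system
`(h, t)`, with coefficients in `M`: the space of the classes of the cocycles of degree `i` modulo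
the coboundaries of degree `i`. -/
noncomputable def EH {m : ℕ} {F : Type u} [Field F] (h t : F) (D : PeriodicDiagram m)
    {M : ModuleCat.{u} (GroupAlg F m)} (P : ProjectiveResolution M) (i : ℤ) :
    Submodule F (D.Cochain P ⧸ D.coboundaries h t P i) :=
  (D.cocycles h t P i).map (D.coboundaries h t P i).mkQ

/-- The filtration of the homology: the classes represented by cocycles in the `k`-th step of the
quantum filtration. -/
noncomputable def filtEH {m : ℕ} {F : Type u} [Field F] (h t : F) (D : PeriodicDiagram m)
    {M : ModuleCat.{u} (GroupAlg F m)} (P : ProjectiveResolution M) (i k : ℤ) :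
    Submodule F (D.Cochain P ⧸ D.coboundaries h t P i) :=
  (D.cocycles h t P i ⊓ D.filt P k).map (D.coboundaries h t P i).mkQ

/-- The `k`-th graded piece of the homology in degree `i`. -/
abbrev GrEH {m : ℕ} {F : Type u} [Field F] (h t : F) (D : PeriodicDiagram m)
    {M : ModuleCat.{u} (GroupAlg F m)} (P : ProjectiveResolution M) (i k : ℤ) : Type u :=
  ↥(D.filtEH h t P i k) ⧸ (D.filtEH h t P i (k + 1)).submoduleOf (D.filtEH h t P i k)

/-- The homology vanishes below the degree `-(number of negative crossings)`. -/
theorem finrank_GrEH_eq_zero {m : ℕ} {F : Type u} [Field F] (h t : F) (D : PeriodicDiagram m)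
    {M : ModuleCat.{u} (GroupAlg F m)} (P : ProjectiveResolution M) (i k : ℤ)
    (hi : i < -(D.nNeg : ℤ)) : Module.finrank F (D.GrEH h t P i k) = 0 := by
  have h0 : D.cocycles h t P i = ⊥ := by
    rw [eq_bot_iff]
    intro f hf
    refine funext fun a => funext fun r => hf.2 a r (by omega)
  have h1 : D.filtEH h t P i k = ⊥ := by
    rw [filtEH, h0, bot_inf_eq, Submodule.map_bot]
  have : Subsingleton (D.filtEH h t P i k) := by
    rw [h1]
    infer_instance
  have : Subsingleton (D.GrEH h t P i k) := (Submodule.mkQ_surjective _).subsingleton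
  exact Module.finrank_zero_of_subsingleton

open scoped LaurentPolynomial LaurentSeries in
/-- The equivariant polynomial `∑ t^i q^k dim Gr^k EH^i` of the theory `(h, t)`. It is a Laurent
series in the variable `t`, whose coefficients are Laurent polynomials in `q` with coefficients
in `ℕ`. -/
noncomputable def polynomial {m : ℕ} {F : Type u} [Field F] (h t : F) (D : PeriodicDiagram m)
    {M : ModuleCat.{u} (GroupAlg F m)} (P : ProjectiveResolution M) :
    LaurentSeries (LaurentPolynomial ℕ) :=
  HahnSeries.ofSuppBddBelow
    (fun i : ℤ => ∑ᶠ k : ℤ, Module.finrank F (D.GrEH h t P i k) • LaurentPolynomial.T k)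
    ⟨-(D.nNeg : ℤ), fun i hi => by
      by_contra hlt
      refine hi ?_
      simp [D.finrank_GrEH_eq_zero h t P i _ (not_le.1 hlt)]⟩

end PeriodicDiagram

/-! The total complex is finite-dimensional in each degree (for a finitely generated resolution),
and its differential preserves a bounded filtration. In a basis adapted to the filtration the
differential cancels basis elements in pairs: one in degree `i` and filtration `a`, the other in
degree `i + 1` and filtration `a + v`. Such a pair contributes `t^i q^a (1 + t q^v)` to the
generating function of the cochains, and the unpaired elements give the cohomology. The pairs with
`v = 0` are counted by the differential of the associated graded complex, which is the same for all
pairs `(h, t)`; the Khovanov differential has no other pairs. So the Khovanov polynomial exceeds the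
deformed one by the contribution of the pairs with `v > 0`. Bases are avoided: `pairs` is the
dimension of a bigraded piece of the coboundaries, filtered by source and by target, and
`grRank_comparison` is a telescoping count of dimensions.

A matrix entry of the differential that involves `h` raises the quantum degree by 2, one that
involves `t` by 4 (`dCoeff_deg`). The complex therefore splits according to residues modulo `κ = 4`
for Lee and `κ = 2` for Bar-Natan, and only `v = κ u` occurs.

That the square of the differential is zero has to be derived from the genus condition on the Gauss
code. A mod 2 Jordan curve argument (`IsPlanar.not_strands`) shows that every change of smoothing
merges or splits circles (`IsPlanar.merges_or_merges`). The edge maps are then linear over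
multiplication by `X` on the circles, so commutativity of the squares need only be checked on `1`
(`IsPlanar.edgeOp_comm`).

An arbitrary resolution is replaced by a finitely generated one, since precomposition with a
homotopy equivalence respects the quantum filtration (`polynomial_eq`). If `m` is invertible,
Maschke's theorem makes `M` its own resolution. Then only finitely many degrees occur, and a pair
with difference `κ u` forces `Kh^{i,a}` and `Kh^{i+1,a+κu}` to be nonzero (`nontrivial_Kh_of_grEH`),
so the width is at least `κ u - 2`. For `κ = 4` this suffices. For `κ = 2` the case of width 0 and
`u = 1` remains; it is excluded because in characteristic two the derivation `X ↦ 1` forces homology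
on a second diagonal (`nontrivial_Kh_of_char_two`). -/

/-! ## Planarity: a change of smoothing merges two circles or splits one -/

namespace GaussCode

variable (D : GaussCode)

/-- The arc that contains a half-edge. -/
def arcOf (d : D.Dart) : D.Arc :=
  if d.2 = true then Sum.inl d.1 else Sum.inl (D.next.symm d.1)

@[simp] theorem arcOf_true (p : Fin D.n × Bool) : D.arcOf (p, true) = Sum.inl p := rfl

@[simp] theorem arcOf_false (p : Fin D.n × Bool) :
    D.arcOf (p, false) = Sum.inl (D.next.symm p) := rfl

@[simp] theorem arcOf_opposite (d : D.Dart) : D.arcOf (D.opposite d) = D.arcOf d := by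
  obtain ⟨p, o⟩ := d
  cases o <;> simp [opposite]

@[simp] theorem opposite_opposite (d : D.Dart) : D.opposite (D.opposite d) = d :=
  D.opposite.left_inv d

theorem opposite_ne (d : D.Dart) : D.opposite d ≠ d := by
  obtain ⟨p, o⟩ := d
  cases o <;> simp [opposite]

/-- The half-edge that is connected to a given half-edge by the smoothing of its crossing. -/
def smooth (I : Finset (Fin D.n)) (d : D.Dart) : D.Dart :=
  ((d.1.1, !d.1.2), if D.positive d.1.1 = true ↔ d.1.1 ∉ I then !d.2 else d.2)

@[simp] theorem smooth_smooth (I : Finset (Fin D.n)) (d : D.Dart) :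
    D.smooth I (D.smooth I d) = d := by
  obtain ⟨⟨c, s⟩, o⟩ := d
  by_cases h : D.positive c = true ↔ c ∉ I <;> simp [smooth, h]

theorem smooth_ne (I : Finset (Fin D.n)) (d : D.Dart) : D.smooth I d ≠ d := by
  obtain ⟨⟨c, s⟩, o⟩ := d
  simp [smooth]

@[simp] theorem smooth_crossing (I : Finset (Fin D.n)) (d : D.Dart) :
    (D.smooth I d).1.1 = d.1.1 := rfl

theorem Joined.circles {D : GaussCode} {I : Finset (Fin D.n)} {x y : D.Arc}
    (h : D.Joined I x y) : D.circles I x y := Relation.EqvGen.rel _ _ h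

theorem circles_smooth (I : Finset (Fin D.n)) (d : D.Dart) :
    D.circles I (D.arcOf d) (D.arcOf (D.smooth I d)) := by
  obtain ⟨⟨c, s⟩, o⟩ := d
  by_cases h : D.positive c = true ↔ c ∉ I
  · cases o
    · simpa [smooth, h, inArc, outArc] using (Joined.oriented (D := D) c s h).circles
    · simpa [smooth, h, inArc, outArc] using
        (D.circles I).symm (Joined.oriented (D := D) c (!s) h).circles
  · have h1 := (Joined.unoriented_in (D := D) c h).circles
    have h2 := (Joined.unoriented_out (D := D) c h).circles
    cases o <;> cases s
    · simpa [smooth, h, inArc] using (D.circles I).symm h1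
    · simpa [smooth, h, inArc] using h1
    · simpa [smooth, h, outArc] using (D.circles I).symm h2
    · simpa [smooth, h, outArc] using h2

/-- With `circles_smooth`, this replaces the three kinds of joins by one involution on half-edges,
so that later arguments need no case distinction by orientation. -/
theorem Joined.exists_dart {D : GaussCode} {I : Finset (Fin D.n)} {x y : D.Arc}
    (h : D.Joined I x y) : ∃ d : D.Dart, x = D.arcOf d ∧ y = D.arcOf (D.smooth I d) := by
  cases h with
  | oriented c s h => exact ⟨((c, s), false), rfl, by simp [smooth, h, outArc]⟩
  | unoriented_in c h => exact ⟨((c, true), false), rfl, by simp [smooth, h, inArc]⟩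
  | unoriented_out c h => exact ⟨((c, true), true), rfl, by simp [smooth, h, outArc]⟩

/-- The circles of a resolution, cut open at the crossing `c`. -/
def strands (I : Finset (Fin D.n)) (c : Fin D.n) : Setoid D.Arc :=
  Relation.EqvGen.setoid fun x y =>
    ∃ d : D.Dart, d.1.1 ≠ c ∧ x = D.arcOf d ∧ y = D.arcOf (D.smooth I d)

theorem strands_smooth (I : Finset (Fin D.n)) {c : Fin D.n} {d : D.Dart} (h : d.1.1 ≠ c) :
    D.strands I c (D.arcOf d) (D.arcOf (D.smooth I d)) :=
  Relation.EqvGen.rel _ _ ⟨d, h, rfl, rfl⟩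

theorem strands_le (I : Finset (Fin D.n)) (c : Fin D.n) : D.strands I c ≤ D.circles I := by
  intro x y h
  change Relation.EqvGen _ _ _ at h
  induction h with
  | rel x y h =>
    obtain ⟨d, -, rfl, rfl⟩ := h
    exact D.circles_smooth I d
  | refl x => exact (D.circles I).refl x
  | symm x y _ ih => exact (D.circles I).symm ih
  | trans x y z _ _ ih ih' => exact (D.circles I).trans ih ih'

theorem smooth_insert (I : Finset (Fin D.n)) {c : Fin D.n} {d : D.Dart} (h : d.1.1 ≠ c) :
    D.smooth (insert c I) d = D.smooth I d := by
  simp [smooth, h]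

/-- Cutting open at `c` forgets the smoothing there. The two resolutions at the ends of an edge of
the cube thus share their strands and differ only in how the four ends are joined. -/
theorem strands_insert (I : Finset (Fin D.n)) (c : Fin D.n) :
    D.strands (insert c I) c = D.strands I c := by
  unfold strands
  congr 1
  funext x y
  refine propext ⟨?_, ?_⟩
  · rintro ⟨d, h, h1, h2⟩
    exact ⟨d, h, h1, by rwa [D.smooth_insert I h] at h2⟩
  · rintro ⟨d, h, h1, h2⟩
    exact ⟨d, h, h1, by rwa [D.smooth_insert I h]⟩

/-- The circles are obtained from the strands by the joins at the crossing. -/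
theorem circles_le_of_strands_le {I : Finset (Fin D.n)} {c : Fin D.n} {r : Setoid D.Arc}
    (h : D.strands I c ≤ r)
    (h' : ∀ d : D.Dart, d.1.1 = c → r (D.arcOf d) (D.arcOf (D.smooth I d))) :
    D.circles I ≤ r := by
  refine Setoid.eqvGen_le fun x y hxy => ?_
  obtain ⟨d, rfl, rfl⟩ := hxy.exists_dart
  by_cases hd : d.1.1 = c
  · exact h' d hd
  · exact h (D.strands_smooth I hd)

/-- A union of strands contains an even number of the half-edges at the crossing `c`. -/
theorem even_ends (I : Finset (Fin D.n)) (c : Fin D.n) (f : D.Arc → ZMod 2)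
    (hf : ∀ x y, D.strands I c x y → f x = f y) :
    f (D.inArc c true) + f (D.inArc c false) + f (D.outArc c true) + f (D.outArc c false) = 0 := by
  -- Each arc that meets a crossing has two half-edges, so the sum over all half-edges vanishes
  -- modulo 2. Those away from `c` cancel in pairs under the smoothing, and the four at `c` remain.
  have h1 : ∑ d : D.Dart, f (D.arcOf d) = 0 := by
    refine Finset.sum_involution (fun d _ => D.opposite d) ?_ ?_ ?_ ?_
    · intro d _
      rw [arcOf_opposite, CharTwo.add_self_eq_zero]
    · intro d _ _
      exact D.opposite_ne d
    · simp
    · simp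
  have h2 : ∑ d : D.Dart with d.1.1 ≠ c, f (D.arcOf d) = 0 := by
    refine Finset.sum_involution (fun d _ => D.smooth I d) ?_ ?_ ?_ ?_
    · intro d hd
      rw [← hf _ _ (D.strands_smooth I (Finset.mem_filter.1 hd).2), CharTwo.add_self_eq_zero]
    · intro d _ _
      exact D.smooth_ne I d
    · simp
    · simp
  rw [← Finset.sum_filter_add_sum_filter_not Finset.univ (fun d : D.Dart => d.1.1 ≠ c), h2,
    zero_add, Finset.sum_filter, Fintype.sum_prod_type, Fintype.sum_prod_type,
    Finset.sum_eq_single c] at h1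
  · simp only [ne_eq, not_true_eq_false, not_false_eq_true, if_true, Fintype.sum_bool,
      arcOf_true, arcOf_false] at h1
    rw [← h1, inArc, inArc, outArc, outArc]
    ring
  · intro b _ hb
    simp [hb]
  · simp

end GaussCode

/-! ### Orbits of a pair of involutions -/

namespace Equiv.Perm

variable {α : Type*} {o σ : Equiv.Perm α}

/-- In the dihedral group generated by `σ` and `o`, conjugation by `σ` inverts the rotation `σ * o`.
Seen from a fixed point `x`, the involution `σ` therefore reflects the orbit. -/
theorem apply_zpow_mul_of_involutions (ho : ∀ x, o (o x) = x) (hσ : ∀ x, σ (σ x) = x) {x : α}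
    (hx : σ x = x) (k : ℤ) : σ (((σ * o) ^ k) x) = ((σ * o) ^ (-k)) x := by
  set p := σ * o
  have hinv : σ * p * σ⁻¹ = p⁻¹ := by
    ext w
    have h1 : σ⁻¹ = σ := by
      ext v
      rw [Equiv.Perm.inv_def, Equiv.symm_apply_eq, hσ]
    have h2 : o⁻¹ = o := by
      ext v
      rw [Equiv.Perm.inv_def, Equiv.symm_apply_eq, ho]
    simp [p, mul_inv_rev, h1, h2, hσ]
  have h1 : σ * p ^ k * σ⁻¹ = p ^ (-k) := by
    rw [← conj_zpow, hinv, inv_zpow, zpow_neg]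
  have h2 : σ⁻¹ x = x := by
    rw [Equiv.Perm.inv_eq_iff_eq, hx]
  calc σ ((p ^ k) x) = (σ * p ^ k * σ⁻¹) x := by
        rw [Equiv.Perm.mul_apply, h2, Equiv.Perm.mul_apply]
    _ = _ := by rw [h1]

/-- If `x`, `y`, `z` are fixed points of an involution `σ` in one orbit of the group generated by
`σ` and another involution, then two of them agree. -/
theorem eq_of_fixed_of_involutions (ho : ∀ x, o (o x) = x) (hσ : ∀ x, σ (σ x) = x) {x y z : α}
    (hx : σ x = x) (hy : σ y = y) (hz : σ z = z) (hxy : (σ * o).SameCycle x y)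
    (hxz : (σ * o).SameCycle x z) (hyx : y ≠ x) (hzx : z ≠ x) : y = z := by
  have key := apply_zpow_mul_of_involutions ho hσ hx
  set p := σ * o
  -- A point `p ^ k x` fixed by `σ` equals its reflection `p ^ (-k) x`.
  have hper : ∀ k : ℤ, σ ((p ^ k) x) = (p ^ k) x → (p ^ (2 * k)) x = x := by
    intro k h
    rw [key] at h
    rw [two_mul, zpow_add, Equiv.Perm.mul_apply, ← h, ← Equiv.Perm.mul_apply, ← zpow_add]
    simp
  obtain ⟨k, rfl⟩ := hxy
  obtain ⟨l, rfl⟩ := hxz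
  have hk := hper k hy
  have hl := hper l hz
  have hfix : ∀ j : ℤ, (p ^ j) x = x ↔ (Function.minimalPeriod (p • ·) x : ℤ) ∣ j :=
    fun j => MulAction.zpow_smul_eq_iff_minimalPeriod_dvd (a := p) (b := x) (n := j)
  rw [hfix] at hk hl
  rw [Ne, hfix] at hyx hzx
  -- With period `L`, both `2k` and `2l` are multiples of `L` but `k` and `l` are not. So `2k` and
  -- `2l` are odd multiples of `L`, and `k - l` is a multiple of `L`: a dihedral orbit has at most
  -- two such fixed points.
  have hkl : (Function.minimalPeriod (p • ·) x : ℤ) ∣ k - l := by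
    generalize (Function.minimalPeriod (p • ·) x : ℤ) = L at *
    obtain ⟨a, ha⟩ := hk
    obtain ⟨b, hb⟩ := hl
    obtain ⟨a', rfl | rfl⟩ := Int.even_or_odd' a
    · exact absurd ⟨a', by linarith⟩ hyx
    obtain ⟨b', rfl | rfl⟩ := Int.even_or_odd' b
    · exact absurd ⟨b', by linarith⟩ hzx
    exact ⟨a' - b', by linarith⟩
  have h1 : (p ^ (k - l)) x = x := (hfix _).2 hkl
  calc (p ^ k) x = (p ^ l * p ^ (k - l)) x := by rw [← zpow_add]; congr 2; ring
    _ = _ := by rw [Equiv.Perm.mul_apply, h1]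

/-- Because `σ` fixes `x`, the cyclic orbit of `x` under `σ * o` is already stable under `σ`, and by
the next lemma under `o`; it is the whole dihedral orbit. -/
theorem sameCycle_apply_of_involutions (ho : ∀ x, o (o x) = x) (hσ : ∀ x, σ (σ x) = x) {x y : α}
    (hx : σ x = x) (hxy : (σ * o).SameCycle x y) : (σ * o).SameCycle x (σ y) := by
  obtain ⟨k, rfl⟩ := hxy
  exact ⟨-k, (apply_zpow_mul_of_involutions ho hσ hx k).symm⟩

theorem sameCycle_apply_of_involutions' (ho : ∀ x, o (o x) = x) (hσ : ∀ x, σ (σ x) = x) {x y : α}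
    (hx : σ x = x) (hxy : (σ * o).SameCycle x y) : (σ * o).SameCycle x (o y) := by
  have h := sameCycle_apply_of_involutions ho hσ hx (hxy.trans ⟨1, rfl⟩)
  simpa [hσ] using h

end Equiv.Perm

namespace GaussCode

variable (D : GaussCode)

open Classical in
/-- At most two of the half-edges at a crossing lie on the same strand. -/
theorem not_all_strands (I : Finset (Fin D.n)) (c : Fin D.n) {x y z : D.Dart} (hx : x.1.1 = c)
    (hy : y.1.1 = c) (hz : z.1.1 = c) (hyx : y ≠ x) (hzx : z ≠ x) (hyz : y ≠ z)
    (h1 : D.strands I c (D.arcOf x) (D.arcOf y)) (h2 : D.strands I c (D.arcOf x) (D.arcOf z)) :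
    False := by
  -- The smoothing involution cut open at `c`: it fixes exactly the four half-edges at `c`. The
  -- strand through `x` becomes its orbit under this involution and `opposite`.
  let f : D.Dart → D.Dart := fun d => if d.1.1 = c then d else D.smooth I d
  have hf : ∀ d, f (f d) = d := by
    intro d
    by_cases h : d.1.1 = c <;> simp [f, h]
  let σ : Equiv.Perm D.Dart := ⟨f, f, hf, hf⟩
  have hσ : ∀ d, σ (σ d) = d := hf
  have hfix : ∀ d : D.Dart, d.1.1 = c → σ d = d := fun d hd => if_pos hd
  -- Membership of an arc in the orbit of `x`, tested on its outgoing half; by `hG` the other half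
  -- gives the same answer.
  let G : D.Arc → Prop := fun e => match e with
    | .inl p => (σ * D.opposite).SameCycle x (p, true)
    | .inr _ => False
  have hG : ∀ d, G (D.arcOf d) ↔ (σ * D.opposite).SameCycle x d := by
    rintro ⟨p, o⟩
    cases o
    · have h3 : D.opposite (p, false) = (D.next.symm p, true) := by simp [opposite]
      change (σ * D.opposite).SameCycle x (D.next.symm p, true) ↔ _
      rw [← h3]
      refine ⟨fun h => ?_, fun h => ?_⟩
      · have h4 := Equiv.Perm.sameCycle_apply_of_involutions' D.opposite_opposite hσ (hfix x hx) h
        rwa [opposite_opposite] at h4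
      · exact Equiv.Perm.sameCycle_apply_of_involutions' D.opposite_opposite hσ (hfix x hx) h
    · rfl
  have hE : ∀ e e', D.strands I c e e' → (G e ↔ G e') := by
    intro e e' h
    change Relation.EqvGen _ _ _ at h
    induction h with
    | rel e e' h =>
      obtain ⟨d, hd, rfl, rfl⟩ := h
      rw [hG, hG]
      have h3 : σ d = D.smooth I d := if_neg hd
      have h4 : σ (D.smooth I d) = d := by rw [← h3, hσ]
      refine ⟨fun h => ?_, fun h => ?_⟩
      · rw [← h3]
        exact Equiv.Perm.sameCycle_apply_of_involutions D.opposite_opposite hσ (hfix x hx) h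
      · rw [← h4]
        exact Equiv.Perm.sameCycle_apply_of_involutions D.opposite_opposite hσ (hfix x hx) h
    | refl e => rfl
    | symm e e' _ ih => exact ih.symm
    | trans e e' e'' _ _ ih ih' => exact ih.trans ih'
  have hGx : G (D.arcOf x) := (hG x).2 (Equiv.Perm.SameCycle.refl _ _)
  exact hyz (Equiv.Perm.eq_of_fixed_of_involutions D.opposite_opposite hσ (hfix x hx) (hfix y hy)
    (hfix z hz) ((hG y).1 ((hE _ _ h1).1 hGx)) ((hG z).1 ((hE _ _ h2).1 hGx)) hyx hzx)

/-! ### Cycles modulo 2 on a planar graph -/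

/-- The boundary map of the 4-valent graph modulo 2, as a matrix. -/
def boundaryMatrix : Matrix (Fin D.n) (Fin D.n × Bool) (ZMod 2) :=
  Matrix.of fun v p => (if p.1 = v then 1 else 0) + (if (D.next p).1 = v then 1 else 0)

theorem boundaryMatrix_mulVec (f : Fin D.n × Bool → ZMod 2) (v : Fin D.n) :
    D.boundaryMatrix.mulVec f v =
      f (v, true) + f (v, false) + (f (D.next.symm (v, true)) + f (D.next.symm (v, false))) := by
  simp only [Matrix.mulVec, dotProduct, boundaryMatrix, Matrix.of_apply, add_mul, ite_mul, one_mul,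
    zero_mul, Finset.sum_add_distrib]
  congr 1
  · rw [Fintype.sum_prod_type, Finset.sum_eq_single v] <;> simp +contextual
  · rw [← Equiv.sum_comp D.next.symm, Fintype.sum_prod_type, Finset.sum_eq_single v] <;>
      simp +contextual

theorem boundaryMatrix_transpose_mulVec (f : Fin D.n → ZMod 2) (p : Fin D.n × Bool) :
    D.boundaryMatrix.transpose.mulVec f p = f p.1 + f (D.next p).1 := by
  simp [Matrix.mulVec, dotProduct, boundaryMatrix, add_mul, Finset.sum_add_distrib]

/-- The coboundary of the faces modulo 2. -/
def faceMap : (D.Face → ZMod 2) →ₗ[ZMod 2] (Fin D.n × Bool → ZMod 2) where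
  toFun f p := f (Quotient.mk _ (p, true)) + f (Quotient.mk _ (D.opposite (p, true)))
  map_add' f g := by
    ext p
    simp only [Pi.add_apply]
    ring
  map_smul' k f := by
    ext p
    simp [mul_add]

theorem mk_rotate (d : D.Dart) :
    (Quotient.mk _ (D.rotate d) : D.Face) = Quotient.mk _ (D.opposite d) := by
  refine Quotient.sound ?_
  refine (Equiv.Perm.SameCycle.symm ⟨1, ?_⟩ : Equiv.Perm.SameCycle _ _ _)
  simp

/-- A function constant along edges factors through the connected components. This bounds both
kernels in the Euler characteristic count below. -/
theorem finrank_le_of_const_on_pieces {V : Type*} [AddCommGroup V] [Module (ZMod 2) V]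
    (φ : V →ₗ[ZMod 2] (Fin D.n → ZMod 2)) (hφ : Function.Injective φ)
    (h : ∀ v p, φ v p.1 = φ v (D.next p).1) :
    Module.finrank (ZMod 2) V ≤ Nat.card D.Piece := by
  have hc : ∀ v, ∀ c c' : Fin D.n, (Relation.EqvGen.setoid
      fun c c' : Fin D.n => ∃ s, (D.next (c, s)).1 = c') c c' → φ v c = φ v c' := by
    intro v c c' hcc
    change Relation.EqvGen _ _ _ at hcc
    induction hcc with
    | rel c c' hcc =>
      obtain ⟨s, rfl⟩ := hcc
      exact h v (c, s)
    | refl c => rfl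
    | symm c c' _ ih => exact ih.symm
    | trans c c' c'' _ _ ih ih' => exact ih.trans ih'
  let ψ : V →ₗ[ZMod 2] (D.Piece → ZMod 2) :=
    { toFun := fun v => Quotient.lift (φ v) (hc v)
      map_add' := fun v w => by
        ext q
        induction q using Quotient.inductionOn
        simp
      map_smul' := fun k v => by
        ext q
        induction q using Quotient.inductionOn
        simp }
  have hψ : Function.Injective ψ := by
    intro v w hvw
    apply hφ
    ext c
    exact congrFun hvw (Quotient.mk _ c)
  have : Fintype D.Piece := Fintype.ofFinite _
  calc Module.finrank (ZMod 2) V ≤ Module.finrank (ZMod 2) (D.Piece → ZMod 2) :=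
        LinearMap.finrank_le_finrank_of_injective hψ
    _ = Nat.card D.Piece := by simp

/-- The boundary at `v` is the sum of `φ d + φ (rotate d)` over the four half-edges `d` at `v`.
Since `rotate` permutes them, every value occurs twice. -/
theorem boundary_faceMap (f : D.Face → ZMod 2) :
    D.boundaryMatrix.mulVec (D.faceMap f) = 0 := by
  ext v
  obtain ⟨φ, hφ⟩ : ∃ φ : D.Dart → ZMod 2, ∀ d, f (Quotient.mk _ d) = φ d := ⟨_, fun _ => rfl⟩
  have h1 : ∀ d : D.Dart, φ (D.opposite d) = φ (D.rotate d) := fun d => by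
    rw [← hφ, ← hφ, mk_rotate]
  have h2 : ∀ p, D.faceMap f p = φ (p, true) + φ (D.rotate (p, true)) := fun p => by
    rw [← h1, ← hφ, ← hφ]
    rfl
  have h3 : ∀ p, D.faceMap f (D.next.symm p) = φ (p, false) + φ (D.rotate (p, false)) := by
    intro p
    rw [← h1, ← hφ, ← hφ]
    simp [faceMap, opposite, add_comm]
  have h4 : ∀ x : ZMod 2, x + x = 0 := CharTwo.add_self_eq_zero
  rw [boundaryMatrix_mulVec, h2, h2, h3, h3]
  cases h : D.positive v <;> simp only [rotate, h, Equiv.coe_fn_mk] <;> simp <;>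
    linear_combination h4 (φ ((v, true), true)) + h4 (φ ((v, false), true)) +
      h4 (φ ((v, true), false)) + h4 (φ ((v, false), false))

/-- On a planar diagram, every cycle modulo 2 is the boundary of a set of faces. -/
theorem IsPlanar.exists_faceMap_eq {D : GaussCode} (hD : D.IsPlanar)
    (g : Fin D.n × Bool → ZMod 2) (hg : D.boundaryMatrix.mulVec g = 0) :
    ∃ f, D.faceMap f = g := by
  have : Fintype D.Face := Fintype.ofFinite _
  have hle : LinearMap.range D.faceMap ≤ LinearMap.ker D.boundaryMatrix.mulVecLin := by
    rintro _ ⟨f, rfl⟩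
    exact D.boundary_faceMap f
  -- A function in the kernel agrees on both sides of every edge. It is therefore constant on the
  -- faces around each crossing and then along each piece.
  have h1 : Module.finrank (ZMod 2) (LinearMap.ker D.faceMap) ≤ Nat.card D.Piece := by
    have hker : ∀ f ∈ LinearMap.ker D.faceMap, ∀ d : D.Dart,
        f (Quotient.mk _ (D.opposite d)) = f (Quotient.mk _ d) := by
      intro f hf d
      obtain ⟨p, o⟩ := d
      cases o
      · have h := congrFun hf (D.next.symm p)
        have h2 := CharTwo.add_eq_zero.1 h
        simpa [opposite] using h2
      · exact (CharTwo.add_eq_zero.1 (congrFun hf p)).symm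
    have hrot : ∀ f ∈ LinearMap.ker D.faceMap, ∀ d : D.Dart,
        f (Quotient.mk _ (D.rotate d)) = f (Quotient.mk _ d) := by
      intro f hf d
      rw [mk_rotate, hker f hf]
    have hall : ∀ f ∈ LinearMap.ker D.faceMap, ∀ d : D.Dart,
        f (Quotient.mk _ d) = f (Quotient.mk _ ((d.1.1, true), true)) := by
      intro f hf d
      obtain ⟨φ, hφ⟩ : ∃ φ : D.Dart → ZMod 2, ∀ d, f (Quotient.mk _ d) = φ d :=
        ⟨_, fun _ => rfl⟩
      have h0 : ∀ d : D.Dart, φ (D.rotate d) = φ d := fun d => by rw [← hφ, ← hφ, hrot f hf]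
      rw [hφ, hφ]
      obtain ⟨⟨c, s⟩, o⟩ := d
      have h1 := h0 ((c, true), true)
      have h2 := h0 ((c, false), true)
      have h3 := h0 ((c, true), false)
      have h4 := h0 ((c, false), false)
      cases h : D.positive c <;> simp [rotate, h] at h1 h2 h3 h4 <;> clear hker hrot h0 hφ <;>
        cases s <;> cases o <;> grind only
    refine D.finrank_le_of_const_on_pieces
      { toFun := fun f c => f.1 (Quotient.mk _ ((c, true), true))
        map_add' := fun _ _ => rfl
        map_smul' := fun _ _ => rfl } ?_ ?_
    · intro f f' hff
      ext q
      induction q using Quotient.inductionOn with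
      | h d =>
        rw [hall f.1 f.2, hall f'.1 f'.2]
        exact congrFun hff d.1.1
    · intro f p
      change f.1 (Quotient.mk _ ((p.1, true), true)) =
        f.1 (Quotient.mk _ (((D.next p).1, true), true))
      rw [← hall f.1 f.2 (p, true), ← hker f.1 f.2, ← hall f.1 f.2 (D.next p, false)]
      rfl
  have h2 : Module.finrank (ZMod 2) (LinearMap.ker D.boundaryMatrix.transpose.mulVecLin) ≤
      Nat.card D.Piece := by
    refine D.finrank_le_of_const_on_pieces (Submodule.subtype _) (Submodule.subtype_injective _) ?_
    intro f p
    have h := congrFun f.2 p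
    rw [Matrix.mulVecLin_apply, boundaryMatrix_transpose_mulVec] at h
    exact CharTwo.add_eq_zero.1 h
  have h3 := LinearMap.finrank_range_add_finrank_ker D.faceMap
  have h4 := LinearMap.finrank_range_add_finrank_ker D.boundaryMatrix.mulVecLin
  have h5 := LinearMap.finrank_range_add_finrank_ker D.boundaryMatrix.transpose.mulVecLin
  have h6 := D.boundaryMatrix.rank_transpose
  simp only [Matrix.rank] at h6
  have h7 := Submodule.finrank_mono hle
  rw [Module.finrank_fintype_fun_eq_card] at h3 h4 h5
  rw [← Nat.card_eq_fintype_card] at h3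
  simp only [Fintype.card_prod, Fintype.card_fin, Fintype.card_bool] at h4 h5
  have h8 := hD
  unfold IsPlanar at h8
  -- With `n` crossings, `F` faces and `P` pieces, the image of `faceMap` has dimension at least `F
  -- - P`. The boundary has rank at least `n - P`, so the cycles have dimension at most `n + P`.
  -- Planarity says `F - P = n + P`.
  have heq := Submodule.eq_of_le_of_finrank_le hle (by omega)
  have hg' : g ∈ LinearMap.ker D.boundaryMatrix.mulVecLin := hg
  rw [← heq] at hg'
  exact hg'

end GaussCode

/-! ### Merging and splitting of circles -/

/-- The equivalence relation `r'` is obtained from `r` by merging the different classes of `a`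
and `b`. -/
structure Setoid.Merges {α : Type*} (r r' : Setoid α) (a b : α) : Prop where
  not_rel : ¬ r a b
  le : r ≤ r'
  rel : r' a b
  of_rel : ∀ {x y}, r' x y → ¬ r' x a → r x y
  of_rel_left : ∀ {x}, r' x a → r x a ∨ r x b

/-- The equivalence relation obtained by merging the classes of `a` and `b`. -/
def Setoid.merge {α : Type*} (r : Setoid α) (a b : α) : Setoid α where
  r x y := r x y ∨ ((r x a ∨ r x b) ∧ (r y a ∨ r y b))
  iseqv :=
    { refl := fun x => Or.inl (r.refl x)
      symm := by
        rintro x y (h | ⟨h, h'⟩)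
        · exact Or.inl (r.symm h)
        · exact Or.inr ⟨h', h⟩
      trans := by
        rintro x y z (h | ⟨h, h'⟩) (k | ⟨k, k'⟩)
        · exact Or.inl (r.trans h k)
        · exact Or.inr ⟨k.imp (r.trans h) (r.trans h), k'⟩
        · exact Or.inr ⟨h, h'.imp (r.trans (r.symm k)) (r.trans (r.symm k))⟩
        · exact Or.inr ⟨h, k'⟩ }

theorem Setoid.merges_of_le_merge {α : Type*} {r r' : Setoid α} {a b : α} (h : ¬ r a b)
    (hle : r ≤ r') (hab : r' a b) (h' : r' ≤ r.merge a b) : r.Merges r' a b where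
  not_rel := h
  le := hle
  rel := hab
  of_rel := by
    intro x y hxy hx
    rcases h' hxy with h1 | ⟨h1 | h1, -⟩
    · exact h1
    · exact absurd (hle h1) hx
    · exact absurd (r'.trans (hle h1) (r'.symm hab)) hx
  of_rel_left := by
    intro x hx
    rcases h' hx with h1 | ⟨h1, -⟩
    · exact Or.inl h1
    · exact h1

namespace GaussCode

variable {D : GaussCode}

/-- Half-edges of different strands are neighbours around the crossing. In particular a smoothing
only joins neighbours, so it stays within one face corner. -/
theorem rotate_eq_or {d d' : D.Dart} (h : d.1.1 = d'.1.1) (h' : d'.1.2 = !d.1.2) :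
    D.rotate d = d' ∨ D.rotate d' = d := by
  obtain ⟨⟨c, s⟩, o⟩ := d
  obtain ⟨⟨c', s'⟩, o'⟩ := d'
  obtain rfl : c = c' := h
  obtain rfl : s' = !s := h'
  cases hc : D.positive c <;> cases s <;> cases o <;> cases o' <;> simp [rotate, hc]

open Classical in
/-- On a planar diagram, the two half-edges of the overstrand at a crossing do not lie on the same
strand of a resolution that is cut open at the crossing. -/
theorem IsPlanar.not_strands (hD : D.IsPlanar) (I : Finset (Fin D.n)) (c : Fin D.n) :
    ¬ D.strands I c (D.inArc c true) (D.outArc c true) := by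
  intro h1
  -- If the overstrand closes up, neither end of the understrand can lie on the same strand, as a
  -- strand has at most two ends at `c`. By parity the two understrand ends are then joined to each
  -- other (`h4`).
  have hall := fun z hz h1' h2' => D.not_all_strands I c (x := ((c, true), false))
    (y := ((c, true), true)) (z := z) rfl rfl hz (by simp) h1' h2' h1
  have h2 : ¬ D.strands I c (D.inArc c true) (D.inArc c false) :=
    hall ((c, false), false) rfl (by simp) (by simp)
  have h3 : ¬ D.strands I c (D.inArc c true) (D.outArc c false) :=
    hall ((c, false), true) rfl (by simp) (by simp)
  have h4 : D.strands I c (D.outArc c false) (D.inArc c false) := by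
    by_contra h4
    have h5 := D.even_ends I c
      (fun e => if D.strands I c (D.outArc c false) e then 1 else 0) (by
        intro x y hxy
        have : D.strands I c (D.outArc c false) x ↔ D.strands I c (D.outArc c false) y :=
          ⟨fun h => (D.strands I c).trans h hxy,
            fun h => (D.strands I c).trans h ((D.strands I c).symm hxy)⟩
        simp [this])
    have h6 : ¬ D.strands I c (D.outArc c false) (D.inArc c true) :=
      fun h => h3 ((D.strands I c).symm h)
    have h7 : ¬ D.strands I c (D.outArc c false) (D.outArc c true) :=
      fun h => h6 ((D.strands I c).trans h ((D.strands I c).symm h1))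
    simp [h4, h6, h7] at h5
  -- The closed curve that follows the strand of the overstrand and runs straight through `c`. It is
  -- a cycle modulo 2, hence the boundary of a colouring `φ` of the faces.
  let f : D.Arc → ZMod 2 := fun e => if D.strands I c (D.inArc c true) e then 1 else 0
  have hf : ∀ x y, D.strands I c x y → f x = f y := by
    intro x y hxy
    have : D.strands I c (D.inArc c true) x ↔ D.strands I c (D.inArc c true) y :=
      ⟨fun h => (D.strands I c).trans h hxy,
        fun h => (D.strands I c).trans h ((D.strands I c).symm hxy)⟩
    simp [f, this]
  have hf1 : f (D.inArc c true) = 1 := if_pos ((D.strands I c).refl _)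
  have hf2 : f (D.outArc c true) = 1 := if_pos h1
  have hf3 : f (D.inArc c false) = 0 := if_neg h2
  have hf4 : f (D.outArc c false) = 0 := if_neg h3
  have h0 : ∀ x : ZMod 2, x + x = 0 := CharTwo.add_self_eq_zero
  obtain ⟨φ, hφ⟩ := hD.exists_faceMap_eq (fun p => f (Sum.inl p)) (by
    ext v
    rw [boundaryMatrix_mulVec]
    change f (D.outArc v true) + f (D.outArc v false) +
      (f (D.inArc v true) + f (D.inArc v false)) = 0
    by_cases hv : v = c
    · subst hv
      rw [hf1, hf2, hf3, hf4]
      rfl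
    · have hj : ∀ d : D.Dart, d.1.1 ≠ c → f (D.arcOf d) = f (D.arcOf (D.smooth I d)) :=
        fun d hd => hf _ _ (D.strands_smooth I hd)
      have k1 := hj ((v, true), true) hv
      have k2 := hj ((v, false), true) hv
      have k3 := hj ((v, true), false) hv
      by_cases ho : D.positive v = true ↔ v ∉ I
      · simp only [smooth, ho, iff_self, if_true, arcOf_true, Bool.not_true, Bool.not_false,
          arcOf_false] at k1 k2
        simp only [outArc, inArc, k1, k2]
        linear_combination h0 (f (Sum.inl (D.next.symm (v, true)))) +
          h0 (f (Sum.inl (D.next.symm (v, false))))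
      · simp only [smooth, if_neg ho, arcOf_true, Bool.not_true, arcOf_false] at k1 k3
        simp only [outArc, inArc, k1, k3]
        linear_combination h0 (f (Sum.inl (v, false))) +
          h0 (f (Sum.inl (D.next.symm (v, false)))))
  obtain ⟨ψ, hψ⟩ : ∃ ψ : D.Dart → ZMod 2, ∀ d, φ (Quotient.mk _ d) = ψ d := ⟨_, fun _ => rfl⟩
  have hrot : ∀ d, ψ (D.rotate d) = ψ (D.opposite d) := fun d => by rw [← hψ, ← hψ, mk_rotate]
  have hcol : ∀ d, ψ d + ψ (D.opposite d) = f (D.arcOf d) := by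
    rintro ⟨p, o⟩
    cases o
    · have h := congrFun hφ (D.next.symm p)
      simp only [faceMap, LinearMap.coe_mk, AddHom.coe_mk, hψ] at h
      rw [arcOf_false, ← h, add_comm]
      simp [opposite]
    · have h := congrFun hφ p
      simp only [faceMap, LinearMap.coe_mk, AddHom.coe_mk, hψ] at h
      exact h
  have hcol0 : ∀ d, f (D.arcOf d) = 0 → ψ (D.opposite d) = ψ d := fun d hd =>
    (CharTwo.add_eq_zero.1 ((hcol d).trans hd)).symm
  -- The colour of the region around an arc off the curve. It is constant along strands: both sides
  -- of such an arc have the same colour, and a smoothing joins half-edges that share a face corner.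
  let K : D.Arc → Option (ZMod 2) := fun e => match e with
    | .inl p => if f (Sum.inl p) = 0 then some (ψ (p, true)) else none
    | .inr _ => none
  have hK : ∀ d, K (D.arcOf d) = if f (D.arcOf d) = 0 then some (ψ d) else none := by
    rintro ⟨p, o⟩
    cases o
    · by_cases h : f (D.arcOf (p, false)) = 0
      · rw [if_pos h]
        have h' := hcol0 _ h
        rw [arcOf_false] at h
        simp only [arcOf_false, K, if_pos h]
        rw [← h']
        simp [opposite]
      · rw [if_neg h]
        exact if_neg h
    · rfl
  have hKE : ∀ x y, D.strands I c x y → K x = K y := by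
    intro x y h
    change Relation.EqvGen _ _ _ at h
    induction h with
    | rel x y h =>
      obtain ⟨d, hd, rfl, rfl⟩ := h
      have hfd := hf _ _ (D.strands_smooth I hd)
      rw [hK, hK, ← hfd]
      by_cases h : f (D.arcOf d) = 0
      · rw [if_pos h, if_pos h]
        rcases rotate_eq_or (d := d) (d' := D.smooth I d) rfl rfl with h' | h'
        · rw [← hcol0 d h, ← hrot, h']
        · rw [← hcol0 (D.smooth I d) (hfd ▸ h), ← hrot, h']
      · rw [if_neg h, if_neg h]
    | refl x => rfl
    | symm x y _ ih => exact ih.symm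
    | trans x y z _ _ ih ih' => exact ih.trans ih'
  have hKc := hKE _ _ h4
  have e1 : D.outArc c false = D.arcOf ((c, false), true) := rfl
  have e2 : D.inArc c false = D.arcOf ((c, false), false) := rfl
  have e3 : D.outArc c true = D.arcOf ((c, true), true) := rfl
  rw [e1] at hKc hf4
  rw [e2] at hKc hf3
  rw [e3] at hf2
  -- The understrand ends have the same colour by `h4`. At `c` they lie on different sides of the
  -- outgoing overstrand half-edge, whose two sides have different colours.
  rw [hK, hK, if_pos hf3, if_pos hf4, Option.some_inj] at hKc
  have h5 := hcol ((c, true), true)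
  rw [hf2, ← hrot] at h5
  have h6 := hcol0 _ hf3
  have h7 := hcol0 _ hf4
  rw [← hrot] at h6 h7
  cases hc : D.positive c <;> simp only [rotate, hc, Equiv.coe_fn_mk] at h5 h6 h7 <;>
    simp at h5 h6 h7
  · rw [h7, hKc, h0] at h5
    exact zero_ne_one h5
  · rw [h6, hKc, h0] at h5
    exact zero_ne_one h5

open Classical in
/-- One of the two smoothings of a crossing of a planar diagram connects the ends of each of the two
strands. -/
theorem IsPlanar.strands_smooth_or (hD : D.IsPlanar) (I : Finset (Fin D.n)) {c : Fin D.n}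
    (hc : c ∉ I) :
    (∀ d : D.Dart, d.1.1 = c → D.strands I c (D.arcOf d) (D.arcOf (D.smooth I d))) ∨
    (∀ d : D.Dart, d.1.1 = c →
      D.strands I c (D.arcOf d) (D.arcOf (D.smooth (insert c I) d))) := by
  set E := D.strands I c with hE
  have hsymm : ∀ {x y}, E x y → E y x := fun h => E.symm h
  -- Every strand has an even number of ends at `c`. As the two overstrand ends are not joined, only
  -- two pairings of the four ends remain, and these are the two smoothings.
  have heven : ∀ x : D.Arc, (if E x (D.inArc c true) then (1 : ZMod 2) else 0) +
      (if E x (D.inArc c false) then 1 else 0) + (if E x (D.outArc c true) then 1 else 0) +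
      (if E x (D.outArc c false) then 1 else 0) = 0 := by
    intro e
    refine D.even_ends I c (fun e' => if E e e' then 1 else 0) ?_
    intro x y hxy
    have : E e x ↔ E e y := ⟨fun h => E.trans h hxy, fun h => E.trans h (E.symm hxy)⟩
    simp [this]
  have h1 : ¬ E (D.inArc c true) (D.outArc c true) := hD.not_strands I c
  have key : (E (D.inArc c true) (D.outArc c false) ∧ E (D.inArc c false) (D.outArc c true)) ∨
      (E (D.inArc c true) (D.inArc c false) ∧ E (D.outArc c true) (D.outArc c false)) := by
    have h2 := heven (D.inArc c true)
    rw [if_pos (E.refl _), if_neg h1] at h2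
    by_cases h3 : E (D.inArc c true) (D.inArc c false)
    · right
      have h4 := heven (D.outArc c true)
      have h5 : ¬ E (D.outArc c true) (D.inArc c true) := fun h => h1 (hsymm h)
      have h6 : ¬ E (D.outArc c true) (D.inArc c false) :=
        fun h => h5 (E.trans h (hsymm h3))
      refine ⟨h3, by_contra fun h7 => ?_⟩
      rw [if_neg h5, if_neg h6, if_pos (E.refl _), if_neg h7] at h4
      exact absurd h4 (by decide)
    · left
      have h4 : E (D.inArc c true) (D.outArc c false) := by
        by_contra h4
        rw [if_neg h3, if_neg h4] at h2
        exact absurd h2 (by decide)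
      refine ⟨h4, by_contra fun h7 => ?_⟩
      have h5 := heven (D.inArc c false)
      have h6 : ¬ E (D.inArc c false) (D.inArc c true) := fun h => h3 (hsymm h)
      have h8 : ¬ E (D.inArc c false) (D.outArc c false) :=
        fun h => h6 (E.trans h (hsymm h4))
      rw [if_neg h6, if_neg h8, if_pos (E.refl _), if_neg h7] at h5
      exact absurd h5 (by decide)
  have hK : ∀ K : Finset (Fin D.n),
      (((D.positive c = true ↔ c ∉ K) ∧ E (D.inArc c true) (D.outArc c false) ∧
        E (D.inArc c false) (D.outArc c true)) ∨
      (¬ (D.positive c = true ↔ c ∉ K) ∧ E (D.inArc c true) (D.inArc c false) ∧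
        E (D.outArc c true) (D.outArc c false))) →
      ∀ d : D.Dart, d.1.1 = c → E (D.arcOf d) (D.arcOf (D.smooth K d)) := by
    rintro K (⟨ho, k1, k2⟩ | ⟨ho, k1, k2⟩) ⟨⟨c', s⟩, o⟩ (rfl : c' = c) <;> cases s <;> cases o <;>
      simp only [smooth, ho, if_true, if_false, iff_self, Bool.not_true, Bool.not_false, arcOf_true,
        arcOf_false] <;> first | exact k1 | exact k2 | exact hsymm k1 | exact hsymm k2
  -- Moving `c` into the set turns an oriented smoothing into an unoriented one and conversely, so
  -- whichever pairing occurs is realized by `I` or by `insert c I`.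
  have hins : (D.positive c = true ↔ c ∉ insert c I) ↔ ¬ (D.positive c = true ↔ c ∉ I) := by
    simp [hc]
  by_cases ho : D.positive c = true ↔ c ∉ I
  · rcases key with k | k
    · exact Or.inl (hK I (Or.inl ⟨ho, k⟩))
    · exact Or.inr (hK _ (Or.inr ⟨fun h => hins.1 h ho, k⟩))
  · rcases key with k | k
    · exact Or.inr (hK _ (Or.inl ⟨hins.2 ho, k⟩))
    · exact Or.inl (hK I (Or.inr ⟨ho, k⟩))

/-- The two smoothings are two of the three perfect pairings of the half-edges at `c`; their
composite is the third, the passage straight through. -/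
theorem smooth_smooth_insert (I : Finset (Fin D.n)) {c : Fin D.n} (hc : c ∉ I) (s o : Bool) :
    D.smooth I (D.smooth (insert c I) ((c, s), o)) = ((c, s), !o) ∧
    D.smooth (insert c I) (D.smooth I ((c, s), o)) = ((c, s), !o) := by
  cases h : D.positive c <;> simp [smooth, hc, h]

/-- If one smoothing connects the ends of each strand, the other one merges the two circles. -/
theorem merges_of_strands (hD : D.IsPlanar) (I : Finset (Fin D.n)) (c : Fin D.n)
    {K K' : Finset (Fin D.n)} (hK : D.strands K c = D.strands I c)
    (hK' : D.strands K' c = D.strands I c)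
    (hKK : ∀ s o, D.smooth K (D.smooth K' ((c, s), o)) = ((c, s), !o))
    (h : ∀ d : D.Dart, d.1.1 = c → D.strands I c (D.arcOf d) (D.arcOf (D.smooth K d))) :
    (D.circles K).Merges (D.circles K') (D.inArc c true) (D.outArc c true) := by
  -- The joins of `K` at `c` only connect ends that already lie on one strand, so the circles of `K`
  -- are the strands.
  have h1 : D.circles K = D.strands I c :=
    le_antisymm (circles_le_of_strands_le D hK.le h) (hK ▸ D.strands_le K c)
  -- Follow the join of `K'` at `c` and then return along a strand: this leads to the opposite
  -- half-edge at the crossing, so `K'` joins the two circles.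
  have h2 : ∀ s o, D.circles K' (D.arcOf ((c, s), o)) (D.arcOf ((c, s), !o)) := by
    intro s o
    have h3 := D.circles_smooth K' ((c, s), o)
    have h4 := h (D.smooth K' ((c, s), o)) rfl
    rw [hKK, ← hK'] at h4
    exact (D.circles K').trans h3 (D.strands_le K' c h4)
  refine Setoid.merges_of_le_merge ?_ ?_ ?_ ?_
  · rw [h1]
    exact hD.not_strands I c
  · rw [h1, ← hK']
    exact D.strands_le K' c
  · exact h2 true false
  · rw [h1]
    refine circles_le_of_strands_le D (c := c) ?_ ?_
    · rw [hK']
      exact fun x y hxy => Or.inl hxy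
    · have hin : ∀ d : D.Dart, d.1.1 = c →
          D.strands I c (D.arcOf d) (D.inArc c true) ∨
            D.strands I c (D.arcOf d) (D.outArc c true) := by
        rintro ⟨⟨c', s⟩, o⟩ (rfl : c' = c)
        cases s
        · have h3 := h ((c', false), o) rfl
          cases ho : (D.smooth K ((c', false), o)).2
          · have h4 : D.smooth K ((c', false), o) = ((c', true), false) :=
              Prod.ext rfl ho
            rw [h4] at h3
            exact Or.inl h3
          · have h4 : D.smooth K ((c', false), o) = ((c', true), true) :=
              Prod.ext rfl ho
            rw [h4] at h3
            exact Or.inr h3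
        · cases o
          · exact Or.inl ((D.strands I c').refl _)
          · exact Or.inr ((D.strands I c').refl _)
      intro d hd
      exact Or.inr ⟨hin d hd, hin _ hd⟩

/-- On a planar diagram, a change of a smoothing merges two circles into one or splits a circle into
two. -/
theorem IsPlanar.merges_or_merges (hD : D.IsPlanar) (I : Finset (Fin D.n)) {c : Fin D.n}
    (hc : c ∉ I) :
    (D.circles I).Merges (D.circles (insert c I)) (D.inArc c true) (D.outArc c true) ∨
    (D.circles (insert c I)).Merges (D.circles I) (D.inArc c true) (D.outArc c true) := by
  rcases hD.strands_smooth_or I hc with h | h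
  · exact Or.inl (merges_of_strands hD I c rfl (D.strands_insert I c)
      (fun s o => (smooth_smooth_insert I hc s o).1) h)
  · exact Or.inr (merges_of_strands hD I c (D.strands_insert I c) rfl
      (fun s o => (smooth_smooth_insert I hc s o).2) h)

end GaussCode

/-! ## The Frobenius algebra on the circles of a resolution -/

namespace CircleAlgebra

open Classical

variable {α : Type} {r r' : Setoid α} {a b : α}

/-- A labelling of the elements of `α` that is constant on the classes. -/
def IsLab (r : Setoid α) (x : α → Bool) : Prop := ∀ a b, r a b → x a = x b

/-- Change of the label of one class. -/
noncomputable def upd (r : Setoid α) (e : α) (v : Bool) (x : α → Bool) : α → Bool :=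
  fun a => if r a e then v else x a

theorem upd_of_rel {e e' : α} (h : r e' e) (v : Bool) (x : α → Bool) : upd r e v x e' = v :=
  if_pos h

theorem upd_of_not_rel {e e' : α} (h : ¬ r e' e) (v : Bool) (x : α → Bool) :
    upd r e v x e' = x e' := if_neg h

@[simp] theorem upd_same (e : α) (v : Bool) (x : α → Bool) : upd r e v x e = v :=
  upd_of_rel (r.refl e) v x

@[simp] theorem upd_upd (e : α) (v w : Bool) (x : α → Bool) :
    upd r e v (upd r e w x) = upd r e v x := by
  funext z
  by_cases h : r z e <;> simp [upd, h]

theorem upd_comm {e e' : α} (h : ¬ r e e') (v w : Bool) (x : α → Bool) :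
    upd r e v (upd r e' w x) = upd r e' w (upd r e v x) := by
  funext z
  by_cases h1 : r z e
  · have h2 : ¬ r z e' := fun h2 => h (r.trans (r.symm h1) h2)
    simp [upd, h1, h2]
  · simp [upd, h1]

theorem upd_congr {e e' : α} (h : r e e') (v : Bool) (x : α → Bool) :
    upd r e v x = upd r e' v x := by
  funext z
  have : r z e ↔ r z e' := ⟨fun h1 => r.trans h1 h, fun h1 => r.trans h1 (r.symm h)⟩
  simp [upd, this]

theorem upd_eq_self {e : α} {v : Bool} {x : α → Bool} (hx : IsLab r x) (h : x e = v) :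
    upd r e v x = x := by
  funext z
  by_cases h1 : r z e
  · rw [upd_of_rel h1, hx _ _ h1, h]
  · exact upd_of_not_rel h1 v x

theorem isLab_upd {x : α → Bool} (hx : IsLab r x) (e : α) (v : Bool) :
    IsLab r (upd r e v x) := by
  intro y z h
  have : r y e ↔ r z e := ⟨fun h1 => r.trans (r.symm h) h1, fun h1 => r.trans h h1⟩
  simp [upd, this, hx _ _ h]

theorem isLab_true : IsLab r fun _ => true := fun _ _ _ => rfl

theorem IsLab.mono {x : α → Bool} (h : r ≤ r') (hx : IsLab r' x) : IsLab r x :=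
  fun _ _ hab => hx _ _ (h hab)

section Merges

variable (m : r.Merges r' a b)

include m

theorem upd_off_of_merges {e : α} (he : ¬ r' e a) (v : Bool) (x : α → Bool) :
    upd r' e v x = upd r e v x := by
  funext z
  have : r' z e ↔ r z e := by
    refine ⟨fun h => r.symm (m.of_rel (r'.symm h) he), fun h => m.le h⟩
  simp [upd, this]

theorem merges_rel_iff {e : α} : r' e a ↔ r e a ∨ r e b :=
  ⟨m.of_rel_left, fun h => h.elim (fun h => m.le h) fun h => r'.trans (m.le h) (r'.symm m.rel)⟩

theorem upd_upd_left_of_merges (v w : Bool) (x : α → Bool) :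
    upd r' a v (upd r a w x) = upd r' a v x := by
  funext z
  by_cases h1 : r z a <;> by_cases h2 : r z b <;> simp [upd, merges_rel_iff m, h1, h2]

theorem upd_upd_right_of_merges (v w : Bool) (x : α → Bool) :
    upd r' a v (upd r b w x) = upd r' a v x := by
  funext z
  by_cases h1 : r z a <;> by_cases h2 : r z b <;> simp [upd, merges_rel_iff m, h1, h2]

theorem upd_upd_merged (v w : Bool) (k : Bool) (x : α → Bool) :
    upd r b w (upd r a v (upd r' a k x)) = upd r b w (upd r a v x) := by
  funext z
  by_cases h1 : r z a <;> by_cases h2 : r z b <;> simp [upd, merges_rel_iff m, h1, h2]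

theorem isLab_upd_of_merges {x : α → Bool} (hx : IsLab r x) (v : Bool) :
    IsLab r' (upd r' a v x) := by
  intro y z h
  by_cases hy : r' y a
  · have hz : r' z a := r'.trans (r'.symm h) hy
    rw [upd_of_rel hy, upd_of_rel hz]
  · have hz : ¬ r' z a := fun hz => hy (r'.trans h hz)
    rw [upd_of_not_rel hy, upd_of_not_rel hz]
    exact hx _ _ (m.of_rel h hy)

theorem not_rel_off {e : α} (he : ¬ r' e a) : ¬ r e a ∧ ¬ r e b :=
  ⟨fun h => he ((merges_rel_iff m).2 (Or.inl h)), fun h => he ((merges_rel_iff m).2 (Or.inr h))⟩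

end Merges

variable {F : Type u} [Field F] (h t : F)

/-- The tensor product of copies of `A` indexed by `α`, with its standard basis. -/
abbrev Space (F : Type u) [Field F] (α : Type) : Type u := (α → Bool) →₀ F

/-- A basis element. -/
noncomputable abbrev del (F : Type u) [Field F] (x : α → Bool) : Space F α := Finsupp.single x 1

/-- The tensor product of copies of `A` indexed by the classes of `r`. -/
noncomputable def labSpace (F : Type u) [Field F] (r : Setoid α) : Submodule F (Space F α) :=
  Submodule.span F (del F '' {x | IsLab r x})

theorem del_mem {x : α → Bool} (hx : IsLab r x) : del F x ∈ labSpace F r :=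
  Submodule.subset_span ⟨x, hx, rfl⟩

theorem eqOn_labSpace {V : Type*} [AddCommGroup V] [Module F V] {A B : Space F α →ₗ[F] V}
    (hAB : ∀ x, IsLab r x → A (del F x) = B (del F x)) {f : Space F α} (hf : f ∈ labSpace F r) :
    A f = B f := by
  refine LinearMap.eqOn_span ?_ hf
  rintro _ ⟨x, hx, rfl⟩
  exact hAB x hx

theorem map_labSpace_mem {A : Space F α →ₗ[F] Space F α}
    (hA : ∀ x, IsLab r x → A (del F x) ∈ labSpace F r') {f : Space F α} (hf : f ∈ labSpace F r) :
    A f ∈ labSpace F r' := by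
  have : labSpace F r ≤ (labSpace F r').comap A := by
    rw [labSpace, Submodule.span_le]
    rintro _ ⟨x, hx, rfl⟩
    exact hA x hx
  exact this hf

/-- Multiplication by `X` on the class of `e`. -/
noncomputable def mulX (r : Setoid α) (e : α) : Space F α →ₗ[F] Space F α :=
  Finsupp.linearCombination F fun x => ∑ v, mulCoeff h t false (x e) v • del F (upd r e v x)

/-- The multiplication that corresponds to a merging of the classes of `a` and `b`. -/
noncomputable def mergeMap (r' : Setoid α) (a b : α) : Space F α →ₗ[F] Space F α :=
  Finsupp.linearCombination F fun x => ∑ v, mulCoeff h t (x a) (x b) v • del F (upd r' a v x)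

/-- The comultiplication that corresponds to a splitting of a class into those of `a` and `b`. -/
noncomputable def splitMap (r' : Setoid α) (a b : α) : Space F α →ₗ[F] Space F α :=
  Finsupp.linearCombination F fun x =>
    ∑ v, ∑ w, comulCoeff h t (x a) v w • del F (upd r' b w (upd r' a v x))

theorem mulX_del (r : Setoid α) (e : α) (x : α → Bool) : mulX h t r e (del F x) =
    ∑ v, mulCoeff h t false (x e) v • del F (upd r e v x) := by
  simp [mulX]

theorem mergeMap_del (r' : Setoid α) (a b : α) (x : α → Bool) : mergeMap h t r' a b (del F x) =
    ∑ v, mulCoeff h t (x a) (x b) v • del F (upd r' a v x) := by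
  simp [mergeMap]

theorem splitMap_del (r' : Setoid α) (a b : α) (x : α → Bool) : splitMap h t r' a b (del F x) =
    ∑ v, ∑ w, comulCoeff h t (x a) v w • del F (upd r' b w (upd r' a v x)) := by
  simp [splitMap]

theorem mulX_mem (e : α) {f : Space F α} (hf : f ∈ labSpace F r) :
    mulX h t r e f ∈ labSpace F r := by
  refine map_labSpace_mem (fun x hx => ?_) hf
  rw [mulX_del]
  exact Submodule.sum_mem _ fun v _ => Submodule.smul_mem _ _ (del_mem (isLab_upd hx e v))

theorem mulX_congr {e e' : α} (he : r e e') {f : Space F α} (hf : f ∈ labSpace F r) :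
    mulX h t r e f = mulX h t r e' f := by
  refine eqOn_labSpace (fun x hx => ?_) hf
  simp only [mulX_del, hx _ _ he, upd_congr he]

theorem mulX_comm (e e' : α) {f : Space F α} (hf : f ∈ labSpace F r) :
    mulX h t r e (mulX h t r e' f) = mulX h t r e' (mulX h t r e f) := by
  by_cases he : r e e'
  · rw [mulX_congr h t he (mulX_mem h t e' hf), mulX_congr h t he hf]
  · refine eqOn_labSpace (A := mulX h t r e ∘ₗ mulX h t r e') (B := mulX h t r e' ∘ₗ mulX h t r e)
      (fun x hx => ?_) hf
    have he' : ¬ r e' e := fun h => he (r.symm h)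
    simp only [LinearMap.comp_apply, mulX_del, map_sum, map_smul, upd_of_not_rel he,
      upd_of_not_rel he', Finset.smul_sum, smul_smul]
    rw [Finset.sum_comm]
    refine Finset.sum_congr rfl fun v _ => Finset.sum_congr rfl fun w _ => ?_
    rw [mul_comm, upd_comm he]

theorem mergeMap_mem (m : r.Merges r' a b) {f : Space F α} (hf : f ∈ labSpace F r) :
    mergeMap h t r' a b f ∈ labSpace F r' := by
  refine map_labSpace_mem (fun x hx => ?_) hf
  rw [mergeMap_del]
  exact Submodule.sum_mem _ fun v _ => Submodule.smul_mem _ _ (del_mem (isLab_upd_of_merges m hx v))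

theorem splitMap_mem (m : r.Merges r' a b) {f : Space F α} (hf : f ∈ labSpace F r') :
    splitMap h t r a b f ∈ labSpace F r := by
  refine map_labSpace_mem (fun x hx => ?_) hf
  rw [splitMap_del]
  exact Submodule.sum_mem _ fun v _ => Submodule.sum_mem _ fun w _ =>
    Submodule.smul_mem _ _ (del_mem (isLab_upd (isLab_upd (hx.mono m.le) a v) b w))

/-- On the merged circle this is associativity and commutativity of `A`, a check of structure
constants. Away from it the two operations act on different tensor factors. -/
theorem mergeMap_mulX (m : r.Merges r' a b) (e : α) {f : Space F α} (hf : f ∈ labSpace F r) :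
    mergeMap h t r' a b (mulX h t r e f) = mulX h t r' e (mergeMap h t r' a b f) := by
  by_cases he : r' e a
  · rcases m.of_rel_left he with hea | heb
    · rw [mulX_congr h t hea hf, mulX_congr h t he (mergeMap_mem h t m hf)]
      refine eqOn_labSpace (A := mergeMap h t r' a b ∘ₗ mulX h t r a)
        (B := mulX h t r' a ∘ₗ mergeMap h t r' a b) (fun x hx => ?_) hf
      have hb : ∀ v, upd r a v x b = x b := fun v => upd_of_not_rel (fun h => m.not_rel (r.symm h)) v x
      simp only [LinearMap.comp_apply, mulX_del, mergeMap_del, map_add, map_smul, upd_same, hb,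
        upd_upd_left_of_merges m, upd_upd, Fintype.sum_bool]
      cases x a <;> cases x b <;> simp only [mulCoeff] <;> module
    · rw [mulX_congr h t heb hf, mulX_congr h t he (mergeMap_mem h t m hf)]
      refine eqOn_labSpace (A := mergeMap h t r' a b ∘ₗ mulX h t r b)
        (B := mulX h t r' a ∘ₗ mergeMap h t r' a b) (fun x hx => ?_) hf
      have ha : ∀ v, upd r b v x a = x a := fun v => upd_of_not_rel m.not_rel v x
      simp only [LinearMap.comp_apply, mulX_del, mergeMap_del, map_add, map_smul, upd_same, ha,
        upd_upd_right_of_merges m, upd_upd, Fintype.sum_bool]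
      cases x a <;> cases x b <;> simp only [mulCoeff] <;> module
  · refine eqOn_labSpace (A := mergeMap h t r' a b ∘ₗ mulX h t r e)
      (B := mulX h t r' e ∘ₗ mergeMap h t r' a b) (fun x hx => ?_) hf
    have ha : ∀ v, upd r e v x a = x a := fun v =>
      upd_of_not_rel (fun h => (not_rel_off m he).1 (r.symm h)) v x
    have hb : ∀ v, upd r e v x b = x b := fun v =>
      upd_of_not_rel (fun h => (not_rel_off m he).2 (r.symm h)) v x
    simp only [LinearMap.comp_apply, mulX_del, mergeMap_del, map_sum, map_smul, ha, hb,
      upd_of_not_rel he, Finset.smul_sum, smul_smul]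
    rw [Finset.sum_comm]
    refine Finset.sum_congr rfl fun v _ => Finset.sum_congr rfl fun w _ => ?_
    rw [mul_comm, ← upd_off_of_merges m he, upd_comm he]

/-- The comultiplication of a Frobenius algebra is a map of bimodules: `X` on the circle that splits
may be moved to either of the two new circles. -/
theorem splitMap_mulX (m : r.Merges r' a b) (e : α) {f : Space F α} (hf : f ∈ labSpace F r') :
    splitMap h t r a b (mulX h t r' e f) = mulX h t r e (splitMap h t r a b f) := by
  have hba : ¬ r b a := fun h => m.not_rel (r.symm h)
  by_cases he : r' e a
  · rw [mulX_congr h t he hf]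
    rcases m.of_rel_left he with hea | heb
    · rw [mulX_congr h t hea (splitMap_mem h t m hf)]
      refine eqOn_labSpace (A := splitMap h t r a b ∘ₗ mulX h t r' a)
        (B := mulX h t r a ∘ₗ splitMap h t r a b) (fun x hx => ?_) hf
      simp only [LinearMap.comp_apply, mulX_del, splitMap_del, map_add, map_smul, upd_same,
        upd_upd_merged m, upd_of_not_rel m.not_rel, upd_comm m.not_rel, upd_upd, Fintype.sum_bool]
      cases x a <;> simp only [mulCoeff, comulCoeff] <;> module
    · rw [mulX_congr h t heb (splitMap_mem h t m hf)]
      refine eqOn_labSpace (A := splitMap h t r a b ∘ₗ mulX h t r' a)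
        (B := mulX h t r b ∘ₗ splitMap h t r a b) (fun x hx => ?_) hf
      simp only [LinearMap.comp_apply, mulX_del, splitMap_del, map_add, map_smul, upd_same,
        upd_upd_merged m, upd_upd, Fintype.sum_bool]
      cases x a <;> simp only [mulCoeff, comulCoeff] <;> module
  · refine eqOn_labSpace (A := splitMap h t r a b ∘ₗ mulX h t r' e)
      (B := mulX h t r e ∘ₗ splitMap h t r a b) (fun x hx => ?_) hf
    obtain ⟨hea, heb⟩ := not_rel_off m he
    have ha : ∀ v, upd r e v x a = x a := fun v => upd_of_not_rel (fun h => hea (r.symm h)) v x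
    simp only [LinearMap.comp_apply, mulX_del, splitMap_del, map_add, map_smul,
      upd_off_of_merges m he, ha, upd_of_not_rel hea, upd_of_not_rel heb, upd_comm hea,
      upd_comm heb, Fintype.sum_bool]
    module

theorem mergeMap_one (r' : Setoid α) (a b : α) :
    mergeMap h t r' a b (del F fun _ => true) = del F fun _ => true := by
  rw [mergeMap_del, Fintype.sum_bool, upd_eq_self isLab_true rfl]
  simp [mulCoeff]

/-- This is `Δ(1)`, written with the operators `mulX`. By linearity it determines the whole
splitting map. -/
theorem splitMap_one (m : r.Merges r' a b) :
    splitMap h t r a b (del F fun _ => true) = mulX h t r a (del F fun _ => true) +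
      mulX h t r b (del F fun _ => true) - h • del F fun _ => true := by
  have h1 : ∀ e, upd r e true (fun _ => true) = fun _ => true :=
    fun e => upd_eq_self isLab_true rfl
  have h2 : upd r b true (upd r a false fun _ => true) = upd r a false fun _ => true := by
    rw [upd_comm fun h => m.not_rel (r.symm h), h1]
  simp only [splitMap_del, mulX_del, Fintype.sum_bool, h1, h2, comulCoeff, mulCoeff]
  module

/-- Every basis element is obtained from `1` by multiplications by `X`. -/
theorem IsLab.induction [Finite α] {p : (α → Bool) → Prop} (h1 : p fun _ => true)
    (h2 : ∀ x e, IsLab r x → x e = false → p (upd r e true x) → p x) {x : α → Bool}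
    (hx : IsLab r x) : p x := by
  have : Fintype α := Fintype.ofFinite α
  induction hn : (Finset.univ.filter fun e => x e = false).card using Nat.strong_induction_on
    generalizing x with
  | _ n ih =>
    by_cases h : ∃ e, x e = false
    · obtain ⟨e, he⟩ := h
      refine h2 x e hx he (ih _ ?_ (isLab_upd hx e true) rfl)
      rw [← hn]
      refine Finset.card_lt_card (Finset.ssubset_iff_of_subset ?_ |>.2 ⟨e, ?_, ?_⟩)
      · intro z hz
        by_cases hze : r z e
        · simp [upd_of_rel hze] at hz
        · simpa [upd_of_not_rel hze] using hz
      · simpa using he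
      · simp
    · push Not at h
      have : x = fun _ => true := funext fun e => by simpa using h e
      rwa [this]

theorem mulX_upd_true {x : α → Bool} {e : α} (hx : IsLab r x) (he : x e = false) :
    mulX h t r e (del F (upd r e true x)) = del F x := by
  rw [mulX_del, Fintype.sum_bool, upd_same, upd_upd, upd_upd, upd_eq_self (v := false) hx he]
  simp [mulCoeff]

/-- Linear maps over the algebra are determined by their values on `1`. -/
theorem eq_of_commute_mulX [Finite α] {s : Setoid α} {A B : Space F α →ₗ[F] Space F α}
    (hA : ∀ f ∈ labSpace F r, ∀ e, A (mulX h t r e f) = mulX h t s e (A f))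
    (hB : ∀ f ∈ labSpace F r, ∀ e, B (mulX h t r e f) = mulX h t s e (B f))
    (h1 : A (del F fun _ => true) = B (del F fun _ => true)) {f : Space F α}
    (hf : f ∈ labSpace F r) : A f = B f := by
  refine eqOn_labSpace (fun x hx => ?_) hf
  refine IsLab.induction (r := r) (p := fun x => A (del F x) = B (del F x)) h1 ?_ hx
  intro x e hx he ih
  rw [← mulX_upd_true h t hx he, hA _ (del_mem (isLab_upd hx e true)), ih,
    hB _ (del_mem (isLab_upd hx e true))]

/-- The derivation `X ↦ 1`. -/
noncomputable def derivX (F : Type u) [Field F] [Finite α] (r : Setoid α) :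
    Space F α →ₗ[F] Space F α :=
  have : Fintype (Quotient r) := Fintype.ofFinite _
  Finsupp.linearCombination F fun x =>
    ∑ q : Quotient r, if x q.out = false then del F (upd r q.out true x) else 0

theorem derivX_one [Finite α] : derivX F r (del F fun _ => true) = 0 := by
  simp [derivX]

theorem derivX_mem [Finite α] {f : Space F α} (hf : f ∈ labSpace F r) :
    derivX F r f ∈ labSpace F r := by
  refine map_labSpace_mem (fun x hx => ?_) hf
  simp only [derivX, Finsupp.linearCombination_single, one_smul]
  refine Submodule.sum_mem _ fun q _ => ?_
  split_ifs
  · exact del_mem (isLab_upd hx _ _)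
  · exact Submodule.zero_mem _

/-- The Leibniz rule for the derivation `X ↦ 1`. The relation `X² = 0` is respected because its
derivative `2X` vanishes in characteristic two. -/
theorem derivX_mulX [Finite α] [CharP F 2] (e : α) {f : Space F α} (hf : f ∈ labSpace F r) :
    derivX F r (mulX 0 0 r e f) = f + mulX 0 0 r e (derivX F r f) := by
  have : Fintype (Quotient r) := Fintype.ofFinite _
  refine eqOn_labSpace (A := derivX F r ∘ₗ mulX 0 0 r e)
    (B := LinearMap.id + mulX 0 0 r e ∘ₗ derivX F r) (fun x hx => ?_) hf
  have hd : ∀ x, derivX F r (del F x) =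
      ∑ q : Quotient r, if x q.out = false then del F (upd r q.out true x) else 0 := by
    intro x
    simp only [derivX, Finsupp.linearCombination_single, one_smul]
    congr!
  have hq : ∀ q : Quotient r, q ≠ Quotient.mk r e → ¬ r q.out e := by
    intro q hq hqe
    exact hq (by rw [← q.out_eq]; exact Quotient.sound hqe)
  have hqe : r (Quotient.mk r e).out e := Quotient.mk_out e
  simp only [LinearMap.comp_apply, LinearMap.add_apply, LinearMap.id_apply, mulX_del, hd, map_sum]
  cases hx' : x e
  · simp only [mulCoeff, Fintype.sum_bool, zero_smul, add_zero, map_zero]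
    rw [Finset.sum_eq_single (Quotient.mk r e)]
    · rw [if_pos (by rw [hx _ _ hqe, hx']), mulX_del, Fintype.sum_bool,
        upd_of_rel (r.symm hqe), upd_congr hqe, upd_upd, upd_upd, upd_eq_self (v := false) hx hx']
      simp only [mulCoeff, zero_smul, zero_add, one_smul]
      rw [← two_smul F, CharTwo.two_eq_zero, zero_smul]
    · intro q _ hqn
      split_ifs
      · rw [mulX_del, Fintype.sum_bool, upd_of_not_rel fun h => hq q hqn (r.symm h), hx']
        simp [mulCoeff]
      · simp
    · simp
  · simp only [mulCoeff, Fintype.sum_bool, zero_smul, one_smul, hd]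
    rw [← Finset.add_sum_erase _ _ (Finset.mem_univ (Quotient.mk r e)),
      ← Finset.add_sum_erase (a := Quotient.mk r e) (Finset.univ) (fun q : Quotient r =>
        mulX 0 0 r e (if x q.out = false then del F (upd r q.out true x) else 0))
        (Finset.mem_univ _), upd_of_rel hqe, if_pos rfl, upd_congr hqe, upd_upd,
      upd_eq_self hx hx', hx _ _ hqe, hx', if_neg (by simp), map_zero, zero_add]
    congr 1
    rw [map_zero, zero_add]
    refine Finset.sum_congr rfl fun q hqm => ?_
    have hqn := hq q (Finset.ne_of_mem_erase hqm)
    rw [upd_of_not_rel hqn]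
    split_ifs
    · rw [mulX_del, Fintype.sum_bool, upd_of_not_rel fun h => hqn (r.symm h), hx', upd_comm hqn]
      simp [mulCoeff]
    · simp

end CircleAlgebra

/-! ### Edge maps of the cube as algebra-linear operators -/

namespace GaussCode

open Classical CircleAlgebra

variable {F : Type u} [Field F] (h t : F) {D : GaussCode}

theorem edgeCoeff_of_merges {I : Finset (Fin D.n)} {c : Fin D.n}
    (m : (D.circles I).Merges (D.circles (insert c I)) (D.inArc c true) (D.outArc c true))
    (x y : D.Arc → Bool) : D.edgeCoeff h t I c x y =
      if ∀ e, ¬ D.circles I e (D.inArc c true) → ¬ D.circles I e (D.outArc c true) → x e = y e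
      then mulCoeff h t (x (D.inArc c true)) (x (D.outArc c true)) (y (D.inArc c true)) else 0 := by
  simp only [edgeCoeff]
  rw [if_pos (⟨m.not_rel, m.rel⟩ : _ ∧ _)]

theorem edgeCoeff_of_splits {I : Finset (Fin D.n)} {c : Fin D.n}
    (m : (D.circles (insert c I)).Merges (D.circles I) (D.inArc c true) (D.outArc c true))
    (x y : D.Arc → Bool) : D.edgeCoeff h t I c x y =
      if ∀ e, ¬ D.circles I e (D.inArc c true) → ¬ D.circles I e (D.outArc c true) → x e = y e
      then comulCoeff h t (x (D.inArc c true)) (y (D.inArc c true)) (y (D.outArc c true))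
      else 0 := by
  simp only [edgeCoeff]
  rw [if_neg (fun h => m.not_rel h.2 : ¬ (_ ∧ _)), if_pos (⟨m.rel, m.not_rel⟩ : _ ∧ _)]

/-- The edge map of the cube as an operator on labellings. -/
noncomputable def edgeOp (D : GaussCode) (I : Finset (Fin D.n)) (c : Fin D.n) :
    Space F D.Arc →ₗ[F] Space F D.Arc :=
  Finsupp.linearCombination F fun x => ∑ y : D.Arc → Bool,
    if IsLab (D.circles (insert c I)) y then D.edgeCoeff h t I c x y • del F y else 0

theorem edgeOp_del (I : Finset (Fin D.n)) (c : Fin D.n) (x : D.Arc → Bool) :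
    D.edgeOp h t I c (del F x) = ∑ y : D.Arc → Bool,
      if IsLab (D.circles (insert c I)) y then D.edgeCoeff h t I c x y • del F y else 0 := by
  simp [edgeOp]

theorem edgeOp_del_apply (I : Finset (Fin D.n)) (c : Fin D.n) (x y : D.Arc → Bool) :
    D.edgeOp h t I c (del F x) y =
      if IsLab (D.circles (insert c I)) y then D.edgeCoeff h t I c x y else 0 := by
  rw [edgeOp_del, Finsupp.finsetSum_apply, Finset.sum_eq_single y]
  · split_ifs <;> simp
  · intro z _ hz
    split_ifs <;> simp [hz]
  · simp

theorem edgeOp_of_merges {I : Finset (Fin D.n)} {c : Fin D.n}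
    (m : (D.circles I).Merges (D.circles (insert c I)) (D.inArc c true) (D.outArc c true))
    {f : Space F D.Arc} (hf : f ∈ labSpace F (D.circles I)) : D.edgeOp h t I c f =
      mergeMap h t (D.circles (insert c I)) (D.inArc c true) (D.outArc c true) f := by
  refine eqOn_labSpace (fun x hx => ?_) hf
  ext z
  rw [edgeOp_del_apply, edgeCoeff_of_merges h t m, mergeMap_del, Finsupp.finsetSum_apply]
  simp only [Finsupp.smul_apply, smul_eq_mul, Finsupp.single_apply]
  -- The condition is made opaque, so that `simp` can evaluate the sum of indicators without
  -- rewriting inside it.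
  obtain ⟨P, hP⟩ : ∃ P : Prop, P ↔ (IsLab (D.circles (insert c I)) z ∧ ∀ e, ¬ D.circles I e (D.inArc c true) →
        ¬ D.circles I e (D.outArc c true) → x e = z e) :=
    ⟨_, Iff.rfl⟩
  have hu : ∀ v, upd (D.circles (insert c I)) (D.inArc c true) v x = z ↔
      P ∧ z (D.inArc c true) = v := by
    intro v
    rw [hP]
    constructor
    · rintro rfl
      refine ⟨⟨isLab_upd_of_merges m hx v, fun e h1 h2 => ?_⟩, upd_same _ _ _⟩
      rw [upd_of_not_rel]
      rw [merges_rel_iff m]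
      exact fun h => h.elim h1 h2
    · rintro ⟨⟨h1, h2⟩, rfl⟩
      funext e
      by_cases he : D.circles (insert c I) e (D.inArc c true)
      · rw [upd_of_rel he, h1 _ _ he]
      · rw [upd_of_not_rel he]
        exact h2 e (not_rel_off m he).1 (not_rel_off m he).2
  simp only [hu, ← ite_and, ← hP]
  by_cases hz : P <;> simp [hz]

theorem edgeOp_of_splits {I : Finset (Fin D.n)} {c : Fin D.n}
    (m : (D.circles (insert c I)).Merges (D.circles I) (D.inArc c true) (D.outArc c true))
    {f : Space F D.Arc} (hf : f ∈ labSpace F (D.circles I)) : D.edgeOp h t I c f =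
      splitMap h t (D.circles (insert c I)) (D.inArc c true) (D.outArc c true) f := by
  refine eqOn_labSpace (fun x hx => ?_) hf
  ext z
  rw [edgeOp_del_apply, edgeCoeff_of_splits h t m, splitMap_del, Finsupp.finsetSum_apply]
  simp only [Finsupp.finsetSum_apply, Finsupp.smul_apply, smul_eq_mul, Finsupp.single_apply]
  have hba : ¬ D.circles (insert c I) (D.inArc c true) (D.outArc c true) := m.not_rel
  obtain ⟨P, hP⟩ : ∃ P : Prop, P ↔ (IsLab (D.circles (insert c I)) z ∧ ∀ e, ¬ D.circles I e (D.inArc c true) →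
        ¬ D.circles I e (D.outArc c true) → x e = z e) :=
    ⟨_, Iff.rfl⟩
  have hu : ∀ v w, upd (D.circles (insert c I)) (D.outArc c true) w
      (upd (D.circles (insert c I)) (D.inArc c true) v x) = z ↔
      P ∧
        z (D.inArc c true) = v ∧ z (D.outArc c true) = w := by
    intro v w
    rw [hP]
    constructor
    · rintro rfl
      refine ⟨⟨isLab_upd (isLab_upd (hx.mono m.le) _ v) _ w, fun e h1 h2 => ?_⟩, ?_, upd_same _ _ _⟩
      · rw [upd_of_not_rel fun h => h2 (m.le h), upd_of_not_rel fun h => h1 (m.le h)]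
      · rw [upd_of_not_rel hba, upd_same]
    · rintro ⟨⟨h1, h2⟩, rfl, rfl⟩
      funext e
      by_cases he : D.circles (insert c I) e (D.outArc c true)
      · rw [upd_of_rel he, h1 _ _ he]
      · rw [upd_of_not_rel he]
        by_cases he' : D.circles (insert c I) e (D.inArc c true)
        · rw [upd_of_rel he', h1 _ _ he']
        · rw [upd_of_not_rel he']
          have h3 : ¬ D.circles I e (D.inArc c true) :=
            fun h => (m.of_rel_left h).elim he' he
          exact h2 e h3 fun h => h3 ((D.circles I).trans h ((D.circles I).symm m.rel))
  simp only [hu, ← ite_and, ← hP]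
  by_cases hz : P <;> simp [hz, ite_and]

variable (hD : D.IsPlanar)

include hD

theorem IsPlanar.edgeOp_mem {I : Finset (Fin D.n)} {c : Fin D.n} (hc : c ∉ I)
    {f : Space F D.Arc} (hf : f ∈ labSpace F (D.circles I)) :
    D.edgeOp h t I c f ∈ labSpace F (D.circles (insert c I)) := by
  rcases hD.merges_or_merges I hc with m | m
  · rw [edgeOp_of_merges h t m hf]
    exact mergeMap_mem h t m hf
  · rw [edgeOp_of_splits h t m hf]
    exact splitMap_mem h t m hf

theorem IsPlanar.edgeOp_mulX {I : Finset (Fin D.n)} {c : Fin D.n} (hc : c ∉ I) (e : D.Arc)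
    {f : Space F D.Arc} (hf : f ∈ labSpace F (D.circles I)) :
    D.edgeOp h t I c (mulX h t (D.circles I) e f) =
      mulX h t (D.circles (insert c I)) e (D.edgeOp h t I c f) := by
  rcases hD.merges_or_merges I hc with m | m
  · rw [edgeOp_of_merges h t m hf, edgeOp_of_merges h t m (mulX_mem h t e hf), mergeMap_mulX h t m e hf]
  · rw [edgeOp_of_splits h t m hf, edgeOp_of_splits h t m (mulX_mem h t e hf), splitMap_mulX h t m e hf]

omit hD

theorem edgeOp_one_of_merges {I : Finset (Fin D.n)} {c : Fin D.n}
    (m : (D.circles I).Merges (D.circles (insert c I)) (D.inArc c true) (D.outArc c true)) :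
    D.edgeOp h t I c (del F fun _ => true) = del F fun _ => true := by
  rw [edgeOp_of_merges h t m (del_mem isLab_true), mergeMap_one]

/-- Multiplication by `Δ(1)`. -/
noncomputable def handle (D : GaussCode) (I : Finset (Fin D.n)) (c : Fin D.n) :
    Space F D.Arc →ₗ[F] Space F D.Arc :=
  mulX h t (D.circles I) (D.inArc c true) + mulX h t (D.circles I) (D.outArc c true) -
    h • LinearMap.id

theorem edgeOp_one_of_splits {I : Finset (Fin D.n)} {c : Fin D.n}
    (m : (D.circles (insert c I)).Merges (D.circles I) (D.inArc c true) (D.outArc c true)) :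
    D.edgeOp h t I c (del F fun _ => true) =
      D.handle h t (insert c I) c (del F fun _ => true) := by
  rw [edgeOp_of_splits h t m (del_mem isLab_true), splitMap_one h t m]
  simp [handle]

theorem IsPlanar.edgeOp_handle (hD : D.IsPlanar) {I : Finset (Fin D.n)} {c : Fin D.n} (hc : c ∉ I)
    (c' : Fin D.n) {f : Space F D.Arc} (hf : f ∈ labSpace F (D.circles I)) :
    D.edgeOp h t I c (D.handle h t I c' f) =
      D.handle h t (insert c I) c' (D.edgeOp h t I c f) := by
  simp only [handle, LinearMap.sub_apply, LinearMap.add_apply, map_sub, map_add,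
    hD.edgeOp_mulX h t hc _ hf, LinearMap.smul_apply, map_smul, LinearMap.id_apply]

theorem handle_comm (I : Finset (Fin D.n)) (c c' : Fin D.n) {f : Space F D.Arc}
    (hf : f ∈ labSpace F (D.circles I)) :
    D.handle h t I c (D.handle h t I c' f) = D.handle h t I c' (D.handle h t I c f) := by
  simp only [handle, LinearMap.sub_apply, LinearMap.add_apply, map_sub, map_add,
    LinearMap.smul_apply, map_smul, LinearMap.id_apply,
    mulX_comm h t (D.inArc c true) _ hf, mulX_comm h t (D.outArc c true) _ hf]
  module

/-- Multiplication by `Δ(1)` depends only on the unordered pair of circles through the crossing.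
This identifies the handles that two different crossings create. -/
theorem handle_congr (I : Finset (Fin D.n)) {c c' : Fin D.n}
    (hcc : (D.circles I (D.inArc c true) (D.inArc c' true) ∧
        D.circles I (D.outArc c true) (D.outArc c' true)) ∨
      (D.circles I (D.inArc c true) (D.outArc c' true) ∧
        D.circles I (D.outArc c true) (D.inArc c' true)))
    {f : Space F D.Arc} (hf : f ∈ labSpace F (D.circles I)) :
    D.handle h t I c f = D.handle h t I c' f := by
  rcases hcc with ⟨h1, h2⟩ | ⟨h1, h2⟩
  · simp only [handle, LinearMap.sub_apply, LinearMap.add_apply, mulX_congr h t h1 hf,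
      mulX_congr h t h2 hf]
  · simp only [handle, LinearMap.sub_apply, LinearMap.add_apply, mulX_congr h t h1 hf,
      mulX_congr h t h2 hf, add_comm]

end GaussCode

/-- Merging two classes decreases the number of classes by one. -/
theorem Setoid.Merges.card_quotient {α : Type*} [Finite α] {r r' : Setoid α} {a b : α}
    (m : r.Merges r' a b) : Nat.card (Quotient r) = Nat.card (Quotient r') + 1 := by
  classical
  let φ : {q : Quotient r // q ≠ Quotient.mk r b} → Quotient r' :=
    fun q => Quotient.map' id (fun _ _ h => m.le h) q.1
  have hφ : Function.Bijective φ := by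
    constructor
    · rintro ⟨q, hq⟩ ⟨q', hq'⟩ h
      induction q using Quotient.inductionOn with | h x => ?_
      induction q' using Quotient.inductionOn with | h y => ?_
      have hx : ¬ r x b := fun h => hq (Quotient.sound h)
      have hy : ¬ r y b := fun h => hq' (Quotient.sound h)
      have hxy : r' x y := Quotient.exact h
      refine Subtype.ext (Quotient.sound ?_)
      by_cases hxa : r' x a
      · have h1 := (m.of_rel_left hxa).resolve_right hx
        have h2 := (m.of_rel_left (r'.trans (r'.symm hxy) hxa)).resolve_right hy
        exact r.trans h1 (r.symm h2)
      · exact m.of_rel hxy hxa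
    · intro q
      induction q using Quotient.inductionOn with | h x => ?_
      by_cases hx : r x b
      · refine ⟨⟨Quotient.mk r a, fun h => m.not_rel (Quotient.exact h)⟩, ?_⟩
        exact Quotient.sound (r'.trans m.rel (r'.symm (m.le hx)))
      · exact ⟨⟨Quotient.mk r x, fun h => hx (Quotient.exact h)⟩, rfl⟩
  rw [← Nat.card_eq_of_bijective φ hφ]
  have := Fintype.ofFinite (Quotient r)
  rw [Nat.card_eq_fintype_card, Nat.card_eq_fintype_card, Fintype.card_subtype_compl,
    Fintype.card_subtype_eq]
  have : 0 < Fintype.card (Quotient r) := Fintype.card_pos_iff.2 ⟨Quotient.mk r b⟩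
  omega

/-! ### Commuting squares and the derivation -/

namespace GaussCode

open Classical CircleAlgebra

variable {F : Type u} [Field F] (h t : F) {D : GaussCode}

/-- The faces of the cube commute. -/
theorem IsPlanar.edgeOp_comm (hD : D.IsPlanar) {I : Finset (Fin D.n)} {c c' : Fin D.n}
    (hc : c ∉ I) (hc' : c' ∉ I) (hcc : c ≠ c') {f : Space F D.Arc}
    (hf : f ∈ labSpace F (D.circles I)) :
    D.edgeOp h t (insert c I) c' (D.edgeOp h t I c f) =
      D.edgeOp h t (insert c' I) c (D.edgeOp h t I c' f) := by
  have hc1 : c' ∉ insert c I := by simp [hc', hcc.symm]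
  have hc2 : c ∉ insert c' I := by simp [hc, hcc]
  have hK : insert c (insert c' I) = insert c' (insert c I) := Finset.insert_comm _ _ _
  -- Both composites commute with multiplication by `X` on any circle, so it suffices to compare
  -- them on `1`.
  refine eq_of_commute_mulX h t (r := D.circles I) (s := D.circles (insert c' (insert c I)))
    (A := D.edgeOp h t (insert c I) c' ∘ₗ D.edgeOp h t I c)
    (B := D.edgeOp h t (insert c' I) c ∘ₗ D.edgeOp h t I c') ?_ ?_ ?_ hf
  · intro f hf e
    simp only [LinearMap.comp_apply]
    rw [hD.edgeOp_mulX h t hc e hf, hD.edgeOp_mulX h t hc1 e (hD.edgeOp_mem h t hc hf)]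
  · intro f hf e
    simp only [LinearMap.comp_apply]
    rw [hD.edgeOp_mulX h t hc' e hf, hD.edgeOp_mulX h t hc2 e (hD.edgeOp_mem h t hc' hf), hK]
  · simp only [LinearMap.comp_apply]
    have h1 : ∀ r : Setoid D.Arc, (del F fun _ => true) ∈ labSpace F r :=
      fun r => del_mem isLab_true
    have m1 := hD.merges_or_merges I hc
    have m2 := hD.merges_or_merges (insert c I) hc1
    have m3 := hD.merges_or_merges I hc'
    have m4 := hD.merges_or_merges (insert c' I) hc2
    rw [hK] at m4
    -- There are sixteen patterns of merges and splits around the square. The two paths must change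
    -- the number of circles equally, which leaves six.
    rcases m1 with m1 | m1 <;> rcases m2 with m2 | m2 <;> rcases m3 with m3 | m3 <;>
      rcases m4 with m4 | m4
    all_goals
      have n1 := m1.card_quotient
      have n2 := m2.card_quotient
      have n3 := m3.card_quotient
      have n4 := m4.card_quotient
    all_goals try omega
    all_goals
      clear n1 n2 n3 n4
      have m4' := m4
      rw [← hK] at m4'
    · rw [edgeOp_one_of_merges h t m1, edgeOp_one_of_merges h t m2, edgeOp_one_of_merges h t m3,
        edgeOp_one_of_merges h t m4']
    · rw [edgeOp_one_of_merges h t m1, edgeOp_one_of_splits h t m2, edgeOp_one_of_merges h t m3,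
        edgeOp_one_of_splits h t m4', hK]
      refine handle_congr h t _ ?_ (h1 _)
      have k1 := m2.of_rel_left (x := D.inArc c true)
      have k2 := m2.of_rel_left (x := D.outArc c true)
      -- If `c'` split some other circle than the one created by merging at `c`, the two strands of
      -- `c` would remain joined in the last resolution, contrary to `m4`.
      have k3 : D.circles (insert c I) (D.inArc c true) (D.inArc c' true) := by
        by_contra k3
        exact m4.not_rel (m2.of_rel m1.rel k3)
      have k4 : D.circles (insert c I) (D.outArc c true) (D.inArc c' true) :=
        (D.circles _).trans ((D.circles _).symm m1.rel) k3
      set r := D.circles (insert c' (insert c I))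
      rcases k1 k3 with l1 | l1 <;> rcases k2 k4 with l2 | l2
      · exact absurd (r.trans l1 (r.symm l2)) m4.not_rel
      · exact Or.inl ⟨r.symm l1, r.symm l2⟩
      · exact Or.inr ⟨r.symm l2, r.symm l1⟩
      · exact absurd (r.trans l1 (r.symm l2)) m4.not_rel
    · rw [edgeOp_one_of_merges h t m1, edgeOp_one_of_splits h t m2, edgeOp_one_of_splits h t m3,
        hD.edgeOp_handle h t hc2 _ (h1 _), edgeOp_one_of_merges h t m4', hK]
    · rw [edgeOp_one_of_splits h t m1, hD.edgeOp_handle h t hc1 _ (h1 _),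
        edgeOp_one_of_merges h t m2, edgeOp_one_of_merges h t m3, edgeOp_one_of_splits h t m4', hK]
    · rw [edgeOp_one_of_splits h t m1, hD.edgeOp_handle h t hc1 _ (h1 _),
        edgeOp_one_of_merges h t m2, edgeOp_one_of_splits h t m3,
        hD.edgeOp_handle h t hc2 _ (h1 _), edgeOp_one_of_merges h t m4', hK]
      set r := D.circles (insert c' (insert c I))
      have k1 : ¬ D.circles (insert c I) (D.inArc c' true) (D.outArc c' true) := m2.not_rel
      -- If `c'` did not meet the circle split at `c`, that split could not separate the strands of
      -- `c'`, contrary to `m2`.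
      have k2 : D.circles I (D.inArc c' true) (D.inArc c true) := by
        by_contra k2
        exact k1 (m1.of_rel m3.rel k2)
      have k3 : r (D.inArc c' true) (D.inArc c true) := by
        rcases m1.of_rel_left k2 with l | l
        · exact m2.le l
        · exact r.trans (m2.le l) (r.symm m4.rel)
      exact handle_congr h t _ (Or.inl ⟨r.symm k3,
        r.trans (r.symm m4.rel) (r.trans (r.symm k3) m2.rel)⟩) (h1 _)
    · rw [edgeOp_one_of_splits h t m1, hD.edgeOp_handle h t hc1 _ (h1 _),
        edgeOp_one_of_splits h t m2, edgeOp_one_of_splits h t m3,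
        hD.edgeOp_handle h t hc2 _ (h1 _), edgeOp_one_of_splits h t m4', hK,
        handle_comm h t _ _ _ (h1 _)]

/-- On `1` a merge gives `1`, with derivative 0, and a split gives a sum of two factors `X`, with
derivative `1 + 1 = 0`. The Leibniz rule and linearity over the `X`-actions carry this to all
labels. -/
theorem IsPlanar.edgeOp_derivX [CharP F 2] (hD : D.IsPlanar) {I : Finset (Fin D.n)} {c : Fin D.n}
    (hc : c ∉ I) {f : Space F D.Arc} (hf : f ∈ labSpace F (D.circles I)) :
    D.edgeOp 0 0 I c (derivX F (D.circles I) f) =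
      derivX F (D.circles (insert c I)) (D.edgeOp 0 0 I c f) := by
  refine eqOn_labSpace (A := D.edgeOp 0 0 I c ∘ₗ derivX F (D.circles I))
    (B := derivX F (D.circles (insert c I)) ∘ₗ D.edgeOp 0 0 I c) (fun x hx => ?_) hf
  have h1 : ∀ r : Setoid D.Arc, (del F fun _ => true) ∈ labSpace F r := fun r => del_mem isLab_true
  simp only [LinearMap.comp_apply]
  refine IsLab.induction (r := D.circles I) (p := fun x => D.edgeOp 0 0 I c (derivX F (D.circles I)
    (del F x)) = derivX F (D.circles (insert c I)) (D.edgeOp 0 0 I c (del F x))) ?_ ?_ hx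
  · rw [derivX_one, map_zero]
    rcases hD.merges_or_merges I hc with m | m
    · rw [edgeOp_one_of_merges _ _ m, derivX_one]
    · rw [edgeOp_one_of_splits _ _ m]
      simp only [handle, LinearMap.sub_apply, LinearMap.add_apply, zero_smul, LinearMap.zero_apply,
        map_add, map_zero, derivX_mulX _ (h1 _), derivX_one, add_zero, sub_zero]
      rw [← two_smul F, CharTwo.two_eq_zero, zero_smul]
  · intro x e hx he ih
    have hm : del F (upd (D.circles I) e true x) ∈ labSpace F (D.circles I) :=
      del_mem (isLab_upd hx e true)
    rw [← mulX_upd_true 0 0 hx he, derivX_mulX e hm, map_add,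
      hD.edgeOp_mulX 0 0 hc e (derivX_mem hm), ih, hD.edgeOp_mulX 0 0 hc e hm,
      derivX_mulX e (hD.edgeOp_mem 0 0 hc hm)]

end GaussCode

/-! ### The differential in components -/

namespace GaussCode

open Classical CircleAlgebra

variable {F : Type u} [Field F] (h t : F) {D : GaussCode} {r : ℕ}

theorem apply_eq_zero_of_mem_labSpace {α : Type} {R : Setoid α} {g : Space F α}
    (hg : g ∈ labSpace F R) {y : α → Bool} (hy : ¬ IsLab R y) : g y = 0 := by
  have h1 : (Finsupp.lapply y : Space F α →ₗ[F] F) g = (0 : Space F α →ₗ[F] F) g := by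
    refine eqOn_labSpace (fun x hx => ?_) hg
    have : x ≠ y := by
      rintro rfl
      exact hy hx
    simp [this]
  exact h1

/-- The component of a chain at a resolution. -/
noncomputable def component (I : Finset (Fin D.n)) : (D.Gen r → F) →ₗ[F] Space F D.Arc where
  toFun f := ∑ s : D.Gen r, if s.I = I then f s • del F s.label else 0
  map_add' f g := by
    rw [← Finset.sum_add_distrib]
    refine Finset.sum_congr rfl fun s _ => ?_
    split_ifs <;> simp [add_smul]
  map_smul' k f := by
    rw [Finset.smul_sum]
    refine Finset.sum_congr rfl fun s _ => ?_
    split_ifs <;> simp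

theorem component_mem (I : Finset (Fin D.n)) (f : D.Gen r → F) :
    component I f ∈ labSpace F (D.circles I) := by
  refine Submodule.sum_mem _ fun s _ => ?_
  split_ifs with hs
  · subst hs
    exact Submodule.smul_mem _ _ (del_mem s.constant)
  · exact Submodule.zero_mem _

theorem component_apply (s : D.Gen r) (f : D.Gen r → F) : component s.I f s.label = f s := by
  simp only [component, LinearMap.coe_mk, AddHom.coe_mk, Finsupp.finsetSum_apply]
  rw [Finset.sum_eq_single s]
  · simp
  · intro s' _ hs'
    split_ifs with hI
    · have : s'.label ≠ s.label := fun hl => hs' (Gen.ext' hI hl)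
      simp [this]
    · rfl
  · simp

theorem component_eq_zero {I : Finset (Fin D.n)} (hI : I.card ≠ r) (f : D.Gen r → F) :
    component I f = 0 := by
  refine Finset.sum_eq_zero fun s _ => if_neg ?_
  rintro rfl
  exact hI s.card_eq

/-- Two families of elements of the circle algebras agree if their values on generators do. -/
theorem eq_of_apply_label {I : Finset (Fin D.n)} {g g' : Space F D.Arc}
    (hg : g ∈ labSpace F (D.circles I)) (hg' : g' ∈ labSpace F (D.circles I))
    (h0 : I.card ≠ r → g = g') (h1 : ∀ s : D.Gen r, s.I = I → g s.label = g' s.label) :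
    g = g' := by
  by_cases hI : I.card = r
  · ext y
    by_cases hy : IsLab (D.circles I) y
    · exact h1 ⟨I, y, hI, hy⟩ rfl
    · rw [apply_eq_zero_of_mem_labSpace hg hy, apply_eq_zero_of_mem_labSpace hg' hy]
  · exact h0 hI

theorem chain_ext {f g : D.Gen r → F} (hfg : ∀ I, component I f = component I g) : f = g := by
  ext s
  rw [← component_apply s f, hfg, component_apply]

/-- The sign of an edge of the cube that ends in the resolution `K`. -/
def edgeSign (K : Finset (Fin D.n)) (c : Fin D.n) : ℤ :=
  (-1) ^ ((K.erase c).filter (· < c)).card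

/-- Removing the smaller crossing lowers the exponent of the larger one by one, while removing the
larger does not affect the smaller. So the two paths around a square have opposite signs. -/
theorem edgeSign_mul_edgeSign {K : Finset (Fin D.n)} {c c' : Fin D.n} (hc : c ∈ K) (hc' : c' ∈ K)
    (hcc : c ≠ c') : edgeSign K c * edgeSign (K.erase c) c' +
      edgeSign K c' * edgeSign (K.erase c') c = 0 := by
  wlog hlt : c < c' generalizing c c'
  · have h1 := this hc' hc hcc.symm (lt_of_le_of_ne (not_lt.1 hlt) hcc.symm)
    linarith
  have h1 : ((K.erase c').erase c).filter (· < c) = (K.erase c).filter (· < c) := by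
    ext z
    simp only [Finset.mem_filter, Finset.mem_erase]
    constructor
    · rintro ⟨⟨h1, -, h2⟩, h3⟩
      exact ⟨⟨h1, h2⟩, h3⟩
    · rintro ⟨⟨h1, h2⟩, h3⟩
      exact ⟨⟨h1, (h3.trans hlt).ne, h2⟩, h3⟩
  have h2 : (K.erase c').filter (· < c') =
      insert c (((K.erase c).erase c').filter (· < c')) := by
    ext z
    simp only [Finset.mem_filter, Finset.mem_erase, Finset.mem_insert]
    constructor
    · rintro ⟨⟨h1, h2⟩, h3⟩
      by_cases hz : z = c
      · exact Or.inl hz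
      · exact Or.inr ⟨⟨h1, hz, h2⟩, h3⟩
    · rintro (rfl | ⟨⟨h1, -, h2⟩, h3⟩)
      · exact ⟨⟨hlt.ne, hc⟩, hlt⟩
      · exact ⟨⟨h1, h2⟩, h3⟩
  simp only [edgeSign, h1, h2]
  rw [Finset.card_insert_of_notMem (by simp)]
  ring

/-- Transfers facts about single edge maps to the differential. The sum is indexed by the crossings
of the target resolution, so the sources are the sets `K.erase c`. -/
theorem component_diff (hD : D.IsPlanar) (K : Finset (Fin D.n)) (f : D.Gen r → F) :
    component K (D.diff h t r f) = ∑ c ∈ K,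
      (edgeSign K c : F) • D.edgeOp h t (K.erase c) c (component (K.erase c) f) := by
  have hmem : ∀ c ∈ K, D.edgeOp h t (K.erase c) c (component (K.erase c) f) ∈
      labSpace F (D.circles K) := by
    intro c hc
    have h1 := hD.edgeOp_mem h t (Finset.notMem_erase c K) (component_mem (K.erase c) f)
    rwa [Finset.insert_erase hc] at h1
  refine eq_of_apply_label (r := r + 1) (component_mem K _)
    (Submodule.sum_mem _ fun c hc => Submodule.smul_mem _ _ (hmem c hc)) ?_ ?_
  · intro hK
    rw [component_eq_zero hK, Finset.sum_eq_zero]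
    intro c hc
    rw [component_eq_zero, map_zero, smul_zero]
    rw [Finset.card_erase_of_mem hc]
    have := Finset.card_pos.2 ⟨c, hc⟩
    omega
  · rintro s' rfl
    rw [component_apply]
    change ∑ s, D.dCoeff h t s s' * f s = _
    simp only [dCoeff, Finset.sum_mul]
    rw [Finset.sum_comm, Finsupp.finsetSum_apply, ← Finset.sum_subset (Finset.subset_univ s'.I)]
    · refine Finset.sum_congr rfl fun c hc => ?_
      simp only [component, LinearMap.coe_mk, AddHom.coe_mk, map_sum, Finsupp.smul_apply,
        Finsupp.finsetSum_apply, smul_eq_mul, Finset.mul_sum]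
      refine Finset.sum_congr rfl fun s _ => ?_
      have hiff : (c ∉ s.I ∧ insert c s.I = s'.I) ↔ s.I = s'.I.erase c := by
        constructor
        · rintro ⟨h1, h2⟩
          rw [← h2, Finset.erase_insert h1]
        · intro h1
          rw [h1, Finset.insert_erase hc]
          exact ⟨Finset.notMem_erase c _, rfl⟩
      simp only [hiff]
      split_ifs with hs
      · rw [map_smul, Finsupp.smul_apply, edgeOp_del_apply, Finset.insert_erase hc,
          if_pos (show IsLab (D.circles s'.I) s'.label from s'.constant), hs, edgeSign]
        push_cast
        rw [smul_eq_mul]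
        ring
      · simp
    · intro c _ hc
      refine Finset.sum_eq_zero fun s _ => ?_
      rw [if_neg, zero_mul]
      rintro ⟨-, h2⟩
      exact hc (h2 ▸ Finset.mem_insert_self c s.I)

/-- The Khovanov-like complex of a planar diagram is a complex. -/
theorem IsPlanar.diff_diff (hD : D.IsPlanar) (f : D.Gen r → F) :
    D.diff h t (r + 1) (D.diff h t r f) = 0 := by
  refine chain_ext fun K => ?_
  rw [map_zero, component_diff h t hD]
  simp only [component_diff h t hD, map_sum, map_smul, Finset.smul_sum, smul_smul]
  rw [Finset.sum_sigma']
  -- The two orders of removing `c` and `c'` give equal composites, as squares commute, with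
  -- opposite signs.
  refine Finset.sum_involution (fun p _ => ⟨p.2, p.1⟩) ?_ ?_ ?_ ?_
  · rintro ⟨c, c'⟩ hp
    simp only [Finset.mem_sigma, Finset.mem_erase] at hp
    obtain ⟨hc, hcc, hc'⟩ := hp
    dsimp only
    have hI : (K.erase c).erase c' = (K.erase c').erase c := Finset.erase_right_comm
    have h1 : insert c' ((K.erase c).erase c') = K.erase c :=
      Finset.insert_erase (Finset.mem_erase.2 ⟨hcc, hc'⟩)
    have h2 : insert c ((K.erase c).erase c') = K.erase c' := by
      rw [hI]
      exact Finset.insert_erase (Finset.mem_erase.2 ⟨hcc.symm, hc⟩)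
    have h3 := hD.edgeOp_comm h t (I := (K.erase c).erase c') (c := c) (c' := c') (by simp)
      (by simp) hcc.symm (component_mem _ f)
    rw [h1, h2] at h3
    rw [← hI, h3, ← add_smul]
    have h4 := congrArg (Int.cast : ℤ → F) (edgeSign_mul_edgeSign hc hc' hcc.symm)
    push_cast at h4
    rw [h4, zero_smul]
  · rintro ⟨c, c'⟩ hp _ heq
    simp only [Finset.mem_sigma, Finset.mem_erase] at hp
    simp only [Sigma.mk.injEq, heq_eq_eq] at heq
    exact hp.2.1 heq.1
  · rintro ⟨c, c'⟩ hp
    simp only [Finset.mem_sigma, Finset.mem_erase] at hp ⊢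
    exact ⟨hp.2.2, fun h => hp.2.1 h.symm, hp.1⟩
  · rintro ⟨c, c'⟩ _
    rfl

/-- The operator on chains given by operators on the circle algebras of all resolutions. -/
noncomputable def liftOp (O : Finset (Fin D.n) → Space F D.Arc →ₗ[F] Space F D.Arc) (r : ℕ) :
    (D.Gen r → F) →ₗ[F] (D.Gen r → F) where
  toFun f s := O s.I (component s.I f) s.label
  map_add' f g := by
    ext s
    simp
  map_smul' k f := by
    ext s
    simp

variable {O : Finset (Fin D.n) → Space F D.Arc →ₗ[F] Space F D.Arc}

theorem component_liftOp
    (hO : ∀ I, ∀ g ∈ labSpace F (D.circles I), O I g ∈ labSpace F (D.circles I))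
    (I : Finset (Fin D.n)) (f : D.Gen r → F) :
    component I (liftOp O r f) = O I (component I f) := by
  refine eq_of_apply_label (r := r) (component_mem I _) (hO I _ (component_mem I f)) ?_ ?_
  · intro hI
    rw [component_eq_zero hI, component_eq_zero hI, map_zero]
  · rintro s rfl
    rw [component_apply]
    rfl

theorem diff_liftOp (hD : D.IsPlanar)
    (hO : ∀ I, ∀ g ∈ labSpace F (D.circles I), O I g ∈ labSpace F (D.circles I))
    (hO' : ∀ I c, c ∉ I → ∀ g ∈ labSpace F (D.circles I),
      D.edgeOp h t I c (O I g) = O (insert c I) (D.edgeOp h t I c g)) (f : D.Gen r → F) :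
    D.diff h t r (liftOp O r f) = liftOp O (r + 1) (D.diff h t r f) := by
  refine chain_ext fun K => ?_
  rw [component_diff h t hD, component_liftOp hO, component_diff h t hD, map_sum]
  refine Finset.sum_congr rfl fun c hc => ?_
  rw [map_smul, component_liftOp hO, hO' _ _ (Finset.notMem_erase c K) _ (component_mem _ f),
    Finset.insert_erase hc]

end GaussCode

/-! ## The quantum degree -/

namespace CircleAlgebra

open Classical

/-- The degree of a basis element of `A`. -/
def sgn (v : Bool) : ℤ := if v then 1 else -1

variable {α : Type} [Finite α] {r r' : Setoid α} {a b : α}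

/-- The degree of a labelling of the classes. -/
noncomputable def labDeg (r : Setoid α) (x : α → Bool) : ℤ :=
  have : Fintype (Quotient r) := Fintype.ofFinite _
  ∑ q : Quotient r, sgn (x q.out)

theorem labDeg_eq [Fintype (Quotient r)] (x : α → Bool) :
    labDeg r x = ∑ q : Quotient r, sgn (x q.out) := by
  unfold labDeg
  congr!

theorem labDeg_upd {x : α → Bool} (hx : IsLab r x) (e : α) (v : Bool) :
    labDeg r (upd r e v x) = labDeg r x - sgn (x e) + sgn v := by
  have : Fintype (Quotient r) := Fintype.ofFinite _
  have hqe : r (Quotient.mk r e).out e := Quotient.mk_out e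
  rw [labDeg_eq, labDeg_eq, ← Finset.add_sum_erase _ _ (Finset.mem_univ (Quotient.mk r e)),
    ← Finset.add_sum_erase (a := Quotient.mk r e) (Finset.univ)
      (fun q : Quotient r => sgn (x q.out)) (Finset.mem_univ _), upd_of_rel hqe, hx _ _ hqe,
    Finset.sum_congr rfl fun q hq => ?_]
  · ring
  · rw [upd_of_not_rel]
    intro h
    exact Finset.ne_of_mem_erase hq (by rw [← q.out_eq]; exact Quotient.sound h)

theorem labDeg_of_merges (m : r.Merges r' a b) {x : α → Bool} (hx : IsLab r' x) :
    labDeg r x = labDeg r' x + sgn (x a) := by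
  have : Fintype (Quotient r) := Fintype.ofFinite _
  have : Fintype (Quotient r') := Fintype.ofFinite _
  have hb : x (Quotient.mk r b).out = x a :=
    hx _ _ (r'.trans (m.le (Quotient.mk_out b)) (r'.symm m.rel))
  rw [labDeg_eq, labDeg_eq, ← Finset.add_sum_erase _ _ (Finset.mem_univ (Quotient.mk r b)), hb,
    add_comm]
  congr 1
  refine Finset.sum_bij (fun q _ => Quotient.map' id (fun _ _ h => m.le h) q) ?_ ?_ ?_ ?_
  · simp
  · intro q hq q' hq' h
    have hq := Finset.ne_of_mem_erase hq
    have hq' := Finset.ne_of_mem_erase hq'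
    induction q using Quotient.inductionOn with | h x => ?_
    induction q' using Quotient.inductionOn with | h y => ?_
    have hx : ¬ r x b := fun h => hq (Quotient.sound h)
    have hy : ¬ r y b := fun h => hq' (Quotient.sound h)
    have hxy : r' x y := Quotient.exact h
    refine Quotient.sound ?_
    by_cases hxa : r' x a
    · have h1 := (m.of_rel_left hxa).resolve_right hx
      have h2 := (m.of_rel_left (r'.trans (r'.symm hxy) hxa)).resolve_right hy
      exact r.trans h1 (r.symm h2)
    · exact m.of_rel hxy hxa
  · intro q _
    induction q using Quotient.inductionOn with | h x => ?_
    by_cases hx : r x b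
    · refine ⟨Quotient.mk r a, Finset.mem_erase.2
        ⟨fun h => m.not_rel (Quotient.exact h), Finset.mem_univ _⟩, ?_⟩
      exact Quotient.sound (r'.trans m.rel (r'.symm (m.le hx)))
    · exact ⟨Quotient.mk r x, Finset.mem_erase.2
        ⟨fun h => hx (Quotient.exact h), Finset.mem_univ _⟩, rfl⟩
  · intro q _
    induction q using Quotient.inductionOn with | h y => ?_
    congr 1
    refine hx _ _ (r'.trans (m.le (Quotient.mk_out y)) (r'.symm ?_))
    exact Quotient.mk_out (s := r') y

end CircleAlgebra

namespace GaussCode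

open Classical CircleAlgebra

variable {F : Type u} [Field F] {D : GaussCode} {r : ℕ}

/-- A sum of `±1` over circles is easy to follow under relabelling, merging and splitting, unlike
the two cardinalities in the definition. -/
theorem qdeg_eq (s : D.Gen r) :
    s.qdeg = labDeg (D.circles s.I) s.label + r + D.nPos - 2 * D.nNeg := by
  have : Fintype (Quotient (D.circles s.I)) := Fintype.ofFinite _
  have hcount : ∀ b, s.count b =
      (Finset.univ.filter fun q : Quotient (D.circles s.I) => s.label q.out = b).card := by
    intro b
    rw [Gen.count, ← Set.ncard_coe_finset]
    congr 1
    ext q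
    simp only [Set.mem_image, Set.mem_ofPred_eq, Finset.coe_filter, Finset.mem_univ, true_and]
    constructor
    · rintro ⟨e, he, rfl⟩
      rw [← he]
      exact s.constant _ _ (Quotient.mk_out (s := D.circles s.I) e)
    · intro hq
      exact ⟨q.out, hq, q.out_eq⟩
  rw [Gen.qdeg, hcount, hcount, labDeg_eq, ← Finset.sum_filter_add_sum_filter_not Finset.univ
    (fun q : Quotient (D.circles s.I) => s.label q.out = true)]
  rw [Finset.sum_congr rfl (g := fun _ => (1 : ℤ)) (fun q hq => by
    rw [(Finset.mem_filter.1 hq).2]; rfl)]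
  simp only [Bool.not_eq_true]
  rw [Finset.sum_congr (s₁ := Finset.univ.filter
    fun q : Quotient (D.circles s.I) => s.label q.out = false) rfl (g := fun _ => (-1 : ℤ))
    (fun q hq => by rw [(Finset.mem_filter.1 hq).2]; rfl)]
  simp
  ring

/-- An edge coefficient is a structure constant of the Frobenius algebra, of the same degree. -/
theorem IsPlanar.edgeCoeff_cases (hD : D.IsPlanar) {I : Finset (Fin D.n)} {c : Fin D.n}
    (hc : c ∉ I) {x y : D.Arc → Bool} (hx : IsLab (D.circles I) x)
    (hy : IsLab (D.circles (insert c I)) y) :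
    (∀ h t : F, D.edgeCoeff h t I c x y = 0) ∨
    (∃ p q v, labDeg (D.circles (insert c I)) y + 1 - labDeg (D.circles I) x =
        1 + sgn v - sgn p - sgn q ∧ ∀ h t : F, D.edgeCoeff h t I c x y = mulCoeff h t p q v) ∨
    (∃ p q v, labDeg (D.circles (insert c I)) y + 1 - labDeg (D.circles I) x =
        1 + sgn q + sgn v - sgn p ∧
        ∀ h t : F, D.edgeCoeff h t I c x y = comulCoeff h t p q v) := by
  by_cases hxy : ∀ e, ¬ D.circles I e (D.inArc c true) → ¬ D.circles I e (D.outArc c true) →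
    x e = y e
  · right
    rcases hD.merges_or_merges I hc with m | m
    · left
      refine ⟨x (D.inArc c true), x (D.outArc c true), y (D.inArc c true), ?_, fun h t => by
        rw [edgeCoeff_of_merges h t m, if_pos hxy]⟩
      -- The degrees are compared on the finer partition. There `y` arises from `x` by giving both
      -- circles at the crossing the same new label, and `labDeg_of_merges` corrects for the circle
      -- counted twice.
      have h1 : y = upd (D.circles I) (D.inArc c true) (y (D.inArc c true))
          (upd (D.circles I) (D.outArc c true) (y (D.inArc c true)) x) := by
        funext e
        by_cases he : D.circles I e (D.inArc c true)
        · rw [upd_of_rel he, hy _ _ (m.le he)]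
        · rw [upd_of_not_rel he]
          by_cases he' : D.circles I e (D.outArc c true)
          · rw [upd_of_rel he', hy _ _ ((D.circles _).trans (m.le he') ((D.circles _).symm m.rel))]
          · rw [upd_of_not_rel he', hxy e he he']
      have h2 := labDeg_of_merges m hy
      have h3 : labDeg (D.circles I) y = _ := congrArg _ h1
      rw [labDeg_upd (isLab_upd hx _ _), labDeg_upd hx, upd_of_not_rel m.not_rel] at h3
      linarith
    · right
      refine ⟨x (D.inArc c true), y (D.inArc c true), y (D.outArc c true), ?_, fun h t => by
        rw [edgeCoeff_of_splits h t m, if_pos hxy]⟩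
      have h1 : y = upd (D.circles (insert c I)) (D.inArc c true) (y (D.inArc c true))
          (upd (D.circles (insert c I)) (D.outArc c true) (y (D.outArc c true)) x) := by
        funext e
        by_cases he : D.circles (insert c I) e (D.inArc c true)
        · rw [upd_of_rel he, hy _ _ he]
        · rw [upd_of_not_rel he]
          by_cases he' : D.circles (insert c I) e (D.outArc c true)
          · rw [upd_of_rel he', hy _ _ he']
          · rw [upd_of_not_rel he', hxy e]
            · exact fun h => (m.of_rel_left h).elim he he'
            · exact fun h => (m.of_rel_left ((D.circles I).trans h
                ((D.circles I).symm m.rel))).elim he he'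
      have hx' := hx.mono m.le
      have h2 := labDeg_of_merges m hx
      have h3 : labDeg (D.circles (insert c I)) y = _ := congrArg _ h1
      rw [labDeg_upd (isLab_upd hx' _ _), labDeg_upd hx', upd_of_not_rel m.not_rel,
        ← hx _ _ m.rel] at h3
      linarith
  · left
    intro h t
    simp only [edgeCoeff]
    rw [if_neg hxy]

/-- A finite check of the structure constants: those equal to `1` preserve degree, those with `h`
raise it by 2, those with `t` by 4. The summand 1 in the formula is the shift by the number of
1-smoothings. -/
theorem IsPlanar.edgeCoeff_deg (hD : D.IsPlanar) {I : Finset (Fin D.n)} {c : Fin D.n}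
    (hc : c ∉ I) {x y : D.Arc → Bool} (hx : IsLab (D.circles I) x)
    (hy : IsLab (D.circles (insert c I)) y) (h t : F) :
    (D.edgeCoeff h t I c x y ≠ 0 →
      labDeg (D.circles (insert c I)) y + 1 - labDeg (D.circles I) x = 0 ∨
      (labDeg (D.circles (insert c I)) y + 1 - labDeg (D.circles I) x = 2 ∧ h ≠ 0) ∨
      (labDeg (D.circles (insert c I)) y + 1 - labDeg (D.circles I) x = 4 ∧ t ≠ 0)) ∧
    (labDeg (D.circles (insert c I)) y + 1 - labDeg (D.circles I) x = 0 →
      D.edgeCoeff h t I c x y = D.edgeCoeff 0 0 I c x y) := by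
  rcases hD.edgeCoeff_cases (F := F) hc hx hy with h1 | ⟨p, q, v, h1, h2⟩ | ⟨p, q, v, h1, h2⟩
  · simp [h1]
  · rw [h1, h2, h2]
    cases p <;> cases q <;> cases v <;> simp [sgn, mulCoeff]
  · rw [h1, h2, h2]
    cases p <;> cases q <;> cases v <;> simp [sgn, comulCoeff]

theorem IsPlanar.dCoeff_deg (hD : D.IsPlanar) (h t : F) {s : D.Gen r} {s' : D.Gen (r + 1)}
    (h0 : D.dCoeff h t s s' ≠ 0) :
    s'.qdeg = s.qdeg ∨ (s'.qdeg = s.qdeg + 2 ∧ h ≠ 0) ∨ (s'.qdeg = s.qdeg + 4 ∧ t ≠ 0) := by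
  obtain ⟨c, -, hc⟩ := Finset.exists_ne_zero_of_sum_ne_zero h0
  split_ifs at hc with hcs
  · have h1 : IsLab (D.circles (insert c s.I)) s'.label := by
      rw [hcs.2]
      exact s'.constant
    have h2 := (hD.edgeCoeff_deg hcs.1 s.constant h1 h t).1 (right_ne_zero_of_mul hc)
    rw [hcs.2] at h2
    rw [qdeg_eq, qdeg_eq]
    push_cast
    rcases h2 with h2 | ⟨h2, h3⟩ | ⟨h2, h3⟩
    · exact Or.inl (by linarith)
    · exact Or.inr (Or.inl ⟨by linarith, h3⟩)
    · exact Or.inr (Or.inr ⟨by linarith, h3⟩)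
  · exact absurd rfl hc

/-- The reason why all theories have the same associated graded complex. -/
theorem IsPlanar.dCoeff_eq (hD : D.IsPlanar) (h t : F) {s : D.Gen r} {s' : D.Gen (r + 1)}
    (h0 : s'.qdeg = s.qdeg) : D.dCoeff h t s s' = D.dCoeff 0 0 s s' := by
  refine Finset.sum_congr rfl fun c _ => ?_
  split_ifs with hcs
  · have h1 : IsLab (D.circles (insert c s.I)) s'.label := by
      rw [hcs.2]
      exact s'.constant
    rw [(hD.edgeCoeff_deg hcs.1 s.constant h1 h t).2]
    rw [qdeg_eq, qdeg_eq] at h0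
    push_cast at h0
    rw [hcs.2]
    linarith
  · rfl

/-! ## The width in characteristic two -/

theorem exists_of_apply_ne_zero {α : Type} {R : Setoid α} {A : Space F α →ₗ[F] Space F α}
    {y : α → Bool} {f : Space F α} (hf : f ∈ labSpace F R) (h0 : A f y ≠ 0) :
    ∃ x, IsLab R x ∧ f x ≠ 0 ∧ A (del F x) y ≠ 0 := by
  by_contra hcon
  push Not at hcon
  refine h0 ?_
  have hsum : f = ∑ x ∈ f.support, f x • del F x := by
    conv_lhs => rw [← Finsupp.sum_single f]
    simp [Finsupp.sum]
  rw [hsum, map_sum, Finsupp.finsetSum_apply]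
  refine Finset.sum_eq_zero fun x hx => ?_
  rw [map_smul, Finsupp.smul_apply, hcon x _ (Finsupp.mem_support_iff.1 hx), smul_zero]
  by_contra hlab
  exact Finsupp.mem_support_iff.1 hx (apply_eq_zero_of_mem_labSpace hf hlab)

theorem liftOp_bidegree {O : Finset (Fin D.n) → Space F D.Arc →ₗ[F] Space F D.Arc} (k : ℤ)
    (hO : ∀ I x y, IsLab (D.circles I) x → O I (del F x) y ≠ 0 →
      labDeg (D.circles I) y = labDeg (D.circles I) x + k) {i j : ℤ}
    {f : ∀ r, D.Gen r → F} (hf : f ∈ D.bidegree F i j) :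
    (fun r => liftOp O r (f r)) ∈ D.bidegree F i (j + k) := by
  intro r s hs
  obtain ⟨x, hx, h1, h2⟩ := exists_of_apply_ne_zero (component_mem s.I (f r)) hs
  have h3 : component s.I (f r) x = f r ⟨s.I, x, s.card_eq, hx⟩ :=
    component_apply (D := D) ⟨s.I, x, s.card_eq, hx⟩ (f r)
  rw [h3] at h1
  obtain ⟨h4, h5⟩ := hf r _ h1
  refine ⟨h4, ?_⟩
  rw [qdeg_eq] at h5 ⊢
  rw [hO s.I x s.label hx h2, ← h5]
  ring

theorem mulX_labDeg {α : Type} [Finite α] {R : Setoid α} (e : α) (x y : α → Bool)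
    (hx : IsLab R x) (h0 : mulX (0 : F) 0 R e (del F x) y ≠ 0) :
    labDeg R y = labDeg R x + -2 := by
  rw [mulX_del, Finsupp.finsetSum_apply] at h0
  obtain ⟨v, -, hv⟩ := Finset.exists_ne_zero_of_sum_ne_zero h0
  rw [Finsupp.smul_apply, smul_eq_mul] at hv
  have h1 := left_ne_zero_of_mul hv
  have h2 := right_ne_zero_of_mul hv
  rw [Finsupp.single_apply] at h2
  have h3 : upd R e v x = y := by
    by_contra h3
    exact h2 (if_neg h3)
  rw [← h3, labDeg_upd hx]
  cases hxe : x e <;> cases v <;> simp [hxe, mulCoeff] at h1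
  simp [sgn]
  ring

theorem derivX_labDeg {α : Type} [Finite α] {R : Setoid α} (x y : α → Bool)
    (hx : IsLab R x) (h0 : derivX F R (del F x) y ≠ 0) :
    labDeg R y = labDeg R x + 2 := by
  simp only [derivX, Finsupp.linearCombination_single, one_smul, Finsupp.finsetSum_apply] at h0
  obtain ⟨q, -, hq⟩ := Finset.exists_ne_zero_of_sum_ne_zero h0
  split_ifs at hq with hxq
  · rw [Finsupp.single_apply] at hq
    have h3 : upd R q.out true x = y := by
      by_contra h3
      exact hq (if_neg h3)
    rw [← h3, labDeg_upd hx, hxq]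
    simp [sgn]
    ring
  · exact absurd rfl hq

theorem nontrivial_Kh_iff {i j : ℤ} : Nontrivial (D.Kh F i j) ↔
    ¬ LinearMap.ker (D.diffAll (0 : F) 0) ⊓ D.bidegree F i j ≤
      (D.bidegree F (i - 1) j).map (D.diffAll (0 : F) 0) := by
  rw [← not_subsingleton_iff_nontrivial, Submodule.Quotient.subsingleton_iff,
    Submodule.submoduleOf_eq_top]

/-- In characteristic two, the homology of a nonempty diagram does not lie on one diagonal. -/
theorem IsPlanar.nontrivial_Kh_of_char_two [CharP F 2] (hD : D.IsPlanar) (e : D.Arc) {i j : ℤ}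
    (hK : Nontrivial (D.Kh F i j)) :
    Nontrivial (D.Kh F i (j + 2)) ∨ Nontrivial (D.Kh F i (j + -2)) := by
  by_contra hcon
  rw [not_or, nontrivial_Kh_iff, nontrivial_Kh_iff, not_not, not_not] at hcon
  obtain ⟨hp, hm⟩ := hcon
  refine nontrivial_Kh_iff.1 hK ?_
  rintro f ⟨hf, hfb⟩
  -- Multiplication by `X` at `e` and the derivation are chain maps of quantum degrees `-2` and `2`.
  -- In characteristic two the Leibniz rule gives `X V + V X = 1`.
  let X : Finset (Fin D.n) → Space F D.Arc →ₗ[F] Space F D.Arc :=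
    fun I => mulX 0 0 (D.circles I) e
  let V : Finset (Fin D.n) → Space F D.Arc →ₗ[F] Space F D.Arc := fun I => derivX F (D.circles I)
  have hX : ∀ I, ∀ g ∈ labSpace F (D.circles I), X I g ∈ labSpace F (D.circles I) :=
    fun I g hg => mulX_mem 0 0 e hg
  have hV : ∀ I, ∀ g ∈ labSpace F (D.circles I), V I g ∈ labSpace F (D.circles I) :=
    fun I g hg => derivX_mem hg
  have hcomm : ∀ O : Finset (Fin D.n) → Space F D.Arc →ₗ[F] Space F D.Arc,
      (∀ r g, D.diff 0 0 r (liftOp O r g) = liftOp O (r + 1) (D.diff 0 0 r g)) →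
      ∀ g : ∀ r, D.Gen r → F, D.diffAll 0 0 (fun r => liftOp O r (g r)) =
        fun r => liftOp O r (D.diffAll 0 0 g r) := by
    intro O hO g
    funext r
    cases r with
    | zero => exact (map_zero (liftOp O 0)).symm
    | succ r => exact hO r (g r)
  have hdX := hcomm X fun r g => diff_liftOp 0 0 hD hX
    (fun I c hc g hg => hD.edgeOp_mulX 0 0 hc e hg) g
  have hdV := hcomm V fun r g => diff_liftOp 0 0 hD hV
    (fun I c hc g hg => hD.edgeOp_derivX hc hg) g
  have hker : ∀ g : ∀ r, D.Gen r → F, g ∈ LinearMap.ker (D.diffAll (0 : F) 0) →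
      (fun r => liftOp X r (g r)) ∈ LinearMap.ker (D.diffAll (0 : F) 0) ∧
      (fun r => liftOp V r (g r)) ∈ LinearMap.ker (D.diffAll (0 : F) 0) := by
    intro g hg
    rw [LinearMap.mem_ker] at hg
    rw [LinearMap.mem_ker, LinearMap.mem_ker, hdX, hdV, hg]
    constructor <;> funext r <;> simp
  -- If both neighbouring groups vanish, then `V f = d y` and `X f = d z`, so `f = X V f + V X f = d
  -- (X y + V z)` is a coboundary.
  obtain ⟨y, hy, hdy⟩ := hp ⟨(hker f hf).2, liftOp_bidegree 2 (fun I x y => derivX_labDeg x y) hfb⟩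
  obtain ⟨z, hz, hdz⟩ := hm ⟨(hker f hf).1, liftOp_bidegree (-2) (fun I x y => mulX_labDeg e x y) hfb⟩
  have hy' := liftOp_bidegree (O := X) (-2) (fun I x y => mulX_labDeg e x y) hy
  have hz' := liftOp_bidegree (O := V) 2 (fun I x y => derivX_labDeg x y) hz
  rw [add_neg_cancel_right] at hy'
  rw [neg_add_cancel_right] at hz'
  refine ⟨_, Submodule.add_mem _ hy' hz', ?_⟩
  rw [map_add, hdX, hdV, hdy, hdz]
  funext r
  refine chain_ext fun I => ?_
  have h1 := derivX_mulX e (component_mem I (f r))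
  simp only [Pi.add_apply, map_add, component_liftOp hX, component_liftOp hV]
  change mulX 0 0 (D.circles I) e (derivX F (D.circles I) _) +
    derivX F (D.circles I) (mulX 0 0 (D.circles I) e _) = _
  rw [h1, add_left_comm, ← two_smul F, CharTwo.two_eq_zero, zero_smul, add_zero]

end GaussCode

namespace PeriodicDiagram

/-- Needed to make the projections to sets of quantum degrees linear over the group algebra. -/
theorem qdeg_rotGen {m : ℕ} (D : PeriodicDiagram m) {r : ℕ} (g : Multiplicative (ZMod m))
    (s : D.Gen r) : (D.rotGen g s).qdeg = s.qdeg := by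
  have hcount : ∀ b, (D.rotGen g s).count b = s.count b := by
    intro b
    let φ : Quotient (D.circles s.I) ≃ Quotient (D.circles (D.rotSet g s.I)) :=
      Quotient.congr (D.rotArc g) fun x y => (D.circles_rot g s.I x y).symm
    rw [GaussCode.Gen.count, GaussCode.Gen.count, ← Set.ncard_image_of_injective _ φ.injective]
    congr 1
    ext q
    simp only [Set.mem_image, Set.mem_ofPred_eq]
    constructor
    · rintro ⟨e, he, rfl⟩
      refine ⟨_, ⟨D.rotArc g⁻¹ e, he, rfl⟩, ?_⟩
      change Quotient.mk _ (D.rotArc g (D.rotArc g⁻¹ e)) = _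
      rw [← Equiv.Perm.mul_apply, ← map_mul, mul_inv_cancel, map_one]
      rfl
    · rintro ⟨_, ⟨e, he, rfl⟩, rfl⟩
      refine ⟨D.rotArc g e, ?_, rfl⟩
      change s.label (D.rotArc g⁻¹ (D.rotArc g e)) = b
      rwa [← Equiv.Perm.mul_apply, ← map_mul, inv_mul_cancel, map_one]
  rw [GaussCode.Gen.qdeg, GaussCode.Gen.qdeg, hcount, hcount]

end PeriodicDiagram

/-! ## Filtered complexes -/

theorem Submodule.finrank_map_add_finrank_inf_ker {F V W : Type*} [Field F] [AddCommGroup V]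
    [Module F V] [AddCommGroup W] [Module F W] (f : V →ₗ[F] W) (S : Submodule F V)
    [FiniteDimensional F S] :
    Module.finrank F (S.map f) + Module.finrank F ↥(S ⊓ LinearMap.ker f) = Module.finrank F S := by
  have h1 := LinearMap.finrank_range_add_finrank_ker (f.domRestrict S)
  rw [LinearMap.range_domRestrict] at h1
  have h2 : (LinearMap.ker (f.domRestrict S)).map S.subtype = S ⊓ LinearMap.ker f := by
    rw [LinearMap.domRestrict, LinearMap.ker_comp, Submodule.map_comap_subtype]
  rw [← h1, ← h2, Submodule.finrank_map_subtype_eq]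

theorem Int.sum_Ico_sub (g : ℤ → ℤ) {a b : ℤ} (h : a ≤ b) :
    ∑ k ∈ Finset.Ico a b, (g k - g (k + 1)) = g a - g b := by
  induction b, h using Int.leInduction with
  | base => simp
  | succ b hb ih =>
    rw [← Finset.insert_Ico_right_eq_Ico_add_one hb, Finset.sum_insert (by simp), ih]
    ring

/-- A complex of vector spaces, given by the subspaces `T i` of cochains of degree `i`, with a
differential `d` that respects a decreasing filtration `Φ`. -/
structure IsFilteredComplex {F V : Type*} [Field F] [AddCommGroup V] [Module F V]
    (T Φ : ℤ → Submodule F V) (lo hi : ℤ) (d : V →ₗ[F] V) : Prop where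
  finite : ∀ i, FiniteDimensional F (T i)
  map_mem : ∀ i, ∀ x ∈ T i, d x ∈ T (i + 1)
  map_map : ∀ x, d (d x) = 0
  map_filt : ∀ k, ∀ x ∈ Φ k, d x ∈ Φ k
  anti : Antitone Φ
  le : lo ≤ hi
  top : Φ lo = ⊤
  bot : Φ hi = ⊥

namespace IsFilteredComplex

variable {F V : Type*} [Field F] [AddCommGroup V] [Module F V]

/-- The coboundaries of filtration degree `b` of the cochains of filtration degree `a`. -/
def bdry (T Φ : ℤ → Submodule F V) (d : V →ₗ[F] V) (i a b : ℤ) : Submodule F V :=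
  (T (i - 1) ⊓ Φ a).map d ⊓ Φ b

/-- The number of pairs of basis elements of filtration degrees `a` and `b` that the differential
cancels. -/
noncomputable def pairs (T Φ : ℤ → Submodule F V) (d : V →ₗ[F] V) (i a b : ℤ) : ℕ :=
  Module.finrank F (bdry T Φ d i a b) + Module.finrank F (bdry T Φ d i (a + 1) (b + 1)) -
    (Module.finrank F (bdry T Φ d i (a + 1) b) + Module.finrank F (bdry T Φ d i a (b + 1)))

variable {T Φ : ℤ → Submodule F V} {lo hi : ℤ} {d : V →ₗ[F] V}

section

variable (C : IsFilteredComplex T Φ lo hi d)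

include C

theorem finite_inf (i : ℤ) (S : Submodule F V) : FiniteDimensional F ↥(T i ⊓ S) :=
  have := C.finite i
  Submodule.finiteDimensional_of_le inf_le_left

theorem finite_bdry (i a b : ℤ) : FiniteDimensional F (bdry T Φ d i a b) :=
  have := C.finite_inf (i - 1) (Φ a)
  Submodule.finiteDimensional_of_le (inf_le_left : bdry T Φ d i a b ≤ _)

theorem bdry_mono (i : ℤ) {a a' b b' : ℤ} (ha : a' ≤ a) (hb : b' ≤ b) :
    bdry T Φ d i a b ≤ bdry T Φ d i a' b' :=
  inf_le_inf (Submodule.map_mono (inf_le_inf le_rfl (C.anti ha))) (C.anti hb)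

theorem pairs_add (i a b : ℤ) : pairs T Φ d i a b +
    (Module.finrank F (bdry T Φ d i (a + 1) b) + Module.finrank F (bdry T Φ d i a (b + 1))) =
    Module.finrank F (bdry T Φ d i a b) +
      Module.finrank F (bdry T Φ d i (a + 1) (b + 1)) := by
  refine Nat.sub_add_cancel ?_
  have := C.finite_bdry i (a + 1) b
  have := C.finite_bdry i a (b + 1)
  have := C.finite_bdry i a b
  have := C.finite_bdry i (a + 1) (b + 1)
  rw [← Submodule.finrank_sup_add_finrank_inf_eq]
  refine Nat.add_le_add (Submodule.finrank_mono ?_) (Submodule.finrank_mono ?_)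
  · exact sup_le (C.bdry_mono i (by omega) le_rfl) (C.bdry_mono i le_rfl (by omega))
  · exact inf_le_inf (inf_le_left) inf_le_right

theorem pairs_cast (i a b : ℤ) : (pairs T Φ d i a b : ℤ) =
    Module.finrank F (bdry T Φ d i a b) - Module.finrank F (bdry T Φ d i (a + 1) b) -
      (Module.finrank F (bdry T Φ d i a (b + 1)) -
        Module.finrank F (bdry T Φ d i (a + 1) (b + 1))) := by
  have := C.pairs_add i a b
  omega

theorem pairs_eq_zero (i a b : ℤ)
    (h : bdry T Φ d i a b ≤ bdry T Φ d i (a + 1) b ⊔ bdry T Φ d i a (b + 1)) :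
    pairs T Φ d i a b = 0 := by
  have h1 := C.pairs_add i a b
  have := C.finite_bdry i (a + 1) b
  have := C.finite_bdry i a (b + 1)
  have := C.finite_bdry i (a + 1) (b + 1)
  have h2 := Submodule.finrank_sup_add_finrank_inf_eq (bdry T Φ d i (a + 1) b)
    (bdry T Φ d i a (b + 1))
  have h3 := Submodule.finrank_mono h
  have h4 : bdry T Φ d i (a + 1) (b + 1) ≤ bdry T Φ d i (a + 1) b ⊓ bdry T Φ d i a (b + 1) :=
    le_inf (C.bdry_mono i le_rfl (by omega)) (C.bdry_mono i (by omega) le_rfl)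
  have h5 : Module.finrank F (bdry T Φ d i (a + 1) (b + 1)) ≤
      Module.finrank F ↥(bdry T Φ d i (a + 1) b ⊓ bdry T Φ d i a (b + 1)) :=
    have := Submodule.finiteDimensional_of_le
      (inf_le_left : bdry T Φ d i (a + 1) b ⊓ bdry T Φ d i a (b + 1) ≤ _)
    Submodule.finrank_mono h4
  omega

theorem eq_top_of_le {k : ℤ} (h : k ≤ lo) : Φ k = ⊤ := top_le_iff.1 (C.top ▸ C.anti h)

theorem eq_bot_of_le {k : ℤ} (h : hi ≤ k) : Φ k = ⊥ := le_bot_iff.1 (C.bot ▸ C.anti h)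

theorem bdry_eq_bot {i a b : ℤ} (h : hi ≤ a ∨ hi ≤ b) : bdry T Φ d i a b = ⊥ := by
  rcases h with h | h <;> simp [bdry, C.eq_bot_of_le h]

/-- Below `lo` each filtration step is the whole space and from `hi` on it is zero, so no bigraded
piece lies outside the square. -/
theorem pairs_eq_zero_of_not_mem {i a b : ℤ}
    (h : ¬ (lo ≤ a ∧ a < hi ∧ lo ≤ b ∧ b < hi)) : pairs T Φ d i a b = 0 := by
  by_cases h1 : hi ≤ a ∨ hi ≤ b
  · refine C.pairs_eq_zero i a b ?_
    rw [C.bdry_eq_bot h1]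
    exact bot_le
  · by_cases h2 : a < lo
    · refine C.pairs_eq_zero i a b (le_trans (le_of_eq ?_) le_sup_left)
      rw [bdry, bdry, C.eq_top_of_le h2.le, C.eq_top_of_le (by omega : a + 1 ≤ lo)]
    · have h3 : b < lo := by omega
      refine C.pairs_eq_zero i a b (le_trans (le_of_eq ?_) le_sup_right)
      rw [bdry, bdry, C.eq_top_of_le h3.le, C.eq_top_of_le (by omega : b + 1 ≤ lo)]

theorem pairs_eq_zero_of_lt {i a b : ℤ} (h : b < a) : pairs T Φ d i a b = 0 := by
  refine C.pairs_eq_zero i a b (le_trans ?_ le_sup_right)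
  rintro _ ⟨⟨x, hx, rfl⟩, -⟩
  exact ⟨⟨x, hx, rfl⟩, C.anti (by omega : b + 1 ≤ a) (C.map_filt _ _ hx.2)⟩

/-- If the complex is a direct sum of subcomplexes according to the residues of the filtration
degree modulo `κ`, then only degrees with difference divisible by `κ` cancel. -/
theorem pairs_eq_zero_of_not_dvd {κ i a b : ℤ} (P : V →ₗ[F] V)
    (hT : ∀ i, ∀ x ∈ T i, P x ∈ T i) (hd : ∀ x, d (P x) = P (d x))
    (ha : ∀ x ∈ Φ a, P x ∈ Φ a ∧ x - P x ∈ Φ (a + 1))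
    (hb : ∀ b, ¬ κ ∣ b - a → ∀ x ∈ Φ b, P x ∈ Φ (b + 1)) (h : ¬ κ ∣ b - a) :
    pairs T Φ d i a b = 0 := by
  refine C.pairs_eq_zero i a b ?_
  rintro _ ⟨⟨x, hx, rfl⟩, hy⟩
  -- `P` keeps the part of `x` in the residue class of `a`. The remainder has source degree at least
  -- `a + 1`. The boundary of `P x` lies in that residue class too, so it jumps past `b`.
  have h1 : P (d x) ∈ Φ (b + 1) := hb b h _ hy
  have h2 : d x = d (x - P x) + d (P x) := by rw [map_sub, sub_add_cancel]
  rw [h2]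
  refine Submodule.add_mem_sup ⟨⟨_, ⟨Submodule.sub_mem _ hx.1 (hT _ _ hx.1), (ha x hx.2).2⟩, rfl⟩, ?_⟩
    ⟨⟨_, ⟨hT _ _ hx.1, (ha x hx.2).1⟩, rfl⟩, ?_⟩
  · rw [map_sub, hd]
    exact Submodule.sub_mem _ hy (C.anti (by omega) h1)
  · rw [hd]
    exact h1

/-- The numbers on the diagonal are the ranks of the differential of the associated graded
complex. -/
theorem pairs_self (p : V →ₗ[F] V) (i k : ℤ) (hp : ∀ x ∈ Φ k, p x = 0 ↔ x ∈ Φ (k + 1)) :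
    pairs T Φ d i k k = Module.finrank F ((T (i - 1) ⊓ Φ k).map (p ∘ₗ d)) := by
  have hle : ∀ a, k ≤ a → (T (i - 1) ⊓ Φ a).map d ≤ Φ k := by
    rintro a ha _ ⟨x, hx, rfl⟩
    exact C.map_filt _ _ (C.anti ha hx.2)
  -- On the diagonal the target condition at `k` is automatic. What is counted is the image of `Φ k`
  -- under `d` modulo its intersection with `Φ (k + 1)`, the kernel of `p` there.
  have h1 : bdry T Φ d i k k = (T (i - 1) ⊓ Φ k).map d := inf_eq_left.2 (hle k le_rfl)
  have h2 : bdry T Φ d i (k + 1) k = bdry T Φ d i (k + 1) (k + 1) := by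
    refine le_antisymm ?_ (C.bdry_mono i le_rfl (by omega))
    rintro _ ⟨⟨x, hx, rfl⟩, -⟩
    exact ⟨⟨x, hx, rfl⟩, C.map_filt _ _ hx.2⟩
  have h3 : bdry T Φ d i k (k + 1) = (T (i - 1) ⊓ Φ k).map d ⊓ LinearMap.ker p := by
    ext x
    refine and_congr_right fun hx => ?_
    exact (hp x (hle k le_rfl hx)).symm
  have h4 := C.pairs_add i k k
  have := C.finite_inf (i - 1) (Φ k)
  have h5 := Submodule.finrank_map_add_finrank_inf_ker p ((T (i - 1) ⊓ Φ k).map d)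
  rw [h1, h2, h3] at h4
  rw [Submodule.map_comp]
  omega

/-- The filtration of the cohomology. -/
theorem finrank_filt_cohomology (i k : ℤ) :
    Module.finrank F ((LinearMap.ker d ⊓ T i ⊓ Φ k).map ((T (i - 1)).map d).mkQ) +
      Module.finrank F (bdry T Φ d i lo k) + Module.finrank F (bdry T Φ d (i + 1) k lo) =
      Module.finrank F ↥(T i ⊓ Φ k) := by
  have := C.finite_inf i (Φ k)
  -- Rank-nullity is applied twice: `d` splits off the non-cocycles of `Φ k`, and the quotient map
  -- splits off the coboundaries in `Φ k`.
  have h1 := Submodule.finrank_map_add_finrank_inf_ker d (T i ⊓ Φ k)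
  have h2 : T i ⊓ Φ k ⊓ LinearMap.ker d = LinearMap.ker d ⊓ T i ⊓ Φ k := by
    rw [inf_comm, inf_assoc]
  rw [h2] at h1
  have : FiniteDimensional F ↥(LinearMap.ker d ⊓ T i ⊓ Φ k) := by
    rw [← h2]
    exact Submodule.finiteDimensional_of_le inf_le_left
  have h3 := Submodule.finrank_map_add_finrank_inf_ker ((T (i - 1)).map d).mkQ
    (LinearMap.ker d ⊓ T i ⊓ Φ k)
  rw [Submodule.ker_mkQ] at h3
  have h4 : LinearMap.ker d ⊓ T i ⊓ Φ k ⊓ (T (i - 1)).map d = bdry T Φ d i lo k := by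
    rw [bdry, C.top, inf_top_eq]
    ext y
    constructor
    · rintro ⟨⟨-, h⟩, h'⟩
      exact ⟨h', h⟩
    · rintro ⟨⟨x, hx, rfl⟩, h⟩
      refine ⟨⟨⟨C.map_map x, ?_⟩, h⟩, ⟨x, hx, rfl⟩⟩
      have := C.map_mem _ _ hx
      rwa [sub_add_cancel] at this
  have h5 : bdry T Φ d (i + 1) k lo = (T i ⊓ Φ k).map d := by
    rw [bdry, C.top, inf_top_eq, add_sub_cancel_right]
  rw [h4] at h3
  rw [h5]
  omega

/-- The second difference telescopes in the target variable, and the term at `hi` is zero. -/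
theorem sum_pairs_right (i a : ℤ) :
    ∑ b ∈ Finset.Ico lo hi, (pairs T Φ d i a b : ℤ) =
      Module.finrank F (bdry T Φ d i a lo) - Module.finrank F (bdry T Φ d i (a + 1) lo) := by
  rw [Finset.sum_congr rfl fun b _ => C.pairs_cast i a b,
    Int.sum_Ico_sub (fun b => (Module.finrank F (bdry T Φ d i a b) : ℤ) -
      Module.finrank F (bdry T Φ d i (a + 1) b)) C.le, C.bdry_eq_bot (Or.inr le_rfl),
    C.bdry_eq_bot (Or.inr le_rfl)]
  simp

theorem sum_pairs_left (i b : ℤ) :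
    ∑ a ∈ Finset.Ico lo hi, (pairs T Φ d i a b : ℤ) =
      Module.finrank F (bdry T Φ d i lo b) - Module.finrank F (bdry T Φ d i lo (b + 1)) := by
  have h : ∀ a, (pairs T Φ d i a b : ℤ) = Module.finrank F (bdry T Φ d i a b) -
      Module.finrank F (bdry T Φ d i a (b + 1)) - (Module.finrank F (bdry T Φ d i (a + 1) b) -
        Module.finrank F (bdry T Φ d i (a + 1) (b + 1))) := fun a => by
    rw [C.pairs_cast]
    ring
  rw [Finset.sum_congr rfl fun a _ => h a,
    Int.sum_Ico_sub (fun a => (Module.finrank F (bdry T Φ d i a b) : ℤ) -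
      Module.finrank F (bdry T Φ d i a (b + 1))) C.le, C.bdry_eq_bot (Or.inl le_rfl),
    C.bdry_eq_bot (Or.inl le_rfl)]
  simp

variable (T Φ d) in
/-- The dimension of the graded piece of degree `k` of the cohomology in degree `i`. -/
noncomputable def grRank (i k : ℤ) : ℕ :=
  Module.finrank F (↥((LinearMap.ker d ⊓ T i ⊓ Φ k).map ((T (i - 1)).map d).mkQ) ⧸
      ((LinearMap.ker d ⊓ T i ⊓ Φ (k + 1)).map ((T (i - 1)).map d).mkQ).submoduleOf
        ((LinearMap.ker d ⊓ T i ⊓ Φ k).map ((T (i - 1)).map d).mkQ))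

/-- The dimensions of the graded pieces of the cohomology in terms of the cancelled pairs. -/
theorem finrank_gr_cohomology (i k : ℤ) :
    (grRank T Φ d i k : ℤ) + ∑ a ∈ Finset.Ico lo hi, (pairs T Φ d i a k : ℤ) +
      ∑ b ∈ Finset.Ico lo hi, (pairs T Φ d (i + 1) k b : ℤ) =
      Module.finrank F ↥(T i ⊓ Φ k) - Module.finrank F ↥(T i ⊓ Φ (k + 1)) := by
  have h1 := C.finrank_filt_cohomology i k
  have h2 := C.finrank_filt_cohomology i (k + 1)
  rw [C.sum_pairs_left, C.sum_pairs_right]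
  have := C.finite i
  have hfin : ∀ j, FiniteDimensional F
      ((LinearMap.ker d ⊓ T i ⊓ Φ j).map ((T (i - 1)).map d).mkQ) := fun j =>
    have : FiniteDimensional F ↥(LinearMap.ker d ⊓ T i ⊓ Φ j) :=
      Submodule.finiteDimensional_of_le (inf_le_left.trans inf_le_right)
    inferInstance
  have := hfin k
  have h3 := Submodule.finrank_quotient_add_finrank
    (((LinearMap.ker d ⊓ T i ⊓ Φ (k + 1)).map ((T (i - 1)).map d).mkQ).submoduleOf
        ((LinearMap.ker d ⊓ T i ⊓ Φ k).map ((T (i - 1)).map d).mkQ))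
  have h4 := (Submodule.submoduleOfEquivOfLe (Submodule.map_mono (f := ((T (i - 1)).map d).mkQ)
    (inf_le_inf (le_refl (LinearMap.ker d ⊓ T i))
      (C.anti (by omega : k ≤ k + 1))))).finrank_eq
  rw [h4] at h3
  rw [grRank]
  omega

/-- Nonzero terms have target degree `k + κ u` with `u ≥ 0`, and `u ≤ N` because the filtration has
length at most `N`. -/
theorem sum_pairs_right_eq {κ : ℤ} (hκ : 0 < κ)
    (hdvd : ∀ i a b, ¬ κ ∣ b - a → pairs T Φ d i a b = 0) {N : ℕ} (hN : hi - lo ≤ N) (i k : ℤ) :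
    ∑ b ∈ Finset.Ico lo hi, (pairs T Φ d i k b : ℤ) =
      ∑ u ∈ Finset.range (N + 1), (pairs T Φ d i k (k + κ * u) : ℤ) := by
  symm
  refine Finset.sum_bij_ne_zero (fun u _ _ => k + κ * (u : ℤ)) ?_ ?_ ?_ ?_
  · intro u _ h
    have h1 := mt C.pairs_eq_zero_of_not_mem (Nat.cast_ne_zero.1 h)
    rw [not_not] at h1
    exact Finset.mem_Ico.2 h1.2.2
  · intro u _ _ v _ _ h
    exact_mod_cast mul_left_cancel₀ hκ.ne' (add_left_cancel h)
  · intro b _ h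
    have h0 := Nat.cast_ne_zero.1 h
    have h1 := mt C.pairs_eq_zero_of_not_mem h0
    have h2 : k ≤ b := not_lt.1 (mt C.pairs_eq_zero_of_lt h0)
    obtain ⟨c, hc⟩ := not_not.1 (mt (hdvd i k b) h0)
    have hc0 : 0 ≤ c := nonneg_of_mul_nonneg_right (by omega : 0 ≤ κ * c) hκ
    have hc1 : c ≤ κ * c := le_mul_of_one_le_left hc0 hκ
    lift c to ℕ using hc0
    have hb : k + κ * (c : ℤ) = b := by omega
    refine ⟨c, Finset.mem_range.2 (by omega), ?_, hb⟩
    rwa [hb]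
  · intros
    rfl

theorem sum_pairs_left_eq {κ : ℤ} (hκ : 0 < κ)
    (hdvd : ∀ i a b, ¬ κ ∣ b - a → pairs T Φ d i a b = 0) {N : ℕ} (hN : hi - lo ≤ N) (i k : ℤ) :
    ∑ a ∈ Finset.Ico lo hi, (pairs T Φ d i a k : ℤ) =
      ∑ u ∈ Finset.range (N + 1), (pairs T Φ d i (k - κ * u) k : ℤ) := by
  symm
  refine Finset.sum_bij_ne_zero (fun u _ _ => k - κ * (u : ℤ)) ?_ ?_ ?_ ?_
  · intro u _ h
    have h1 := mt C.pairs_eq_zero_of_not_mem (Nat.cast_ne_zero.1 h)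
    rw [not_not] at h1
    exact Finset.mem_Ico.2 ⟨h1.1, h1.2.1⟩
  · intro u _ _ v _ _ h
    exact_mod_cast mul_left_cancel₀ hκ.ne' (sub_right_injective h)
  · intro a _ h
    have h0 := Nat.cast_ne_zero.1 h
    have h1 := mt C.pairs_eq_zero_of_not_mem h0
    have h2 : a ≤ k := not_lt.1 (mt C.pairs_eq_zero_of_lt h0)
    obtain ⟨c, hc⟩ := not_not.1 (mt (hdvd i a k) h0)
    have hc0 : 0 ≤ c := nonneg_of_mul_nonneg_right (by omega : 0 ≤ κ * c) hκ
    have hc1 : c ≤ κ * c := le_mul_of_one_le_left hc0 hκ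
    lift c to ℕ using hc0
    have hb : k - κ * (c : ℤ) = a := by omega
    refine ⟨c, Finset.mem_range.2 (by omega), ?_, hb⟩
    rwa [hb]
  · intros
    rfl

theorem pairs_eq_zero_of_gt {κ : ℤ} (hκ : 0 < κ) {N : ℕ} (hN : hi - lo ≤ N) {u : ℕ} (hu : N < u)
    (i a : ℤ) : pairs T Φ d i a (a + κ * u) = 0 := by
  refine C.pairs_eq_zero_of_not_mem fun h => ?_
  have : (u : ℤ) ≤ κ * u := le_mul_of_one_le_left (by omega) hκ
  omega

/-- The comparison of the cohomology of two differentials with the same associated graded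
complex, one of which preserves the filtration degree and the other one preserves it modulo
`κ`. -/
theorem grRank_comparison {d₀ : V →ₗ[F] V} (C₀ : IsFilteredComplex T Φ lo hi d₀) {κ : ℤ}
    (hκ : 0 < κ) (hdvd : ∀ i a b, ¬ κ ∣ b - a → pairs T Φ d i a b = 0)
    (hdvd₀ : ∀ i a b, a ≠ b → pairs T Φ d₀ i a b = 0)
    (hself : ∀ i k, pairs T Φ d i k k = pairs T Φ d₀ i k k) {N : ℕ} (hN : hi - lo ≤ N)
    (i k : ℤ) : grRank T Φ d₀ i k = grRank T Φ d i k +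
      ∑ u ∈ Finset.Icc 1 N, (pairs T Φ d (i + 1) k (k + κ * u) +
        pairs T Φ d i (k - κ * u) k) := by
  have h1 := C.finrank_gr_cohomology i k
  have h2 := C₀.finrank_gr_cohomology i k
  have hdvd₁ : ∀ i a b, ¬ κ ∣ b - a → pairs T Φ d₀ i a b = 0 := fun i a b h =>
    hdvd₀ i a b (by rintro rfl; exact h (by simp))
  -- The term `u = 0` is split off. It is the same for both differentials by `hself`, and for `d₀`
  -- it is the only one. The cochain side of the count does not involve the differential, so the two
  -- equations can be subtracted.
  rw [C.sum_pairs_right_eq hκ hdvd hN, C.sum_pairs_left_eq hκ hdvd hN,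
    Finset.sum_range_succ', Finset.sum_range_succ'] at h1
  rw [C₀.sum_pairs_right_eq hκ hdvd₁ hN, C₀.sum_pairs_left_eq hκ hdvd₁ hN,
    Finset.sum_range_succ', Finset.sum_range_succ'] at h2
  have h3 : ∀ u : ℕ, κ * ((u + 1 : ℕ) : ℤ) ≠ 0 := fun u =>
    mul_ne_zero hκ.ne' (by exact_mod_cast u.succ_ne_zero)
  have h4 : ∀ u : ℕ, pairs T Φ d₀ i (k - κ * ((u + 1 : ℕ) : ℤ)) k = 0 := fun u =>
    hdvd₀ _ _ _ (by have := h3 u; omega)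
  have h5 : ∀ u : ℕ, pairs T Φ d₀ (i + 1) k (k + κ * ((u + 1 : ℕ) : ℤ)) = 0 := fun u =>
    hdvd₀ _ _ _ (by have := h3 u; omega)
  have h6 : ∑ u ∈ Finset.Icc 1 N, (pairs T Φ d (i + 1) k (k + κ * u) +
      pairs T Φ d i (k - κ * u) k) = ∑ u ∈ Finset.range N,
        (pairs T Φ d (i + 1) k (k + κ * ((u + 1 : ℕ) : ℤ)) +
          pairs T Φ d i (k - κ * ((u + 1 : ℕ) : ℤ)) k) := by
    rw [← Finset.Ico_add_one_right_eq_Icc, Finset.sum_Ico_eq_sum_range, Nat.add_sub_cancel]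
    simp only [add_comm 1]
  simp only [h4, h5, Nat.cast_zero, mul_zero, sub_zero, add_zero, Finset.sum_const_zero,
    zero_add] at h1 h2
  rw [h6, Finset.sum_add_distrib]
  zify
  rw [hself, hself] at h1
  push_cast at h1
  linarith

end

end IsFilteredComplex

namespace PeriodicDiagram

variable {m : ℕ} {F : Type u} [Field F] (D : PeriodicDiagram m)

/-! ## The total complex is filtered -/

open Classical in
/-- The projection to the generators whose quantum degree lies in a given set. -/
noncomputable def restrict (S : Set ℤ) (r : ℕ) : D.Chain F r →ₗ[GroupAlg F m] D.Chain F r where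
  toFun f := fun s => if s.qdeg ∈ S then (f : D.Gen r → F) s else 0
  map_add' f g := funext fun s => by
    change (if s.qdeg ∈ S then (f : D.Gen r → F) s + (g : D.Gen r → F) s else 0) =
      (if s.qdeg ∈ S then (f : D.Gen r → F) s else 0) +
        (if s.qdeg ∈ S then (g : D.Gen r → F) s else 0)
    split_ifs <;> simp
  map_smul' x f := by
    let p : (D.Gen r → F) →ₗ[F] (D.Gen r → F) :=
      { toFun := fun f s => if s.qdeg ∈ S then f s else 0
        map_add' := fun f g => funext fun s => by
          simp only [Pi.add_apply]
          split_ifs <;> simp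
        map_smul' := fun c f => funext fun s => by simp }
    suffices H : ∀ f : D.Gen r → F,
        p ((D.rep F r).asAlgebraHom x f) = (D.rep F r).asAlgebraHom x (p f) from H f
    intro f
    induction x using MonoidAlgebra.induction_linear with
    | zero => simp
    | add x y hx hy => simp [hx, hy]
    | single g a =>
      simp only [Representation.asAlgebraHom_single, LinearMap.smul_apply, map_smul]
      congr 1
      funext s
      change (if s.qdeg ∈ S then (D.rotSign g (D.rotGen g⁻¹ s).I : F) *
        f (D.rotGen g⁻¹ s) else 0) = (D.rotSign g (D.rotGen g⁻¹ s).I : F) *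
          (if (D.rotGen g⁻¹ s).qdeg ∈ S then f (D.rotGen g⁻¹ s) else 0)
      rw [qdeg_rotGen, mul_ite, mul_zero]

open Classical in
theorem restrict_apply (S : Set ℤ) {r : ℕ} (f : D.Chain F r) (s : D.Gen r) :
    (D.restrict S r f : D.Gen r → F) s = if s.qdeg ∈ S then (f : D.Gen r → F) s else 0 := rfl

theorem chain_ext {r : ℕ} {f g : D.Chain F r}
    (h : ∀ s, (f : D.Gen r → F) s = (g : D.Gen r → F) s) : f = g := funext h

theorem diffHom_apply (h t : F) {r : ℕ} (f : D.Chain F r) (s' : D.Gen (r + 1)) :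
    (D.diffHom h t r f : D.Gen (r + 1) → F) s' =
      ∑ s, D.dCoeff h t s s' * (f : D.Gen r → F) s := rfl

theorem diffHom_restrict (h t : F) (S : Set ℤ)
    (hS : ∀ r (s : D.Gen r) (s' : D.Gen (r + 1)), D.dCoeff h t s s' ≠ 0 →
      (s.qdeg ∈ S ↔ s'.qdeg ∈ S)) (r : ℕ) (f : D.Chain F r) :
    D.diffHom h t r (D.restrict S r f) = D.restrict S (r + 1) (D.diffHom h t r f) := by
  classical
  refine D.chain_ext fun s' => ?_
  rw [restrict_apply, diffHom_apply, diffHom_apply, Finset.sum_congr rfl fun s _ =>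
    congrArg _ (D.restrict_apply S f s)]
  split_ifs with h1
  · refine Finset.sum_congr rfl fun s _ => ?_
    by_cases h0 : D.dCoeff h t s s' = 0
    · simp [h0]
    · rw [if_pos ((hS r s s' h0).2 h1)]
  · refine Finset.sum_eq_zero fun s _ => ?_
    by_cases h0 : D.dCoeff h t s s' = 0
    · simp [h0]
    · rw [if_neg (mt (hS r s s' h0).1 h1), mul_zero]

theorem diffHom_diffHom (h t : F) (r : ℕ) (f : D.Chain F r) :
    D.diffHom h t (r + 1) (D.diffHom h t r f) = 0 :=
  GaussCode.IsPlanar.diff_diff h t D.planar f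

theorem gen_le {r : ℕ} (s : D.Gen r) : r ≤ D.n := by
  have := Finset.card_le_univ s.I
  rwa [s.card_eq, Fintype.card_fin] at this

theorem exists_qdeg_bounds : ∃ lo hi : ℤ, lo ≤ hi ∧ ∀ r (s : D.Gen r),
    lo ≤ s.qdeg ∧ s.qdeg < hi := by
  have hfin : (Set.range fun s : Σ r : Fin (D.n + 1), D.Gen r => s.2.qdeg).Finite :=
    Set.finite_range _
  obtain ⟨b, hb⟩ := hfin.bddAbove
  obtain ⟨a, ha⟩ := hfin.bddBelow
  have hmem : ∀ r (s : D.Gen r), a ≤ s.qdeg ∧ s.qdeg ≤ b := fun r s =>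
    have h := Set.mem_range_self (f := fun s : Σ r : Fin (D.n + 1), D.Gen r => s.2.qdeg)
      ⟨⟨r, Nat.lt_succ_of_le (D.gen_le s)⟩, s⟩
    ⟨ha h, hb h⟩
  -- The maximum gives `lo ≤ hi` without exhibiting a generator; the upper bound is strict, hence
  -- the `b + 1`.
  refine ⟨a, max a (b + 1), le_max_left _ _, fun r s => ⟨(hmem r s).1, ?_⟩⟩
  exact lt_of_lt_of_le (Int.lt_add_one_of_le (hmem r s).2) (le_max_right _ _)

variable {M : ModuleCat.{u} (GroupAlg F m)} (P : ProjectiveResolution M)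

theorem diffC_zero (h t : F) (f : D.Cochain P) (a : ℕ) : D.diffC h t P f a 0 = 0 := rfl

theorem diffC_succ (h t : F) (f : D.Cochain P) (a r : ℕ) :
    D.diffC h t P f a (r + 1) = D.diffHom h t r ∘ₗ f a r := rfl

theorem diffP_zero (f : D.Cochain P) (r : ℕ) : D.diffP P f 0 r = 0 := rfl

theorem diffP_succ (f : D.Cochain P) (a r : ℕ) :
    D.diffP P f (a + 1) r = (-1 : F) ^ r • (f a r ∘ₗ (P.complex.d (a + 1) a).hom) := rfl

theorem cochain_ext {f g : D.Cochain P}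
    (h : ∀ a r p (s : D.Gen r), (f a r p : D.Gen r → F) s = (g a r p : D.Gen r → F) s) :
    f = g :=
  funext fun a => funext fun r => LinearMap.ext fun p => D.chain_ext (h a r p)

theorem diffTot_diffTot (h t : F) (f : D.Cochain P) :
    D.diffTot h t P (D.diffTot h t P f) = 0 := by
  have hCC : D.diffC h t P (D.diffC h t P f) = 0 := by
    refine funext fun a => funext fun r => ?_
    rcases r with _ | _ | r
    · rfl
    · rw [diffC_succ, diffC_zero, LinearMap.comp_zero]
      rfl
    · exact LinearMap.ext fun p => D.diffHom_diffHom h t r (f a r p)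
  have hPP : D.diffP P (D.diffP P f) = 0 := by
    refine funext fun a => funext fun r => ?_
    rcases a with _ | _ | a
    · rfl
    · rw [diffP_succ, diffP_zero, LinearMap.zero_comp, smul_zero]
      rfl
    · rw [diffP_succ, diffP_succ, LinearMap.smul_comp, LinearMap.comp_assoc,
        ← ModuleCat.hom_comp, P.complex.d_comp_d, ModuleCat.hom_zero, LinearMap.comp_zero,
        smul_zero, smul_zero]
      rfl
  -- The sign `(-1) ^ r` changes when the Khovanov differential raises `r`, so the two parts
  -- anticommute.
  have hCP : D.diffC h t P (D.diffP P f) + D.diffP P (D.diffC h t P f) = 0 := by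
    refine funext fun a => funext fun r => ?_
    change D.diffC h t P (D.diffP P f) a r + D.diffP P (D.diffC h t P f) a r = 0
    rcases a with _ | a
    · rcases r with _ | r
      · rw [diffC_zero, diffP_zero, add_zero]
      · rw [diffC_succ, diffP_zero, diffP_zero, LinearMap.comp_zero, add_zero]
    · rcases r with _ | r
      · rw [diffC_zero, diffP_succ, diffC_zero, LinearMap.zero_comp, smul_zero, add_zero]
      · rw [diffC_succ, diffP_succ, diffP_succ, diffC_succ]
        refine LinearMap.ext fun p => ?_
        have h1 : D.diffHom h t r ((-1 : F) ^ r • f a r ((P.complex.d (a + 1) a).hom p)) =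
            (-1 : F) ^ r • D.diffHom h t r (f a r ((P.complex.d (a + 1) a).hom p)) :=
          (D.diff h t r).map_smul _ _
        change D.diffHom h t r ((-1 : F) ^ r • f a r ((P.complex.d (a + 1) a).hom p)) +
          (-1 : F) ^ (r + 1) • D.diffHom h t r (f a r ((P.complex.d (a + 1) a).hom p)) = 0
        rw [h1, pow_succ, mul_neg_one, neg_smul, add_neg_cancel]
  simp only [diffTot, LinearMap.add_apply, map_add]
  rw [hCC, hPP, zero_add, add_zero, add_comm, hCP]

theorem diffTot_mem_degree (h t : F) {i : ℤ} {f : D.Cochain P} (hf : f ∈ D.degree P i) :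
    D.diffTot h t P f ∈ D.degree P (i + 1) := by
  intro a r har
  change D.diffC h t P f a r + D.diffP P f a r = 0
  have h1 : D.diffC h t P f a r = 0 := by
    rcases r with _ | r
    · rfl
    · rw [diffC_succ, hf a r (by push_cast at har; omega), LinearMap.comp_zero]
  have h2 : D.diffP P f a r = 0 := by
    rcases a with _ | a
    · rfl
    · rw [diffP_succ, hf a r (by push_cast at har; omega), LinearMap.zero_comp, smul_zero]
  rw [h1, h2, add_zero]

theorem diffTot_mem_filt (h t : F) {k : ℤ} {f : D.Cochain P} (hf : f ∈ D.filt P k) :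
    D.diffTot h t P f ∈ D.filt P k := by
  refine Submodule.add_mem _ ?_ ?_
  · intro a r p s' hs'
    rcases r with _ | r
    · rfl
    · rw [diffC_succ, LinearMap.comp_apply, diffHom_apply]
      refine Finset.sum_eq_zero fun s _ => ?_
      by_cases h0 : D.dCoeff h t s s' = 0
      · rw [h0, zero_mul]
      · rw [hf a r p s (by rcases GaussCode.IsPlanar.dCoeff_deg D.planar h t h0 with h | h | h <;>
          omega), mul_zero]
  · intro a r p s hs
    rcases a with _ | a
    · rfl
    · have h1 := hf a r ((P.complex.d (a + 1) a).hom p) s hs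
      change (-1 : F) ^ r * (f a r ((P.complex.d (a + 1) a).hom p) : D.Gen r → F) s = 0
      rw [h1, mul_zero]

theorem filt_antitone : Antitone (D.filt P) := fun _ _ hkl _ hf a r p s hs =>
  hf a r p s (hs.trans_le hkl)

/-- The projection of the cochains to the quantum degrees in a given set. -/
noncomputable def restrictCochain (S : Set ℤ) : D.Cochain P →ₗ[F] D.Cochain P where
  toFun f := fun a r => D.restrict S r ∘ₗ f a r
  map_add' f g := funext fun a => funext fun r => LinearMap.comp_add _ _ _
  map_smul' c f := by
    classical
    refine D.cochain_ext P fun a r p s => ?_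
    change (if s.qdeg ∈ S then c * (f a r p : D.Gen r → F) s else 0) =
      c * (if s.qdeg ∈ S then (f a r p : D.Gen r → F) s else 0)
    rw [mul_ite, mul_zero]

open Classical in
theorem restrictCochain_apply (S : Set ℤ) (f : D.Cochain P) {a r : ℕ} (p : P.complex.X a)
    (s : D.Gen r) : (D.restrictCochain P S f a r p : D.Gen r → F) s =
      if s.qdeg ∈ S then (f a r p : D.Gen r → F) s else 0 := rfl

theorem restrictCochain_mem_degree (S : Set ℤ) {i : ℤ} {f : D.Cochain P}
    (hf : f ∈ D.degree P i) : D.restrictCochain P S f ∈ D.degree P i := by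
  intro a r har
  change D.restrict S r ∘ₗ f a r = 0
  rw [hf a r har, LinearMap.comp_zero]

theorem diffP_restrictCochain (S : Set ℤ) (f : D.Cochain P) :
    D.diffP P (D.restrictCochain P S f) = D.restrictCochain P S (D.diffP P f) := by
  classical
  refine D.cochain_ext P fun a r p s => ?_
  rw [restrictCochain_apply]
  rcases a with _ | a
  · exact (ite_self _).symm
  · change (-1 : F) ^ r * (if s.qdeg ∈ S then
      (f a r ((P.complex.d (a + 1) a).hom p) : D.Gen r → F) s else 0) = if s.qdeg ∈ S then
        (-1 : F) ^ r * (f a r ((P.complex.d (a + 1) a).hom p) : D.Gen r → F) s else 0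
    rw [mul_ite, mul_zero]

theorem diffTot_restrictCochain (h t : F) (S : Set ℤ)
    (hS : ∀ r (s : D.Gen r) (s' : D.Gen (r + 1)), D.dCoeff h t s s' ≠ 0 →
      (s.qdeg ∈ S ↔ s'.qdeg ∈ S)) (f : D.Cochain P) :
    D.diffTot h t P (D.restrictCochain P S f) = D.restrictCochain P S (D.diffTot h t P f) := by
  have hC : D.diffC h t P (D.restrictCochain P S f) =
      D.restrictCochain P S (D.diffC h t P f) := by
    refine funext fun a => funext fun r => ?_
    rcases r with _ | r
    · exact (LinearMap.comp_zero _).symm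
    · exact LinearMap.ext fun p => D.diffHom_restrict h t S hS r (f a r p)
  change D.diffC h t P _ + D.diffP P _ = D.restrictCochain P S (D.diffC h t P f + D.diffP P f)
  rw [map_add, hC, diffP_restrictCochain]

instance finite_chain (r : ℕ) : Module.Finite F (D.Chain F r) :=
  inferInstanceAs (Module.Finite F (D.Gen r → F))

theorem finite_hom {X : Type*} [AddCommGroup X] [Module (GroupAlg F m) X]
    [Module.Finite (GroupAlg F m) X] (r : ℕ) :
    Module.Finite F (X →ₗ[GroupAlg F m] D.Chain F r) := by
  obtain ⟨n, x, hx⟩ := Module.Finite.exists_fin (R := GroupAlg F m) (M := X)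
  let ev : (X →ₗ[GroupAlg F m] D.Chain F r) →ₗ[F] (Fin n → D.Chain F r) :=
    { toFun := fun f i => f (x i)
      map_add' := fun _ _ => rfl
      map_smul' := fun _ _ => rfl }
  refine Module.Finite.of_injective ev fun f g hfg => ?_
  exact LinearMap.ext_on_range hx fun i => congrFun hfg i

theorem finite_degree (hP : ∀ a, Module.Finite (GroupAlg F m) (P.complex.X a)) (i : ℤ) :
    FiniteDimensional F (D.degree P i) := by
  -- In total degree `i` one has `a ≤ i + nNeg`, as `r ≥ 0`. Together with `r ≤ n` this leaves
  -- finitely many bidegrees.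
  let K := (i + D.nNeg).toNat + 1
  let ev : D.degree P i →ₗ[F] (∀ (a : Fin K) (r : Fin (D.n + 1)),
      P.complex.X a →ₗ[GroupAlg F m] D.Chain F r) :=
    { toFun := fun f a r => f.1 a r
      map_add' := fun _ _ => rfl
      map_smul' := fun _ _ => rfl }
  have (a : Fin K) (r : Fin (D.n + 1)) :
      Module.Finite F (P.complex.X a →ₗ[GroupAlg F m] D.Chain F r) :=
    have := hP a
    D.finite_hom (X := P.complex.X a) r
  refine Module.Finite.of_injective ev fun f g hfg => Subtype.ext ?_
  refine funext fun a => funext fun r => ?_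
  by_cases hr : r < D.n + 1
  · by_cases ha : a < K
    · exact congrFun (congrFun hfg ⟨a, ha⟩) ⟨r, hr⟩
    · rw [f.2 a r (by omega), g.2 a r (by omega)]
  · refine LinearMap.ext fun p => D.chain_ext fun s => ?_
    exact absurd (D.gen_le s) (by omega)

theorem isFilteredComplex (h t : F) {lo hi : ℤ} (hle : lo ≤ hi)
    (hq : ∀ r (s : D.Gen r), lo ≤ s.qdeg ∧ s.qdeg < hi)
    (hP : ∀ a, Module.Finite (GroupAlg F m) (P.complex.X a)) :
    IsFilteredComplex (D.degree P) (D.filt P) lo hi (D.diffTot h t P) where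
  finite := D.finite_degree P hP
  map_mem _ _ hx := D.diffTot_mem_degree P h t hx
  map_map := D.diffTot_diffTot P h t
  map_filt _ _ hx := D.diffTot_mem_filt P h t hx
  anti := D.filt_antitone P
  le := hle
  top := top_le_iff.1 fun _ _ _ r _ s hs => absurd (hq r s).1 (not_le.2 hs)
  bot := le_bot_iff.1 fun _ hf => D.cochain_ext P fun a r p s => hf a r p s (hq r s).2

open IsFilteredComplex

/-- Projection to the quantum degrees congruent to `a` modulo `κ` is a chain map, which feeds the
abstract criterion. The value `κ = 0` covers a differential that preserves the degree. -/
theorem pairs_eq_zero_of_not_dvd (h t : F) {lo hi κ : ℤ}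
    (C : IsFilteredComplex (D.degree P) (D.filt P) lo hi (D.diffTot h t P))
    (hκ : ∀ r (s : D.Gen r) (s' : D.Gen (r + 1)), D.dCoeff h t s s' ≠ 0 →
      κ ∣ s'.qdeg - s.qdeg) (i a b : ℤ) (hab : ¬ κ ∣ b - a) :
    pairs (D.degree P) (D.filt P) (D.diffTot h t P) i a b = 0 := by
  classical
  refine C.pairs_eq_zero_of_not_dvd (D.restrictCochain P {j | κ ∣ j - a})
    (fun _ x hx => D.restrictCochain_mem_degree P _ hx)
    (fun x => D.diffTot_restrictCochain P h t _ (fun r s s' h0 => ?_) x) ?_ ?_ hab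
  · have h1 := hκ r s s' h0
    have h2 : s'.qdeg - a = (s'.qdeg - s.qdeg) + (s.qdeg - a) := by ring
    change κ ∣ _ ↔ κ ∣ _
    rw [h2]
    exact (Int.dvd_add_right h1).symm
  · intro x hx
    constructor
    · intro a' r p s hs
      rw [restrictCochain_apply, hx a' r p s hs, ite_self]
    · intro a' r p s hs
      have h2 : ((x - D.restrictCochain P {j | κ ∣ j - a} x) a' r p : D.Gen r → F) s =
        (x a' r p : D.Gen r → F) s -
          (D.restrictCochain P {j | κ ∣ j - a} x a' r p : D.Gen r → F) s := rfl
      rw [h2, restrictCochain_apply]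
      rcases (Int.lt_add_one_iff.1 hs).lt_or_eq with h1 | h1
      · rw [hx a' r p s h1, ite_self, sub_zero]
      · rw [if_pos (by rw [h1]; simp), sub_self]
  · intro b hb x hx a' r p s hs
    rw [restrictCochain_apply]
    rcases (Int.lt_add_one_iff.1 hs).lt_or_eq with h1 | h1
    · rw [hx a' r p s h1, ite_self]
    · exact if_neg (by rw [h1]; exact hb)

theorem restrictCochain_eq_zero {k : ℤ} {x : D.Cochain P} (hx : x ∈ D.filt P k) :
    D.restrictCochain P {k} x = 0 ↔ x ∈ D.filt P (k + 1) := by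
  classical
  constructor
  · intro h0 a r p s hs
    rcases (Int.lt_add_one_iff.1 hs).lt_or_eq with h1 | h1
    · exact hx a r p s h1
    · have h2 := D.restrictCochain_apply P {k} x p s
      rw [if_pos (by exact h1), h0] at h2
      exact h2.symm
  · intro h0
    refine D.cochain_ext P fun a r p s => ?_
    rw [restrictCochain_apply]
    split_ifs with h1
    · exact h0 a r p s (by rw [Set.mem_singleton_iff.1 h1]; omega)
    · rfl

/-- On `Φ k` the part of the differential that lands in degree `k` uses only entries preserving the
degree, and these do not depend on `(h, t)`. -/
theorem restrictCochain_diffC_eq (h t : F) {k : ℤ} {x : D.Cochain P} (hx : x ∈ D.filt P k) :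
    D.restrictCochain P {k} (D.diffC h t P x) =
      D.restrictCochain P {k} (D.diffC (0 : F) 0 P x) := by
  classical
  refine D.cochain_ext P fun a r p s' => ?_
  rw [restrictCochain_apply, restrictCochain_apply]
  split_ifs with h1
  · rcases r with _ | r
    · rfl
    · rw [diffC_succ, diffC_succ, LinearMap.comp_apply, LinearMap.comp_apply, diffHom_apply,
        diffHom_apply]
      refine Finset.sum_congr rfl fun s _ => ?_
      have h1 : s'.qdeg = k := h1
      rcases lt_trichotomy s.qdeg s'.qdeg with h2 | h2 | h2
      · rw [hx a r p s (by omega), mul_zero, mul_zero]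
      · rw [GaussCode.IsPlanar.dCoeff_eq D.planar h t h2.symm]
      · have h3 : ∀ h t : F, D.dCoeff h t s s' = 0 := fun h t => by
          by_contra h0
          rcases GaussCode.IsPlanar.dCoeff_deg D.planar h t h0 with h | h | h <;> omega
        rw [h3, h3]
  · rfl

theorem restrictCochain_diffTot_eq (h t : F) {k : ℤ} {x : D.Cochain P} (hx : x ∈ D.filt P k) :
    D.restrictCochain P {k} (D.diffTot h t P x) =
      D.restrictCochain P {k} (D.diffTot (0 : F) 0 P x) := by
  rw [diffTot, diffTot, LinearMap.add_apply, LinearMap.add_apply, map_add, map_add,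
    restrictCochain_diffC_eq D P h t hx]

theorem pairs_self_eq (h t : F) {lo hi : ℤ}
    (C : IsFilteredComplex (D.degree P) (D.filt P) lo hi (D.diffTot h t P))
    (C₀ : IsFilteredComplex (D.degree P) (D.filt P) lo hi (D.diffTot (0 : F) 0 P)) (i k : ℤ) :
    pairs (D.degree P) (D.filt P) (D.diffTot h t P) i k k =
      pairs (D.degree P) (D.filt P) (D.diffTot (0 : F) 0 P) i k k := by
  rw [C.pairs_self (D.restrictCochain P {k}) i k fun _ => D.restrictCochain_eq_zero P,
    C₀.pairs_self (D.restrictCochain P {k}) i k fun _ => D.restrictCochain_eq_zero P]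
  have heq : (D.degree P (i - 1) ⊓ D.filt P k).map
      (D.restrictCochain P {k} ∘ₗ D.diffTot h t P) = (D.degree P (i - 1) ⊓ D.filt P k).map
      (D.restrictCochain P {k} ∘ₗ D.diffTot (0 : F) 0 P) := by
    ext y
    constructor
    · rintro ⟨x, hx, rfl⟩
      exact ⟨x, hx, (D.restrictCochain_diffTot_eq P h t hx.2).symm⟩
    · rintro ⟨x, hx, rfl⟩
      exact ⟨x, hx, D.restrictCochain_diffTot_eq P h t hx.2⟩
  rw [heq]

end PeriodicDiagram

section

variable {F X Y : Type*} [Field F] [AddCommGroup X] [Module F X] [AddCommGroup Y] [Module F Y]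

/-- Two linear maps that are inverse to each other on given subspaces. -/
def Submodule.equivOfInvOn (f : X →ₗ[F] Y) (g : Y →ₗ[F] X) (S : Submodule F X)
    (U : Submodule F Y) (hf : ∀ x ∈ S, f x ∈ U) (hg : ∀ y ∈ U, g y ∈ S)
    (hgf : ∀ x ∈ S, g (f x) = x) (hfg : ∀ y ∈ U, f (g y) = y) : S ≃ₗ[F] U :=
  LinearEquiv.ofLinearMap (f.restrict hf) (g.restrict hg)
    (LinearMap.ext fun y => Subtype.ext (hfg y y.2))
    (LinearMap.ext fun x => Subtype.ext (hgf x x.2))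

theorem Submodule.finrank_quotient_eq_of_invOn (f : X →ₗ[F] Y) (g : Y →ₗ[F] X)
    {S S' : Submodule F X} {U U' : Submodule F Y} (hf : ∀ x ∈ S, f x ∈ U)
    (hg : ∀ y ∈ U, g y ∈ S) (hf' : ∀ x ∈ S', f x ∈ U') (hg' : ∀ y ∈ U', g y ∈ S')
    (hgf : ∀ x ∈ S, g (f x) = x) (hfg : ∀ y ∈ U, f (g y) = y) :
    Module.finrank F (S ⧸ S'.submoduleOf S) = Module.finrank F (U ⧸ U'.submoduleOf U) := by
  refine (Submodule.Quotient.equiv _ _ (Submodule.equivOfInvOn f g S U hf hg hgf hfg) ?_).finrank_eq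
  ext y
  constructor
  · rintro ⟨x, hx, rfl⟩
    exact hf' x hx
  · intro hy
    exact ⟨⟨g y, hg y y.2⟩, hg' y hy, Subtype.ext (hfg y y.2)⟩

end

namespace PeriodicDiagram

variable {m : ℕ} {F : Type u} [Field F] (D : PeriodicDiagram m)
  {M : ModuleCat.{u} (GroupAlg F m)} {P Q : ProjectiveResolution M}

/-! ## Independence of the resolution -/

/-- The map of cochains induced by a chain map of resolutions. -/
noncomputable def precomp (φ : P.complex ⟶ Q.complex) : D.Cochain Q →ₗ[F] D.Cochain P where
  toFun f := fun a r => f a r ∘ₗ (φ.f a).hom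
  map_add' _ _ := rfl
  map_smul' _ _ := rfl

theorem precomp_apply (φ : P.complex ⟶ Q.complex) (f : D.Cochain Q) (a r : ℕ) :
    D.precomp φ f a r = f a r ∘ₗ (φ.f a).hom := rfl

theorem diffTot_precomp (h t : F) (φ : P.complex ⟶ Q.complex) (f : D.Cochain Q) :
    D.diffTot h t P (D.precomp φ f) = D.precomp φ (D.diffTot h t Q f) := by
  have hC : D.diffC h t P (D.precomp φ f) = D.precomp φ (D.diffC h t Q f) := by
    refine funext fun a => funext fun r => ?_
    rcases r with _ | r
    · exact (LinearMap.zero_comp _).symm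
    · rfl
  have hP : D.diffP P (D.precomp φ f) = D.precomp φ (D.diffP Q f) := by
    refine funext fun a => funext fun r => ?_
    rcases a with _ | a
    · exact (LinearMap.zero_comp _).symm
    · rw [diffP_succ, precomp_apply, precomp_apply, diffP_succ, LinearMap.smul_comp,
        LinearMap.comp_assoc, LinearMap.comp_assoc, ← ModuleCat.hom_comp, ← ModuleCat.hom_comp,
        φ.comm]
  rw [diffTot, diffTot, LinearMap.add_apply, LinearMap.add_apply, map_add, hC, hP]

theorem precomp_mem_degree (φ : P.complex ⟶ Q.complex) {i : ℤ} {f : D.Cochain Q}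
    (hf : f ∈ D.degree Q i) : D.precomp φ f ∈ D.degree P i := by
  intro a r har
  rw [precomp_apply, hf a r har, LinearMap.zero_comp]

theorem precomp_mem_filt (φ : P.complex ⟶ Q.complex) {k : ℤ} {f : D.Cochain Q}
    (hf : f ∈ D.filt Q k) : D.precomp φ f ∈ D.filt P k :=
  fun a r _ s hs => hf a r _ s hs

theorem precomp_mem_cocycles (h t : F) (φ : P.complex ⟶ Q.complex) {i : ℤ} {f : D.Cochain Q}
    (hf : f ∈ D.cocycles h t Q i) : D.precomp φ f ∈ D.cocycles h t P i := by
  refine ⟨?_, D.precomp_mem_degree φ hf.2⟩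
  have h1 : D.diffTot h t Q f = 0 := hf.1
  change D.diffTot h t P (D.precomp φ f) = 0
  rw [diffTot_precomp, h1, map_zero]

theorem precomp_mem_coboundaries (h t : F) (φ : P.complex ⟶ Q.complex) (i : ℤ) :
    D.coboundaries h t Q i ≤ (D.coboundaries h t P i).comap (D.precomp φ) := by
  rintro _ ⟨f, hf, rfl⟩
  exact ⟨_, D.precomp_mem_degree φ hf, D.diffTot_precomp h t φ f⟩

/-- A homotopy of resolutions, composed into a cocycle, gives the required primitive. Only the
equality of classes is needed, so no filtration degree of the primitive is recorded. -/
theorem precomp_sub_mem_coboundaries (h t : F) {φ : P.complex ⟶ Q.complex}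
    {ψ : Q.complex ⟶ P.complex} (H : Homotopy (φ ≫ ψ) (𝟙 P.complex)) {i : ℤ} {f : D.Cochain P}
    (hf : f ∈ D.cocycles h t P i) :
    D.precomp φ (D.precomp ψ f) - f ∈ D.coboundaries h t P i := by
  -- The sign `(-1) ^ r` cancels the one in `diffP`.
  let K : D.Cochain P := fun a r => (-1 : F) ^ r • (f (a + 1) r ∘ₗ (H.hom a (a + 1)).hom)
  refine ⟨K, ?_, ?_⟩
  · intro a r har
    change (-1 : F) ^ r • (f (a + 1) r ∘ₗ (H.hom a (a + 1)).hom) = 0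
    rw [hf.2 (a + 1) r (by push_cast; omega), LinearMap.zero_comp, smul_zero]
  · refine funext fun a => funext fun r => ?_
    have hsq : ∀ r : ℕ, (-1 : F) ^ r * (-1) ^ r = 1 := fun r => by
      rw [← mul_pow, neg_one_mul, neg_neg, one_pow]
    have hcyc : ∀ a r, D.diffC h t P f a r + D.diffP P f a r = 0 := fun a r =>
      congrFun (congrFun (LinearMap.mem_ker.1 hf.1) a) r
    have h1 : D.diffC h t P K a r = f a r ∘ₗ
        (H.hom a (a + 1) ≫ P.complex.d (a + 1) a).hom := by
      have h2 : D.diffC h t P K a r = (-1 : F) ^ (r + 1) •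
          (D.diffC h t P f (a + 1) r ∘ₗ (H.hom a (a + 1)).hom) := by
        rcases r with _ | r
        · rw [diffC_zero, diffC_zero, LinearMap.zero_comp, smul_zero]
        · rw [diffC_succ, diffC_succ, pow_succ, pow_succ, mul_assoc, neg_one_mul, neg_neg, mul_one]
          exact LinearMap.ext fun p => (D.diff h t r).map_smul _ _
      -- The cocycle condition trades the Khovanov part of the differential of `f` for minus the
      -- resolution part, which supplies the second term of the homotopy formula.
      rw [h2, eq_neg_of_add_eq_zero_left (hcyc (a + 1) r), diffP_succ, LinearMap.neg_comp,
        LinearMap.smul_comp, smul_neg, smul_smul, pow_succ, mul_neg_one, neg_mul, hsq, neg_smul,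
        neg_neg, one_smul, LinearMap.comp_assoc, ModuleCat.hom_comp]
    have h3 : D.diffP P K a r = f a r ∘ₗ (dNext a H.hom).hom := by
      rcases a with _ | a
      · rw [diffP_zero, Homotopy.dNext_zero_chainComplex, ModuleCat.hom_zero, LinearMap.comp_zero]
      · rw [diffP_succ, Homotopy.dNext_succ_chainComplex, ModuleCat.hom_comp, LinearMap.smul_comp,
          smul_smul, hsq, one_smul, LinearMap.comp_assoc]
    change D.diffC h t P K a r + D.diffP P K a r =
      (f a r ∘ₗ (ψ.f a).hom) ∘ₗ (φ.f a).hom - f a r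
    have h4 := H.comm a
    rw [HomologicalComplex.comp_f, HomologicalComplex.id_f, Homotopy.prevD_chainComplex] at h4
    rw [h1, h3, LinearMap.comp_assoc, ← ModuleCat.hom_comp, h4, ModuleCat.hom_add,
      ModuleCat.hom_add, LinearMap.comp_add, LinearMap.comp_add, ModuleCat.hom_id,
      LinearMap.comp_id, add_sub_cancel_right, add_comm]

/-- The map of the quotients by the coboundaries induced by a chain map of resolutions. -/
noncomputable def precompQ (h t : F) (φ : P.complex ⟶ Q.complex) (i : ℤ) :
    (D.Cochain Q ⧸ D.coboundaries h t Q i) →ₗ[F] (D.Cochain P ⧸ D.coboundaries h t P i) :=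
  Submodule.mapQ _ _ (D.precomp φ) (D.precomp_mem_coboundaries h t φ i)

theorem precompQ_mem_EH (h t : F) (φ : P.complex ⟶ Q.complex) (i : ℤ) :
    ∀ x ∈ D.EH h t Q i, D.precompQ h t φ i x ∈ D.EH h t P i := by
  rintro _ ⟨f, hf, rfl⟩
  exact ⟨_, D.precomp_mem_cocycles h t φ hf, rfl⟩

theorem precompQ_mem_filtEH (h t : F) (φ : P.complex ⟶ Q.complex) (i k : ℤ) :
    ∀ x ∈ D.filtEH h t Q i k, D.precompQ h t φ i x ∈ D.filtEH h t P i k := by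
  rintro _ ⟨f, hf, rfl⟩
  exact ⟨_, ⟨D.precomp_mem_cocycles h t φ hf.1, D.precomp_mem_filt φ hf.2⟩, rfl⟩

theorem filtEH_le_EH (h t : F) (P : ProjectiveResolution M) (i k : ℤ) :
    D.filtEH h t P i k ≤ D.EH h t P i := Submodule.map_mono inf_le_left

theorem precompQ_precompQ (h t : F) {φ : P.complex ⟶ Q.complex}
    {ψ : Q.complex ⟶ P.complex} (H : Homotopy (φ ≫ ψ) (𝟙 P.complex)) (i : ℤ) :
    ∀ x ∈ D.EH h t P i, D.precompQ h t φ i (D.precompQ h t ψ i x) = x := by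
  rintro _ ⟨f, hf, rfl⟩
  exact (Submodule.Quotient.eq _).2 (D.precomp_sub_mem_coboundaries h t H hf)

variable (P Q)

theorem finiteDimensional_EH_of_resolution (h t : F) (i : ℤ)
    (hQ : FiniteDimensional F (D.EH h t Q i)) : FiniteDimensional F (D.EH h t P i) :=
  let E := ProjectiveResolution.homotopyEquiv P Q
  (Submodule.equivOfInvOn (D.precompQ h t E.hom i) (D.precompQ h t E.inv i) _ _
    (D.precompQ_mem_EH h t E.hom i) (D.precompQ_mem_EH h t E.inv i)
    (D.precompQ_precompQ h t E.homotopyInvHomId i)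
    (D.precompQ_precompQ h t E.homotopyHomInvId i)).finiteDimensional

/-- Precomposition does not change the chain groups in which the values lie, so both comparison maps
preserve the quantum filtration. Being mutually inverse on cohomology, they identify every
filtration step. -/
theorem finrank_GrEH_eq (h t : F) (i k : ℤ) :
    Module.finrank F (D.GrEH h t P i k) = Module.finrank F (D.GrEH h t Q i k) :=
  let E := ProjectiveResolution.homotopyEquiv P Q
  Submodule.finrank_quotient_eq_of_invOn (D.precompQ h t E.inv i) (D.precompQ h t E.hom i)
    (D.precompQ_mem_filtEH h t E.inv i k) (D.precompQ_mem_filtEH h t E.hom i k)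
    (D.precompQ_mem_filtEH h t E.inv i (k + 1)) (D.precompQ_mem_filtEH h t E.hom i (k + 1))
    (fun x hx => D.precompQ_precompQ h t E.homotopyHomInvId i x (D.filtEH_le_EH h t P i k hx))
    (fun x hx => D.precompQ_precompQ h t E.homotopyInvHomId i x (D.filtEH_le_EH h t Q i k hx))

theorem polynomial_eq (h t : F) : D.polynomial h t P = D.polynomial h t Q := by
  refine HahnSeries.ext (funext fun i => ?_)
  change ∑ᶠ k : ℤ, _ = ∑ᶠ k : ℤ, _
  simp only [D.finrank_GrEH_eq P Q]

end PeriodicDiagram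

/-! ## Finitely generated resolutions -/

namespace FGModuleCat

variable {R : Type u} [CommRing R] [IsNoetherianRing R]

theorem exists_free_epi (X : FGModuleCat.{u} R) : ∃ (Y : FGModuleCat.{u} R) (f : Y ⟶ X),
    Epi f ∧ Projective Y ∧ Projective ((forget₂ (FGModuleCat.{u} R) (ModuleCat.{u} R)).obj Y) := by
  obtain ⟨n, f, hf⟩ := Module.Finite.exists_fin' R X
  have hP : Projective ((forget₂ (FGModuleCat.{u} R) (ModuleCat.{u} R)).obj
      (FGModuleCat.of R (Fin n → R))) :=
    inferInstanceAs (Projective (ModuleCat.of R (Fin n → R)))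
  refine ⟨FGModuleCat.of R (Fin n → R), FGModuleCat.ofHom f, ?_,
    Functor.projective_of_map_projective _ hP, hP⟩
  have : Epi ((forget₂ (FGModuleCat.{u} R) (ModuleCat.{u} R)).map (FGModuleCat.ofHom f)) :=
    (ModuleCat.epi_iff_surjective _).2 hf
  exact (forget₂ (FGModuleCat.{u} R) (ModuleCat.{u} R)).epi_of_epi_map this

instance : EnoughProjectives (FGModuleCat.{u} R) where
  presentation X := by
    obtain ⟨Y, f, h1, h2, -⟩ := exists_free_epi X
    exact ⟨⟨Y, f⟩⟩

instance : (forget₂ (FGModuleCat.{u} R) (ModuleCat.{u} R)).PreservesProjectiveObjects where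
  projective_obj {X} hX := by
    obtain ⟨Y, f, h1, -, h3⟩ := exists_free_epi X
    -- A projective object is a retract of a finite free module, and retracts of projectives are
    -- projective.
    have h4 : Retract X Y := ⟨Projective.factorThru (𝟙 X) f, f, Projective.factorThru_comp _ _⟩
    exact (h4.map (forget₂ (FGModuleCat.{u} R) (ModuleCat.{u} R))).projective

end FGModuleCat

theorem ModuleCat.exists_finite_projectiveResolution {R : Type u} [CommRing R]
    [IsNoetherianRing R] (M : ModuleCat.{u} R) [Module.Finite R M] :
    ∃ Q : ProjectiveResolution M, ∀ a, Module.Finite R (Q.complex.X a) :=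
  ⟨(forget₂ (FGModuleCat.{u} R) (ModuleCat.{u} R)).mapProjectiveResolution
    (ProjectiveResolution.of (FGModuleCat.of R M)), fun a =>
    inferInstanceAs (Module.Finite R ((ProjectiveResolution.of (FGModuleCat.of R M)).complex.X a))⟩

namespace PeriodicDiagram

theorem finite_groupAlg (F : Type u) [Field F] {m : ℕ} (hm : m ≠ 0) :
    Module.Finite F (GroupAlg F m) :=
  have : NeZero m := ⟨hm⟩
  inferInstance

/-- Maschke's theorem: the group algebra is semisimple when the group order is invertible. -/
theorem projective_of_ne_zero {F : Type u} [Field F] {m : ℕ} (hm : (m : F) ≠ 0)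
    (M : ModuleCat.{u} (GroupAlg F m)) : Projective M := by
  have : NeZero m := ⟨fun h => hm (by simp [h])⟩
  have : NeZero (Nat.card (Multiplicative (ZMod m)) : F) := ⟨by
    rw [Nat.card_eq_fintype_card, Fintype.card_multiplicative, ZMod.card]
    exact hm⟩
  have : Module.Projective (GroupAlg F m) M := Module.projective_of_isSemisimpleRing _ _
  exact inferInstance

/-- If `m` is invertible, the resolution is `M` itself in degree 0, and the equivariant complex
becomes `Hom(M, C)`. Otherwise the group algebra is noetherian and finite free covers are iterated.
-/
theorem exists_finite_projectiveResolution {F : Type u} [Field F] {m : ℕ} (hm : m ≠ 0)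
    (M : ModuleCat.{u} (GroupAlg F m)) [Module.Finite (GroupAlg F m) M] :
    ∃ Q : ProjectiveResolution M, (∀ a, Module.Finite (GroupAlg F m) (Q.complex.X a)) ∧
      ((m : F) ≠ 0 → ∀ a, a ≠ 0 → Subsingleton (Q.complex.X a)) := by
  by_cases h : (m : F) = 0
  · have := finite_groupAlg F hm
    have : IsNoetherianRing (GroupAlg F m) := IsNoetherianRing.of_finite F _
    obtain ⟨Q, hQ⟩ := ModuleCat.exists_finite_projectiveResolution M
    exact ⟨Q, hQ, fun h' => absurd h h'⟩
  · have := projective_of_ne_zero h M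
    have h0 : ∀ a, a ≠ 0 → Subsingleton ((ProjectiveResolution.self M).complex.X a) := fun a ha =>
      ModuleCat.subsingleton_of_isZero
        (HomologicalComplex.isZero_single_obj_X (ComplexShape.down ℕ) 0 M a ha)
    refine ⟨ProjectiveResolution.self M, fun a => ?_, fun _ => h0⟩
    rcases a with _ | a
    · have e := (HomologicalComplex.singleObjXSelf (ComplexShape.down ℕ) 0 M).toLinearEquiv
      exact Module.Finite.equiv e.symm
    · have := h0 (a + 1) a.succ_ne_zero
      infer_instance

end PeriodicDiagram

/-! ### Generating functions of cancelled pairs -/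

namespace IsFilteredComplex

variable {F V : Type*} [Field F] [AddCommGroup V] [Module F V]
  {T Φ : ℤ → Submodule F V} {lo hi : ℤ} {d : V →ₗ[F] V}

theorem grRank_eq_zero (C : IsFilteredComplex T Φ lo hi d) {i k : ℤ}
    (h : ¬ (lo ≤ k ∧ k < hi)) : grRank T Φ d i k = 0 := by
  have h1 := C.finrank_gr_cohomology i k
  have h2 : Φ k = Φ (k + 1) := by
    by_cases h3 : k < lo
    · rw [C.eq_top_of_le h3.le, C.eq_top_of_le (by omega)]
    · rw [C.eq_bot_of_le (by omega : hi ≤ k), C.eq_bot_of_le (by omega : hi ≤ k + 1)]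
  rw [h2, sub_self] at h1
  have h3 : 0 ≤ ∑ a ∈ Finset.Ico lo hi, (pairs T Φ d i a k : ℤ) :=
    Finset.sum_nonneg fun _ _ => Int.natCast_nonneg _
  have h4 : 0 ≤ ∑ b ∈ Finset.Ico lo hi, (pairs T Φ d (i + 1) k b : ℤ) :=
    Finset.sum_nonneg fun _ _ => Int.natCast_nonneg _
  omega

theorem pairs_eq_zero_of_eq_bot (C : IsFilteredComplex T Φ lo hi d) {i : ℤ} (h : T (i - 1) = ⊥)
    (a b : ℤ) : pairs T Φ d i a b = 0 := by
  refine C.pairs_eq_zero i a b ?_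
  rw [bdry, h, bot_inf_eq, Submodule.map_bot, bot_inf_eq]
  exact bot_le

variable (T Φ lo hi d) in
/-- The generating function of the pairs whose filtration degrees differ by `v`. -/
noncomputable def pairsPoly (v i : ℤ) : LaurentPolynomial ℕ :=
  ∑ a ∈ Finset.Ico lo hi, pairs T Φ d i a (a + v) • LaurentPolynomial.T a

/-- `pairsPoly` records the source degree of each pair. Counting the same pairs by their target
degree multiplies it by `T v`, which produces the factor `q^v`. -/
theorem sum_pairs_smul_T (C : IsFilteredComplex T Φ lo hi d) (v i : ℤ) :
    ∑ k ∈ Finset.Ico lo hi, pairs T Φ d i (k - v) k • (LaurentPolynomial.T k : LaurentPolynomial ℕ) =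
      LaurentPolynomial.T v * pairsPoly T Φ lo hi d v i := by
  rw [pairsPoly, Finset.mul_sum]
  have hne : ∀ {n : ℕ} {x : LaurentPolynomial ℕ}, n • x ≠ 0 → n ≠ 0 := fun h h0 =>
    h (by rw [h0, zero_smul])
  refine Finset.sum_bij_ne_zero (fun k _ _ => k - v) ?_ ?_ ?_ ?_
  · intro k _ h
    have h1 := mt C.pairs_eq_zero_of_not_mem (hne h)
    rw [not_not] at h1
    exact Finset.mem_Ico.2 ⟨h1.1, h1.2.1⟩
  · intro k _ _ l _ _ h
    exact sub_left_injective h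
  · intro a _ h
    rw [mul_smul_comm] at h
    have h1 := mt C.pairs_eq_zero_of_not_mem (hne h)
    rw [not_not] at h1
    refine ⟨a + v, Finset.mem_Ico.2 h1.2.2, ?_, add_sub_cancel_right a v⟩
    rwa [add_sub_cancel_right, add_comm a v, LaurentPolynomial.T_add, add_comm v a]
  · intro k _ _
    rw [mul_smul_comm, ← LaurentPolynomial.T_add, add_sub_cancel, sub_add_cancel]

theorem sum_grRank_smul_T (C : IsFilteredComplex T Φ lo hi d) {d₀ : V →ₗ[F] V}
    (C₀ : IsFilteredComplex T Φ lo hi d₀) {κ : ℤ}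
    (hκ : 0 < κ) (hdvd : ∀ i a b, ¬ κ ∣ b - a → pairs T Φ d i a b = 0)
    (hdvd₀ : ∀ i a b, a ≠ b → pairs T Φ d₀ i a b = 0)
    (hself : ∀ i k, pairs T Φ d i k k = pairs T Φ d₀ i k k) {N : ℕ} (hN : hi - lo ≤ N) (i : ℤ) :
    ∑ᶠ k : ℤ, grRank T Φ d₀ i k • (LaurentPolynomial.T k : LaurentPolynomial ℕ) =
      ∑ᶠ k : ℤ, grRank T Φ d i k • (LaurentPolynomial.T k : LaurentPolynomial ℕ) +
        ∑ u ∈ Finset.Icc 1 N, (pairsPoly T Φ lo hi d (κ * u) (i + 1) +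
          LaurentPolynomial.T (κ * u) * pairsPoly T Φ lo hi d (κ * u) i) := by
  have hsupp : ∀ {d : V →ₗ[F] V}, IsFilteredComplex T Φ lo hi d →
      ∑ᶠ k : ℤ, grRank T Φ d i k • (LaurentPolynomial.T k : LaurentPolynomial ℕ) =
        ∑ k ∈ Finset.Ico lo hi, grRank T Φ d i k • LaurentPolynomial.T k := fun C => by
    refine finsum_eq_sum_of_support_subset _ fun k hk => ?_
    rw [Finset.coe_Ico, Set.mem_Ico]
    by_contra h
    exact hk (by simp [C.grRank_eq_zero h])
  rw [hsupp C, hsupp C₀, Finset.sum_congr rfl fun k _ => congrArg (· • LaurentPolynomial.T k)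
    (C.grRank_comparison C₀ hκ hdvd hdvd₀ hself hN i k)]
  simp only [add_smul, Finset.sum_smul, Finset.sum_add_distrib]
  congr 1
  rw [Finset.sum_comm, Finset.sum_comm (s := Finset.Ico lo hi)]
  congr 1
  exact Finset.sum_congr rfl fun u _ => C.sum_pairs_smul_T _ i

end IsFilteredComplex

namespace PeriodicDiagram

open IsFilteredComplex

variable {m : ℕ} {F : Type u} [Field F] (D : PeriodicDiagram m)
  {M : ModuleCat.{u} (GroupAlg F m)} (Q : ProjectiveResolution M)

theorem degree_eq_bot_of_lt {i : ℤ} (hi : i < -(D.nNeg : ℤ)) : D.degree Q i = ⊥ :=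
  le_bot_iff.1 fun _ hf => funext fun a => funext fun r => hf a r (by omega)

theorem degree_eq_bot_of_gt (hQ : ∀ a, a ≠ 0 → Subsingleton (Q.complex.X a)) {i : ℤ}
    (hi : (D.n : ℤ) - D.nNeg < i) : D.degree Q i = ⊥ := by
  refine le_bot_iff.1 fun f hf => D.cochain_ext Q fun a r p s => ?_
  rcases a with _ | a
  · have := D.gen_le s
    rw [hf 0 r (by push_cast; omega)]
    rfl
  · have := hQ (a + 1) a.succ_ne_zero
    rw [Subsingleton.elim p 0, map_zero]
    rfl

/-! ## Projective coefficients -/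

theorem dCoeff_qdeg_eq {r : ℕ} {s : D.Gen r} {s' : D.Gen (r + 1)}
    (h0 : D.dCoeff (0 : F) 0 s s' ≠ 0) : s'.qdeg = s.qdeg := by
  rcases GaussCode.IsPlanar.dCoeff_deg D.planar _ _ h0 with h | ⟨-, h⟩ | ⟨-, h⟩
  · exact h
  · exact absurd rfl h
  · exact absurd rfl h

/-- With the resolution concentrated in degree 0, a cocycle is an equivariant map from a projective
module into the cycles. If the Khovanov group vanishes, its values are boundaries, and projectivity
lifts the map through `d` equivariantly. -/
theorem mem_coboundaries_of_not_nontrivial (hQ : ∀ a, a ≠ 0 → Subsingleton (Q.complex.X a))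
    {i k : ℤ} (hK : ¬ Nontrivial (D.Kh F i k)) {f : D.Cochain Q}
    (hf : f ∈ D.cocycles (0 : F) 0 Q i) (hfk : ∀ a r p (s : D.Gen r),
      (f a r p : D.Gen r → F) s ≠ 0 → s.qdeg = k) : f ∈ D.coboundaries (0 : F) 0 Q i := by
  rw [GaussCode.nontrivial_Kh_iff, not_not] at hK
  have hval : ∀ (r : ℕ) (p : Q.complex.X 0) (y : D.Gen r → F), f 0 r p = y →
      (r : ℤ) - D.nNeg = i → ∃ z ∈ D.bidegree F (i - 1) k, D.diffAll (0 : F) 0 z =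
        Pi.single (M := fun r => D.Gen r → F) r y := by
    intro r p y hy hr
    refine hK ⟨?_, ?_⟩
    · refine funext fun r' => ?_
      rcases r' with _ | r'
      · rfl
      · change D.diff (0 : F) 0 r' (Pi.single (M := fun r => D.Gen r → F) r y r') = 0
        by_cases h : r' = r
        · subst h
          rw [Pi.single_eq_same]
          have h1 := congrFun (congrFun (LinearMap.mem_ker.1 hf.1) 0) (r' + 1)
          change D.diffC (0 : F) 0 Q f 0 (r' + 1) + D.diffP Q f 0 (r' + 1) = 0 at h1
          rw [diffP_zero, add_zero, diffC_succ] at h1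
          rw [← hy]
          exact LinearMap.congr_fun h1 p
        · rw [Pi.single_eq_of_ne h, map_zero]
    · intro r' s hs
      by_cases h : r' = r
      · subst h
        rw [Pi.single_eq_same, ← hy] at hs
        exact ⟨hr, hfk 0 r' p s hs⟩
      · rw [Pi.single_eq_of_ne h] at hs
        exact absurd rfl hs
  have hzero : (∀ r : ℕ, (r : ℤ) - D.nNeg = i → f 0 r = 0) → f ∈ D.coboundaries (0 : F) 0 Q i := by
    intro h
    have : f = 0 := by
      refine funext fun a => funext fun r => ?_
      by_cases har : (a : ℤ) + (r - D.nNeg) = i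
      · rcases a with _ | a
        · exact h r (by push_cast at har; omega)
        · have := hQ (a + 1) a.succ_ne_zero
          exact LinearMap.ext fun p => by rw [Subsingleton.elim p 0, map_zero, map_zero]
      · exact hf.2 a r har
    rw [this]
    exact Submodule.zero_mem _
  by_cases hr0 : ∃ r : ℕ, ((r + 1 : ℕ) : ℤ) - D.nNeg = i
  · obtain ⟨r, hr⟩ := hr0
    have hrange : ∀ p, f 0 (r + 1) p ∈ LinearMap.range (D.diffHom (0 : F) 0 r) := by
      intro p
      obtain ⟨z, -, hz⟩ := hval (r + 1) p _ rfl hr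
      have h1 := (congrFun hz (r + 1)).trans
        (Pi.single_eq_same (M := fun r => D.Gen r → F) _ _)
      exact ⟨z r, h1⟩
    have hproj := Q.projective 0
    have : Module.Projective (GroupAlg F m) (Q.complex.X 0) := inferInstance
    -- Choosing a preimage of each value would not be equivariant; the lift comes from projectivity,
    -- applied to the surjection of `d` onto its range.
    obtain ⟨v, hv⟩ := Module.projective_lifting_property
      (D.diffHom (0 : F) 0 r).rangeRestrict ((f 0 (r + 1)).codRestrict _ hrange)
      (D.diffHom (0 : F) 0 r).surjective_rangeRestrict
    have hv' : D.diffHom (0 : F) 0 r ∘ₗ v = f 0 (r + 1) := LinearMap.ext fun p =>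
      congrArg Subtype.val (LinearMap.congr_fun hv p)
    let U : D.Cochain Q := Pi.single
      (M := fun a => ∀ r : ℕ, Q.complex.X a →ₗ[GroupAlg F m] D.Chain F r) 0 (Pi.single r v)
    have hU : ∀ a r', a ≠ 0 ∨ r' ≠ r → U a r' = 0 := by
      intro a r' h
      by_cases ha : a = 0
      · subst ha
        have h1 : U 0 = Pi.single r v := Pi.single_eq_same _ _
        rw [h1, Pi.single_eq_of_ne (by tauto)]
      · have h1 : U a = 0 := Pi.single_eq_of_ne ha _
        rw [h1]
        rfl
    have hU0 : U 0 r = v := by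
      have h1 : U 0 = Pi.single r v := Pi.single_eq_same _ _
      rw [h1, Pi.single_eq_same]
    refine ⟨U, fun a r' har => hU a r' ?_, ?_⟩
    · by_contra h
      push Not at h
      rw [h.1, h.2] at har
      push_cast at har hr
      omega
    · refine funext fun a => funext fun r' => ?_
      rcases a with _ | a
      · change D.diffC (0 : F) 0 Q U 0 r' + D.diffP Q U 0 r' = _
        rw [diffP_zero, add_zero]
        rcases r' with _ | r'
        · rw [diffC_zero, hf.2 0 0 (by push_cast at hr ⊢; omega)]
        · rw [diffC_succ]
          by_cases h : r' = r
          · rw [h, hU0, hv']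
          · rw [hU 0 r' (Or.inr h), LinearMap.comp_zero,
              hf.2 0 (r' + 1) (by push_cast at hr ⊢; omega)]
      · have := hQ (a + 1) a.succ_ne_zero
        exact LinearMap.ext fun p => by rw [Subsingleton.elim p 0, map_zero, map_zero]
  · refine hzero fun r hr => ?_
    rcases r with _ | r
    · refine LinearMap.ext fun p => ?_
      obtain ⟨z, -, hz⟩ := hval 0 p _ rfl hr
      have h1 := (congrFun hz 0).trans (Pi.single_eq_same (M := fun r => D.Gen r → F) _ _)
      exact h1.symm
    · exact absurd ⟨r, hr⟩ hr0

/-- The Khovanov differential preserves the quantum degree, so the degree-`k` part of a cocycle is a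
cocycle. If it is a coboundary, subtracting it moves the class into step `k + 1`. -/
theorem nontrivial_Kh_of_grEH (hQ : ∀ a, a ≠ 0 → Subsingleton (Q.complex.X a))
    {i k : ℤ} (hG : Module.finrank F (D.GrEH (0 : F) 0 Q i k) ≠ 0) : Nontrivial (D.Kh F i k) := by
  classical
  by_contra hK
  refine hG ?_
  suffices h : D.filtEH (0 : F) 0 Q i k ≤ D.filtEH (0 : F) 0 Q i (k + 1) by
    have : Subsingleton (D.GrEH (0 : F) 0 Q i k) :=
      Submodule.Quotient.subsingleton_iff.2 (Submodule.submoduleOf_eq_top.2 h)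
    exact Module.finrank_zero_of_subsingleton
  rintro _ ⟨f, ⟨hf, hfk⟩, rfl⟩
  have hcomm := D.diffTot_restrictCochain Q (0 : F) 0 {k} fun r s s' h0 => by
    rw [D.dCoeff_qdeg_eq h0]
  have hg : D.restrictCochain Q {k} f ∈ D.cocycles (0 : F) 0 Q i := by
    have h1 : D.diffTot (0 : F) 0 Q f = 0 := hf.1
    refine ⟨?_, D.restrictCochain_mem_degree Q _ hf.2⟩
    change D.diffTot (0 : F) 0 Q _ = 0
    rw [hcomm, h1, map_zero]
  have hb := D.mem_coboundaries_of_not_nontrivial Q hQ hK hg fun a r p s hs => by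
    by_contra h
    rw [restrictCochain_apply] at hs
    exact hs (if_neg h)
  refine ⟨f - D.restrictCochain Q {k} f, ⟨Submodule.sub_mem _ hf hg, ?_⟩, ?_⟩
  · intro a r p s hs
    have h2 : ((f - D.restrictCochain Q {k} f) a r p : D.Gen r → F) s =
      (f a r p : D.Gen r → F) s - (D.restrictCochain Q {k} f a r p : D.Gen r → F) s := rfl
    rw [h2, restrictCochain_apply]
    rcases (Int.lt_add_one_iff.1 hs).lt_or_eq with h1 | h1
    · rw [hfk a r p s h1, ite_self, sub_zero]
    · rw [if_pos (by exact h1), sub_self]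
  · rw [map_sub, sub_eq_self]
    exact (Submodule.Quotient.mk_eq_zero _).2 hb

/-! ## The comparison of the polynomials -/

theorem grRank_eq (h t : F) (i k : ℤ) :
    grRank (D.degree Q) (D.filt Q) (D.diffTot h t Q) i k =
      Module.finrank F (D.GrEH h t Q i k) := rfl

/-- The common core of both characteristics: only the divisibility `κ` of the degree jumps enters.
The last clause gives the two Khovanov groups from which the width bounds follow. -/
theorem polynomial_comparison (hm : m ≠ 0) (h t : F) {κ : ℤ} (hκ : 0 < κ)
    (hdeg : ∀ r (s : D.Gen r) (s' : D.Gen (r + 1)), D.dCoeff h t s s' ≠ 0 → κ ∣ s'.qdeg - s.qdeg)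
    [Module.Finite (GroupAlg F m) M] (P : ProjectiveResolution M) :
    (∀ i, FiniteDimensional F (D.EH (0 : F) 0 P i)) ∧
    (∀ i, FiniteDimensional F (D.EH h t P i)) ∧
    ∃ (N : ℕ) (R : ℕ → LaurentSeries (LaurentPolynomial ℕ)),
      (∀ u, N < u → R u = 0) ∧
      D.polynomial (0 : F) 0 P = D.polynomial h t P +
        ∑ u ∈ Finset.Icc 1 N,
          (1 + HahnSeries.single (1 : ℤ) (LaurentPolynomial.T (κ * (u : ℤ)))) * R u ∧
      ((m : F) ≠ 0 →
        (∀ u, 1 ≤ u → (R u).support.Finite) ∧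
        ∀ u, 1 ≤ u → R u ≠ 0 →
          ∃ i a, Nontrivial (D.Kh F i a) ∧ Nontrivial (D.Kh F (i + 1) (a + κ * u))) := by
  obtain ⟨Q, hQ, hQ0⟩ := exists_finite_projectiveResolution hm M
  obtain ⟨lo, hi, hle, hq⟩ := D.exists_qdeg_bounds
  have C := D.isFilteredComplex Q h t hle hq hQ
  have C₀ := D.isFilteredComplex Q (0 : F) 0 hle hq hQ
  have hfin : ∀ (h t : F) i, FiniteDimensional F (D.EH h t P i) := fun h t i => by
    refine D.finiteDimensional_EH_of_resolution P Q h t i ?_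
    have := D.finite_degree Q hQ i
    have : FiniteDimensional F (D.cocycles h t Q i) :=
      Submodule.finiteDimensional_of_le inf_le_right
    exact Module.Finite.map (D.cocycles h t Q i) (D.coboundaries h t Q i).mkQ
  have hdvd : ∀ i a b, ¬ κ ∣ b - a →
      pairs (D.degree Q) (D.filt Q) (D.diffTot h t Q) i a b = 0 :=
    fun i a b => D.pairs_eq_zero_of_not_dvd Q h t C hdeg i a b
  have hdvd₀ : ∀ i a b, a ≠ b →
      pairs (D.degree Q) (D.filt Q) (D.diffTot (0 : F) 0 Q) i a b = 0 := fun i a b hab =>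
    -- Divisibility by `κ = 0` means equality of the degrees.
    D.pairs_eq_zero_of_not_dvd Q 0 0 C₀ (κ := 0)
      (fun r s s' h0 => by rw [D.dCoeff_qdeg_eq h0, sub_self]) i a b
      (by rw [zero_dvd_iff]; omega)
  have hself := D.pairs_self_eq Q h t C C₀
  obtain ⟨N, hN⟩ : ∃ N : ℕ, hi - lo ≤ N := ⟨(hi - lo).toNat, Int.self_le_toNat _⟩
  let c : ℤ → ℤ → LaurentPolynomial ℕ :=
    pairsPoly (D.degree Q) (D.filt Q) lo hi (D.diffTot h t Q)
  have hc0 : ∀ v i, D.degree Q i = ⊥ → c v (i + 1) = 0 := fun v i hi =>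
    Finset.sum_eq_zero fun a _ => by
      rw [C.pairs_eq_zero_of_eq_bot (by rw [add_sub_cancel_right, hi]), zero_smul]
  have hbdd : ∀ u : ℕ, BddBelow (Function.support fun i : ℤ => c (κ * u) (i + 1)) := fun u =>
    ⟨-(D.nNeg : ℤ), fun i hi => not_lt.1 fun hlt => hi (hc0 _ _ (D.degree_eq_bot_of_lt Q hlt))⟩
  -- The coefficient of `t^i` counts pairs with target in degree `i + 1`. So `R u` records the
  -- source of each pair, and the factor `1 + t q^{κu}` adds the target.
  let R : ℕ → LaurentSeries (LaurentPolynomial ℕ) := fun u =>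
    HahnSeries.ofSuppBddBelow (fun i : ℤ => c (κ * u) (i + 1)) (hbdd u)
  have hR : ∀ u i, (R u).coeff i = c (κ * u) (i + 1) := fun u i => rfl
  have hne : ∀ u : ℕ, R u ≠ 0 → ∃ i a,
      pairs (D.degree Q) (D.filt Q) (D.diffTot h t Q) (i + 1) a (a + κ * u) ≠ 0 := by
    intro u hu
    by_contra hcon
    push Not at hcon
    refine hu (HahnSeries.ext (funext fun i => ?_))
    rw [hR]
    exact Finset.sum_eq_zero fun a _ => by rw [hcon, zero_smul]
  have hN0 : ∀ u, N < u → R u = 0 := by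
    intro u hu
    by_contra h0
    obtain ⟨i, a, hia⟩ := hne u h0
    exact hia (C.pairs_eq_zero_of_gt hκ hN hu _ a)
  refine ⟨hfin 0 0, hfin h t, N, R, hN0, ?_, fun hmF => ⟨fun u _ => ?_, fun u hu h0 => ?_⟩⟩
  · rw [D.polynomial_eq P Q, D.polynomial_eq P Q]
    refine HahnSeries.ext (funext fun i => ?_)
    rw [HahnSeries.coeff_add, HahnSeries.coeff_sum]
    refine (C.sum_grRank_smul_T C₀ hκ hdvd hdvd₀ hself hN i).trans ?_
    congr 1
    refine Finset.sum_congr rfl fun u _ => ?_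
    rw [add_mul, one_mul, HahnSeries.coeff_add, HahnSeries.coeff_single_mul, hR, hR,
      sub_add_cancel]
  · refine (Set.finite_Icc (-(D.nNeg : ℤ)) (D.n - D.nNeg)).subset fun i hi => ?_
    have hi : c (κ * u) (i + 1) ≠ 0 := hi
    exact ⟨not_lt.1 fun hlt => hi (hc0 _ _ (D.degree_eq_bot_of_lt Q hlt)),
      not_lt.1 fun hlt => hi (hc0 _ _ (D.degree_eq_bot_of_gt Q (hQ0 hmF) hlt))⟩
  · obtain ⟨i, a, hia⟩ := hne u h0
    have huN : u ∈ Finset.Icc 1 N := Finset.mem_Icc.2 ⟨hu, not_lt.1 (mt (hN0 u) h0)⟩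
    -- By the comparison formula a pair contributes to the Khovanov rank at its source and at its
    -- target, so both ranks are nonzero.
    refine ⟨i, a, D.nontrivial_Kh_of_grEH Q (hQ0 hmF) ?_, D.nontrivial_Kh_of_grEH Q (hQ0 hmF) ?_⟩
    · have h1 := C.grRank_comparison C₀ hκ hdvd hdvd₀ hself hN i a
      have h2 := Finset.single_le_sum (f := fun u : ℕ =>
        pairs (D.degree Q) (D.filt Q) (D.diffTot h t Q) (i + 1) a (a + κ * u) +
        pairs (D.degree Q) (D.filt Q) (D.diffTot h t Q) i (a - κ * u) a)
        (fun _ _ => Nat.zero_le _) huN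
      rw [grRank_eq] at h1
      omega
    · have h1 := C.grRank_comparison C₀ hκ hdvd hdvd₀ hself hN (i + 1) (a + κ * u)
      have h2 := Finset.single_le_sum (f := fun v : ℕ =>
        pairs (D.degree Q) (D.filt Q) (D.diffTot h t Q) (i + 1 + 1) (a + κ * u)
          (a + κ * u + κ * v) +
        pairs (D.degree Q) (D.filt Q) (D.diffTot h t Q) (i + 1) (a + κ * u - κ * v) (a + κ * u))
        (fun _ _ => Nat.zero_le _) huN
      rw [grRank_eq] at h1
      simp only [add_sub_cancel_right] at h2
      omega

theorem exists_gen_of_nontrivial_Kh {D : GaussCode} {i j : ℤ} (hK : Nontrivial (D.Kh F i j)) :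
    ∃ r : ℕ, Nonempty (D.Gen r) ∧ (r : ℤ) - D.nNeg = i := by
  by_contra hcon
  push Not at hcon
  refine GaussCode.nontrivial_Kh_iff.1 hK ?_
  rintro f ⟨-, hf⟩
  have h0 : f = 0 := funext fun r => funext fun s => by
    by_contra hs
    exact hcon r ⟨s⟩ (hf r s hs).1
  rw [h0]
  exact Submodule.zero_mem _

end PeriodicDiagram

theorem mainTheorem9 {F : Type u} [Field F] (m : ℕ) (hm : 1 < m) (D : PeriodicDiagram m)
    (M : ModuleCat.{u} (PeriodicDiagram.GroupAlg F m))
    [Module.Finite (PeriodicDiagram.GroupAlg F m) M] (P : ProjectiveResolution M) :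
    (ringChar F ≠ 2 →
      (∀ i, FiniteDimensional F (D.EH (0 : F) 0 P i)) ∧
      (∀ i, FiniteDimensional F (D.EH (0 : F) 1 P i)) ∧
      ∃ (N : ℕ) (R : ℕ → LaurentSeries (LaurentPolynomial ℕ)),
        (∀ u, N < u → R u = 0) ∧
        D.polynomial (0 : F) 0 P = D.polynomial (0 : F) 1 P +
          ∑ u ∈ Finset.Icc 1 N,
            (1 + HahnSeries.single (1 : ℤ) (LaurentPolynomial.T (4 * (u : ℤ)))) * R u ∧
        ((m : F) ≠ 0 →
          (∀ u, 1 ≤ u → (R u).support.Finite) ∧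
          ∀ w : ℤ, D.HasWidth F w → ∀ u : ℕ, 1 ≤ u → w < 2 * (u : ℤ) → R u = 0)) ∧
    (ringChar F = 2 →
      (∀ i, FiniteDimensional F (D.EH (0 : F) 0 P i)) ∧
      (∀ i, FiniteDimensional F (D.EH (1 : F) 0 P i)) ∧
      ∃ (N : ℕ) (R : ℕ → LaurentSeries (LaurentPolynomial ℕ)),
        (∀ u, N < u → R u = 0) ∧
        D.polynomial (0 : F) 0 P = D.polynomial (1 : F) 0 P +
          ∑ u ∈ Finset.Icc 1 N,
            (1 + HahnSeries.single (1 : ℤ) (LaurentPolynomial.T (2 * (u : ℤ)))) * R u ∧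
        ((m : F) ≠ 0 →
          (∀ u, 1 ≤ u → (R u).support.Finite) ∧
          ∀ w : ℤ, D.HasWidth F w → ∀ u : ℕ, 1 ≤ u → w < (u : ℤ) → R u = 0)) := by
  refine ⟨fun _ => ?_, fun hchar => ?_⟩
  -- With `h = 0` only the entries with `t` raise the quantum degree, by 4.
  · obtain ⟨h1, h2, N, R, h3, h4, h5⟩ := D.polynomial_comparison (by omega) (0 : F) 1
      (κ := 4) (by norm_num) (fun r s s' h0 => by
        rcases GaussCode.IsPlanar.dCoeff_deg D.planar _ _ h0 with h | ⟨-, h⟩ | ⟨h, -⟩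
        · exact ⟨0, by omega⟩
        · exact absurd rfl h
        · exact ⟨1, by omega⟩) P
    refine ⟨h1, h2, N, R, h3, h4, fun hmF => ⟨(h5 hmF).1, fun w hw u hu hwu => ?_⟩⟩
    by_contra h0
    obtain ⟨i, a, hK, hK'⟩ := (h5 hmF).2 u hu h0
    -- The diagonals differ by `4u - 2`, so `4u - 2 ≤ w < 2u`, which is impossible for `u ≥ 1`.
    have := hw.2 ⟨_, _, _, _, hK', hK, rfl⟩
    omega
  · have : CharP F 2 := ringChar.of_eq hchar
    -- With `t = 0` only the entries with `h` raise the quantum degree, by 2.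
    obtain ⟨h1, h2, N, R, h3, h4, h5⟩ := D.polynomial_comparison (by omega) (1 : F) 0
      (κ := 2) (by norm_num) (fun r s s' h0 => by
        rcases GaussCode.IsPlanar.dCoeff_deg D.planar _ _ h0 with h | ⟨h, -⟩ | ⟨-, h⟩
        · exact ⟨0, by omega⟩
        · exact ⟨1, by omega⟩
        · exact absurd rfl h) P
    refine ⟨h1, h2, N, R, h3, h4, fun hmF => ⟨(h5 hmF).1, fun w hw u hu hwu => ?_⟩⟩
    by_contra h0
    obtain ⟨i, a, hK, hK'⟩ := (h5 hmF).2 u hu h0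
    have hw2 := hw.2 ⟨_, _, _, _, hK', hK, rfl⟩
    -- The bound `2u - 2 ≤ w < u` leaves only `u = 1`, `w = 0`. For a nonempty diagram a second
    -- group in the same homological degree, two quantum degrees away, gives `w ≥ 2`.
    by_cases he : Nonempty D.Arc
    · obtain ⟨e⟩ := he
      rcases GaussCode.IsPlanar.nontrivial_Kh_of_char_two D.planar e hK with hK2 | hK2
      · have := hw.2 ⟨_, _, _, _, hK2, hK, rfl⟩
        omega
      · have := hw.2 ⟨_, _, _, _, hK, hK2, rfl⟩
        omega
    -- The empty diagram has chains in one homological degree only, so there are no pairs between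
    -- degrees `i` and `i + 1`.
    · have hn : D.n = 0 := by
        by_contra hn
        exact he ⟨Sum.inl (⟨0, Nat.pos_of_ne_zero hn⟩, true)⟩
      obtain ⟨r, ⟨s⟩, hr⟩ := PeriodicDiagram.exists_gen_of_nontrivial_Kh hK
      obtain ⟨r', ⟨s'⟩, hr'⟩ := PeriodicDiagram.exists_gen_of_nontrivial_Kh hK'
      have := D.gen_le s
      have := D.gen_le s'
      omega
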